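/- Let $n \ge 2$, let $\Omega \subset \mathbb{R}^n$ be a bounded open set with $C^\infty$ boundary and outer unit normal $\nu$, let $q \in L^\infty(\Omega)$ (complex valued), and let $\varphi(x) = \pm x_1$. There exist constants $C_0, h_0 > 0$ such that for all $0 < h \le h_0$ and all $\delta > 0$ one has $$ \frac{\delta h^3}{C_0} \|\partial_\nu u\|^2_{L^2(\{\partial_\nu\varphi \le -\delta\})} + \frac{h^4}{C_0} \|\partial_\nu u\|^2_{L^2(\{-\delta < \partial_\nu\varphi < h/3\})} + \frac{h^2}{C_0}\left(\|u\|^2 + \|h\nabla u\|^2\right) \le \left\|e^{\varphi/h}(-h^2\Delta + h^2 q)(e^{-\varphi/h}u)\right\|^2 + h^3 \|\partial_\nu u\|^2_{L^2(\{\partial_\nu\varphi \ge h/3\})} $$ for every complex valued $u \in C^\infty(\overline\Omega)$ with $u|_{\partial\Omega} = 0$. Here $\|\cdot\|$ is the norm of $L^2(\Omega)$, the sets $\{\partial_\nu\varphi \le -\delta\}$, $\{-\delta < \partial_\nu\varphi < h/3\}$ and $\{\partial_\nu\varphi \ge h/3\}$ are subsets of $\partial\Omega$, and the $L^2$ norms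 on them are taken with respect to the surface measure of $\partial\Omega$. -/

import Mathlib

open MeasureTheory Topology
open scoped ContDiff ENNReal

noncomputable section

/-- `ρ` is a smooth function that cuts out `Ω` near `x`: close to `x`, the set `Ω` is `{ρ < 0}`,
and the gradient of `ρ` at `x` (hence also near `x`) is nonzero. -/
def IsLocalDefiningFunction {n : ℕ} (Ω : Set (EuclideanSpace ℝ (Fin n)))
    (x : EuclideanSpace ℝ (Fin n)) (ρ : EuclideanSpace ℝ (Fin n) → ℝ) : Prop :=
  ContDiff ℝ ∞ ρ ∧ gradient ρ x ≠ 0 ∧ ∀ᶠ y in 𝓝 x, (y ∈ Ω ↔ ρ y < 0)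

/-- The set `Ω` has `C^∞` boundary: near each boundary point it is the sublevel set of a smooth
function with nonvanishing gradient. (The boundary is then locally a smooth hypersurface, and `Ω`
lies locally on one side of it.) -/
def HasSmoothBoundary {n : ℕ} (Ω : Set (EuclideanSpace ℝ (Fin n))) : Prop :=
  ∀ x ∈ frontier Ω, ∃ ρ : EuclideanSpace ℝ (Fin n) → ℝ, IsLocalDefiningFunction Ω x ρ

open Classical in
/-- The outer unit normal `ν = ∇ρ / |∇ρ|` at a boundary point `x`, where `ρ` is any local defining
function of `Ω` at `x`; see `outerNormal_eq` for the independence of `ρ`.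
(If there is no local defining function the value is `0`.) -/
def outerNormal {n : ℕ} (Ω : Set (EuclideanSpace ℝ (Fin n))) (x : EuclideanSpace ℝ (Fin n)) :
    EuclideanSpace ℝ (Fin n) :=
  if h : ∃ ρ, IsLocalDefiningFunction Ω x ρ then
    ‖gradient h.choose x‖⁻¹ • gradient h.choose x
  else 0

/-- Near a boundary point, moving in a direction in which a defining function decreases leads into
`Ω`, so that another defining function cannot increase in this direction. -/
theorem IsLocalDefiningFunction.inner_nonpos {n : ℕ} {Ω : Set (EuclideanSpace ℝ (Fin n))}
    {x : EuclideanSpace ℝ (Fin n)} (hΩ : IsOpen Ω) (hx : x ∈ frontier Ω)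
    {ρ₁ ρ₂ : EuclideanSpace ℝ (Fin n) → ℝ} (h₁ : IsLocalDefiningFunction Ω x ρ₁)
    (h₂ : IsLocalDefiningFunction Ω x ρ₂) (w : EuclideanSpace ℝ (Fin n))
    (hw : inner ℝ (gradient ρ₁ x) w < 0) : inner ℝ (gradient ρ₂ x) w ≤ 0 := by
  have hzero : ∀ ρ, IsLocalDefiningFunction Ω x ρ → ρ x = 0 := by
    rintro ρ ⟨hs, -, he⟩
    have hxn : x ∉ Ω := by
      rw [hΩ.frontier_eq] at hx
      exact hx.2
    have h1 : 0 ≤ ρ x := by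
      by_contra hlt
      exact hxn (he.self_of_nhds.2 (not_le.1 hlt))
    refine le_antisymm ?_ h1
    by_contra hgt
    have hev : ∀ᶠ y in 𝓝 x, 0 < ρ y :=
      hs.continuous.continuousAt.eventually (lt_mem_nhds (not_le.1 hgt))
    have hcl : x ∈ closure Ω := frontier_subset_closure hx
    obtain ⟨y, hy, hyΩ⟩ := (mem_closure_iff_frequently.1 hcl).and_eventually (hev.and he) |>.exists
    exact absurd (hyΩ.2.1 hy) (not_lt.2 hyΩ.1.le)
  have hder : ∀ ρ, IsLocalDefiningFunction Ω x ρ →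
      HasDerivAt (fun t : ℝ => ρ (x + t • w)) (inner ℝ (gradient ρ x) w) 0 := by
    intro ρ hρ
    have hd : DifferentiableAt ℝ ρ x := (hρ.1.differentiable (by simp)) x
    have h1 : HasFDerivAt ρ (fderiv ℝ ρ x) (x + (0 : ℝ) • w) := by simpa using hd.hasFDerivAt
    have h2 : HasDerivAt (fun t : ℝ => x + t • w) w 0 := by
      simpa using ((hasDerivAt_id (0 : ℝ)).smul_const w).const_add x
    have h3 := h1.comp_hasDerivAt (0 : ℝ) h2
    have h4 : inner ℝ (gradient ρ x) w = fderiv ℝ ρ x w := by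
      simp [gradient]
    rw [h4]
    exact h3
  have hline : Filter.Tendsto (fun t : ℝ => x + t • w) (𝓝[>] 0) (𝓝 x) := by
    have : Continuous (fun t : ℝ => x + t • w) := by fun_prop
    have h := this.tendsto 0
    simp only [zero_smul, add_zero] at h
    exact h.mono_left nhdsWithin_le_nhds
  by_contra hpos
  rw [not_le] at hpos
  have s₁ := (hasDerivAt_iff_tendsto_slope.1 (hder ρ₁ h₁)).mono_left
    (nhdsWithin_mono (0 : ℝ) (fun t (ht : t ∈ Set.Ioi (0 : ℝ)) => (ne_of_gt ht : t ≠ 0)))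
  have s₂ := (hasDerivAt_iff_tendsto_slope.1 (hder ρ₂ h₂)).mono_left
    (nhdsWithin_mono (0 : ℝ) (fun t (ht : t ∈ Set.Ioi (0 : ℝ)) => (ne_of_gt ht : t ≠ 0)))
  have e₁ := s₁.eventually (gt_mem_nhds hw)
  have e₂ := s₂.eventually (lt_mem_nhds hpos)
  obtain ⟨t, ht1, ht2, ht3, ht4, ht5⟩ :=
    (e₁.and (e₂.and ((hline.eventually h₁.2.2).and ((hline.eventually h₂.2.2).and
      self_mem_nhdsWithin)))).exists
  have ht : (0 : ℝ) < t := ht5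
  simp only [slope_def_field, zero_smul, add_zero, hzero ρ₁ h₁, hzero ρ₂ h₂, sub_zero] at ht1 ht2
  have hneg : ρ₁ (x + t • w) < 0 := by
    by_contra hc
    exact absurd ht1 (not_lt.2 (div_nonneg (not_lt.1 hc) ht.le))
  have hp : 0 < ρ₂ (x + t • w) := by
    by_contra hc
    exact absurd ht2 (not_lt.2 (div_nonpos_of_nonpos_of_nonneg (not_lt.1 hc) ht.le))
  exact absurd (ht4.1 (ht3.2 hneg)) (not_lt.2 hp.le)

/-- The outer unit normal does not depend on the local defining function. -/
theorem outerNormal_eq {n : ℕ} {Ω : Set (EuclideanSpace ℝ (Fin n))}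
    {x : EuclideanSpace ℝ (Fin n)} (hΩ : IsOpen Ω) (hx : x ∈ frontier Ω)
    {ρ : EuclideanSpace ℝ (Fin n) → ℝ} (hρ : IsLocalDefiningFunction Ω x ρ) :
    outerNormal Ω x = ‖gradient ρ x‖⁻¹ • gradient ρ x := by
  have hex : ∃ ρ, IsLocalDefiningFunction Ω x ρ := ⟨ρ, hρ⟩
  rw [outerNormal, dif_pos hex]
  have h₂ := hex.choose_spec
  have key := fun w => hρ.inner_nonpos hΩ hx h₂ w
  set a := gradient ρ x with ha
  set b := gradient hex.choose x with hb
  have ha0 : a ≠ 0 := hρ.2.1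
  have hb0 : b ≠ 0 := h₂.2.1
  have han : 0 < ‖a‖ := norm_pos_iff.2 ha0
  have hbn : 0 < ‖b‖ := norm_pos_iff.2 hb0
  set a' := ‖a‖⁻¹ • a with ha'
  set b' := ‖b‖⁻¹ • b with hb'
  have na : ‖a'‖ = 1 := by rw [ha', norm_smul, norm_inv, norm_norm, inv_mul_cancel₀ han.ne']
  have nb : ‖b'‖ = 1 := by rw [hb', norm_smul, norm_inv, norm_norm, inv_mul_cancel₀ hbn.ne']
  by_contra hne
  -- the direction `b' - a'` decreases the first function and increases the second one
  have hlt : inner ℝ a' b' < 1 := by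
    rcases lt_or_eq_of_le (real_inner_le_norm a' b') with h | h
    · simpa [na, nb] using h
    · rw [na, nb, one_mul] at h
      exact absurd ((inner_eq_one_iff_of_norm_eq_one na nb).1 h).symm hne
  have hA : inner ℝ a (b' - a') = ‖a‖ * (inner ℝ a' b' - 1) := by
    have : a = ‖a‖ • a' := by rw [ha', smul_smul, mul_inv_cancel₀ han.ne', one_smul]
    conv_lhs => rw [this]
    rw [real_inner_smul_left, inner_sub_right, real_inner_self_eq_norm_sq, na]
    norm_num
  have hB : inner ℝ b (b' - a') = ‖b‖ * (1 - inner ℝ a' b') := by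
    have : b = ‖b‖ • b' := by rw [hb', smul_smul, mul_inv_cancel₀ hbn.ne', one_smul]
    conv_lhs => rw [this]
    rw [real_inner_smul_left, inner_sub_right, real_inner_self_eq_norm_sq, nb,
      real_inner_comm a' b']
    norm_num
  have h1 := key (b' - a') (by rw [hA]; exact mul_neg_of_pos_of_neg han (by linarith))
  rw [hB] at h1
  have h2 : 0 < ‖b‖ * (1 - inner ℝ a' b') := mul_pos hbn (by linarith)
  linarith

/-- The normal derivative `∂_ν f = ∇f · ν` on the boundary of `Ω`. -/
def normalDeriv {n : ℕ} {F : Type*} [NormedAddCommGroup F] [NormedSpace ℝ F]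
    (Ω : Set (EuclideanSpace ℝ (Fin n))) (f : EuclideanSpace ℝ (Fin n) → F)
    (x : EuclideanSpace ℝ (Fin n)) : F :=
  fderiv ℝ f x (outerNormal Ω x)

/-- The gradient `(∂_1 u, …, ∂_n u) ∈ ℂⁿ` of a complex valued function on `ℝⁿ`. -/
def complexGradient {n : ℕ} (u : EuclideanSpace ℝ (Fin n) → ℂ) (x : EuclideanSpace ℝ (Fin n)) :
    EuclideanSpace ℂ (Fin n) :=
  WithLp.toLp 2 fun j => fderiv ℝ u x (EuclideanSpace.single j 1)

/-- The surface measure on the boundary of `Ω ⊆ ℝⁿ`: the `(n-1)`-dimensional Hausdorff measure,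
normalized so as to agree with Lebesgue measure on hyperplanes. -/
def surfaceMeasure {n : ℕ} (Ω : Set (EuclideanSpace ℝ (Fin n))) :
    Measure (EuclideanSpace ℝ (Fin n)) :=
  (Measure.euclideanHausdorffMeasure (n - 1)).restrict (frontier Ω)

/-- The conjugated semiclassical operator `u ↦ e^{φ/h} (-h² Δ + h² q) (e^{-φ/h} u)`. -/
def conjugatedSchrodinger {n : ℕ} (φ : EuclideanSpace ℝ (Fin n) → ℝ)
    (q : EuclideanSpace ℝ (Fin n) → ℂ) (h : ℝ) (u : EuclideanSpace ℝ (Fin n) → ℂ)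
    (x : EuclideanSpace ℝ (Fin n)) : ℂ :=
  (Real.exp (φ x / h) : ℂ) *
    (-(h : ℂ) ^ 2 * Laplacian.laplacian (fun y => (Real.exp (-φ y / h) : ℂ) * u y) x +
      (h : ℂ) ^ 2 * q x * ((Real.exp (-φ x / h) : ℂ) * u x))

/-- The squared norm `‖f‖²_{L²(S, μ)}`, as an extended nonnegative real. -/
def sqNormL2 {X F : Type*} [MeasurableSpace X] [NormedAddCommGroup F]
    (f : X → F) (S : Set X) (μ : Measure X) : ℝ≥0∞ :=
  eLpNorm f 2 (μ.restrict S) ^ 2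

end

/-!
# A Carleman estimate with boundary terms for the weights `± x₁`

The weight is `c · x` for a unit vector `c`. The estimate follows from a positive commutator
argument with two modifications.

*Interior gain.* The linear weight is replaced by the convexified weight
`c · x + h K (c · x)² / 2`, whose derivative along `c` is `p = 1 + h K (c · x)`. The conjugated
operator has a symmetric part `-h² Δ - p²` and an antisymmetric part; their commutator contributes
`4 h² K ∫ p² w²` up to terms that are nonnegative, together with the boundary term
`2 h³ ∫ p (c · ν) |∂_ν w|²`. Passing back to the linear weight multiplies `w` by
`e^{K (c · x)² / 2}`, which is bounded above and below on `Ω` independently of `h`.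

*Boundary gain.* The remaining weight `h⁴ |∂_ν w|²` on `{∂_ν φ < h / 3}` comes from a second
multiplier: a smooth vector field `Z` with `Z · ν ≤ -1` on the boundary
(`exists_inward_vectorField`). Rellich's identity for `h⁴ Z` gives a boundary term at most
`-h⁴ ∫ |∂_ν w|²`, and its interior error, of size `h⁴ |∇w|²`, is paid for by Green's identity and a
large `K`. The boundary coefficient `2 h³ p (c · ν) - h⁴` is then at most `-h⁴ / 6` where
`c · ν < h / 3`, since `p ≤ 5 / 4`, and at most `-δ h³` where `c · ν ≤ -δ`, since `p ≥ 3 / 4`.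

Both arguments are integrations by parts (`IsBoundaryMeasure.integral_rellich`,
`IsBoundaryMeasure.integral_green`, `IsBoundaryMeasure.integral_transport`), combined by a single
pointwise inequality, `carleman_pointwise`, whose proof is a completion of squares. This gives
`IsBoundaryMeasure.carleman_real`. The real and imaginary parts of `u` are treated separately, and
the potential, of size `h²`, is absorbed for small `h`.

The divergence theorem is proved in local coordinates, where `Ω` is the subgraph of a `C¹` function
and a shear reduces the claim to a half space, and then glued by a partition of unity
(`exists_boundary_measure`). The boundary measure that results is the area element of the local
graphs. Its equality with the Hausdorff measure of the boundary would need the area formula. The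
estimate only needs the two measures to be comparable up to a constant, and this holds because the
local parametrizations are bi-Lipschitz.
-/

/-! ### Graphs of implicit functions -/

/-- Implicit function theorem in the form of a subgraph: near a zero of `F` at which the last
partial derivative is positive, `{F < 0}` is the part below the graph of a function `g`. A cut-off
makes `g` globally defined and Lipschitz. -/
theorem exists_graph_of_fderiv_pos {Y : Type*} [NormedAddCommGroup Y] [InnerProductSpace ℝ Y]
    [FiniteDimensional ℝ Y] {F : Y × ℝ → ℝ} (hF : ContDiff ℝ 1 F) {p₀ : Y × ℝ} (h0 : F p₀ = 0)
    (hpos : 0 < fderiv ℝ F p₀ (0, 1)) :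
    ∃ g : Y → ℝ, ContDiff ℝ 1 g ∧ (∃ K, LipschitzWith K g) ∧ ∃ U : Set (Y × ℝ), IsOpen U ∧ p₀ ∈ U ∧
      ∀ p ∈ U, (F p < 0 ↔ p.2 < g p.1) ∧ (F p = 0 ↔ p.2 = g p.1) ∧ 0 < fderiv ℝ F p (0, 1) := by
  have hinv : (fderiv ℝ F p₀ ∘L .inr ℝ Y ℝ).IsInvertible := by
    refine ⟨ContinuousLinearEquiv.unitsEquivAut ℝ (Units.mk0 _ hpos.ne'), ?_⟩
    ext
    simp
  set ψ := hF.contDiffAt.implicitFunction one_ne_zero hinv with hψ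
  have hψ0 : ψ p₀.1 = p₀.2 := hF.contDiffAt.implicitFunction_apply_self one_ne_zero hinv
  have hψe : ∀ᶠ y in 𝓝 p₀.1, F (y, ψ y) = 0 := by
    simpa [h0] using hF.contDiffAt.eventually_apply_implicitFunction one_ne_zero hinv
  have hψd : ContDiffAt ℝ 1 ψ p₀.1 := hF.contDiffAt.contDiffAt_implicitFunction one_ne_zero hinv
  have hψn : ∀ᶠ y in 𝓝 p₀.1, ContDiffAt ℝ 1 ψ y := hψd.eventually (by simp)
  obtain ⟨r, hr, hball⟩ := Metric.eventually_nhds_iff_ball.1 hψn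
  -- `b` cuts the implicit function off, since it is only known to be `C¹` near `p₀.1`
  let b : ContDiffBump p₀.1 := ⟨r / 4, r / 2, by linarith, by linarith⟩
  have hk : ContDiff ℝ 1 fun y => b y * (ψ y - p₀.2) := by
    rw [contDiff_iff_contDiffAt]
    intro y
    by_cases hy : y ∈ Metric.ball p₀.1 r
    · exact b.contDiffAt.mul ((hball y hy).sub contDiffAt_const)
    · have hy' : y ∉ tsupport b := by
        rw [b.tsupport_eq]
        intro h
        exact hy (Metric.closedBall_subset_ball (by change r / 2 < r; linarith) h)
      have : (fun y => b y * (ψ y - p₀.2)) =ᶠ[𝓝 y] fun _ => 0 := by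
        filter_upwards [notMem_tsupport_iff_eventuallyEq.1 hy'] with z hz
        simp [hz]
      exact contDiffAt_const.congr_of_eventuallyEq this
  have hks : HasCompactSupport fun y => b y * (ψ y - p₀.2) := b.hasCompactSupport.mul_right
  obtain ⟨K, hK⟩ := ContDiff.lipschitzWith_of_hasCompactSupport hks hk one_ne_zero
  refine ⟨fun y => p₀.2 + b y * (ψ y - p₀.2), contDiff_const.add hk, ⟨K, ?_⟩, ?_⟩
  · intro x y
    simpa using hK x y
  set g := fun y => p₀.2 + b y * (ψ y - p₀.2) with hg
  have hgψ : g =ᶠ[𝓝 p₀.1] ψ := by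
    filter_upwards [b.eventuallyEq_one] with y hy
    simp [hg, hy]
  have hgc : ContinuousAt g p₀.1 := (contDiff_const.add hk).continuous.continuousAt
  have hg0 : g p₀.1 = p₀.2 := by simp [hg, hψ0]
  have hdc : Continuous fun p => fderiv ℝ F p (0, 1) :=
    (hF.continuous_fderiv one_ne_zero).clm_apply continuous_const
  obtain ⟨R, hR, hRpos⟩ := Metric.eventually_nhds_iff_ball.1
    (hdc.continuousAt.eventually (lt_mem_nhds hpos))
  have hev : ∀ᶠ y in 𝓝 p₀.1, F (y, g y) = 0 ∧ g y ∈ Metric.ball p₀.2 R := by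
    have h1 : ∀ᶠ y in 𝓝 p₀.1, g y ∈ Metric.ball p₀.2 R :=
      hgc (by rw [hg0]; exact Metric.ball_mem_nhds _ hR)
    filter_upwards [h1, hgψ, hψe] with y h1 h2 h3
    exact ⟨by rw [h2]; exact h3, h1⟩
  obtain ⟨r', hr', hball'⟩ := Metric.eventually_nhds_iff_ball.1 hev
  have hRpos' : ∀ y t, y ∈ Metric.ball p₀.1 (min r' R) → t ∈ Metric.ball p₀.2 R →
      0 < fderiv ℝ F (y, t) (0, 1) := by
    intro y t hy ht
    apply hRpos
    rw [← Prod.mk.eta (p := p₀), ← ball_prod_same]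
    exact ⟨Metric.ball_subset_ball (min_le_right _ _) hy, ht⟩
  refine ⟨Metric.ball p₀.1 (min r' R) ×ˢ Metric.ball p₀.2 R, Metric.isOpen_ball.prod
    Metric.isOpen_ball, ⟨Metric.mem_ball_self (lt_min hr' hR), Metric.mem_ball_self hR⟩, ?_⟩
  rintro ⟨y, t⟩ ⟨hy, ht⟩
  obtain ⟨hFg, hgR⟩ := hball' y (Metric.ball_subset_ball (min_le_left _ _) hy)
  have hmono : StrictMonoOn (fun t => F (y, t)) (Metric.ball p₀.2 R) := by
    apply strictMonoOn_of_deriv_pos (convex_ball _ _)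
    · exact (hF.continuous.comp (by fun_prop)).continuousOn
    · intro s hs
      rw [Metric.isOpen_ball.interior_eq] at hs
      have h1 : HasDerivAt (fun t : ℝ => (y, t)) ((0 : Y), (1 : ℝ)) s :=
        (hasDerivAt_const s y).prodMk (hasDerivAt_id s)
      have h2 := ((hF.differentiable one_ne_zero) (y, s)).hasFDerivAt.comp_hasDerivAt s h1
      have h3 : deriv (fun t => F (y, t)) s = fderiv ℝ F (y, s) (0, 1) := h2.deriv
      rw [h3]
      exact hRpos' y s hy hs
  refine ⟨?_, ?_, hRpos' y t hy ht⟩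
  · rw [← hFg]
    exact hmono.lt_iff_lt ht hgR
  · rw [← hFg]
    exact hmono.injOn.eq_iff ht hgR

/-! ### The divergence theorem on a subgraph -/

theorem integral_fderiv_eq_zero_of_hasCompactSupport {E : Type*} [NormedAddCommGroup E]
    [NormedSpace ℝ E] [FiniteDimensional ℝ E] [MeasurableSpace E] [BorelSpace E]
    (μ : Measure E) [μ.IsAddHaarMeasure] {f : E → ℝ} (hf : ContDiff ℝ 1 f)
    (hs : HasCompactSupport f) (v : E) : ∫ x, fderiv ℝ f x v ∂μ = 0 := by
  have hc : Continuous fun x => fderiv ℝ f x v :=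
    (hf.continuous_fderiv one_ne_zero).clm_apply continuous_const
  have hcs : HasCompactSupport fun x => fderiv ℝ f x v := hs.fderiv_apply ℝ v
  have h := integral_mul_fderiv_eq_neg_fderiv_mul_of_integrable (μ := μ) (f := fun _ : E => (1 : ℝ))
    (g := f) (v := v) (by simp) (by simpa using hc.integrable_of_hasCompactSupport hcs)
    (by simpa using hf.continuous.integrable_of_hasCompactSupport hs)
    (fun x _ => differentiableAt_const _) (fun x _ => hf.differentiable one_ne_zero x)
  simpa using h

/-- The shear `(y, s) ↦ (y, s + g y)`, which flattens the subgraph of `g`. -/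
def shearHomeomorph {Y : Type*} [TopologicalSpace Y] (g : Y → ℝ) (hg : Continuous g) :
    Y × ℝ ≃ₜ Y × ℝ where
  toFun p := (p.1, p.2 + g p.1)
  invFun p := (p.1, p.2 - g p.1)
  left_inv p := by simp
  right_inv p := by simp
  continuous_toFun := by fun_prop
  continuous_invFun := by fun_prop

/-- Divergence theorem for a constant vector field times a function on the subgraph of `g`; the
vector `(-∇g, 1)` is the outer normal times the area element. -/
theorem integral_fderiv_subgraph {Y : Type*} [NormedAddCommGroup Y] [InnerProductSpace ℝ Y]
    [FiniteDimensional ℝ Y] [MeasurableSpace Y] [BorelSpace Y] (μ : Measure Y) [μ.IsAddHaarMeasure]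
    {g : Y → ℝ} (hg : ContDiff ℝ 1 g) {f : Y × ℝ → ℝ} (hf : ContDiff ℝ 1 f)
    (hs : HasCompactSupport f) (a : Y) (b : ℝ) :
    ∫ p in {p : Y × ℝ | p.2 < g p.1}, fderiv ℝ f p (a, b) ∂(μ.prod volume) =
      ∫ y, f (y, g y) * (b - fderiv ℝ g y a) ∂μ := by
  set S := shearHomeomorph g hg.continuous with hS
  have hSapp : ∀ p, S p = (p.1, p.2 + g p.1) := fun _ => rfl
  have hmp : MeasurePreserving S (μ.prod volume) (μ.prod volume) := by
    refine (MeasurePreserving.id μ).skew_product (g := fun y s => s + g y)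
      (by have := hg.continuous; exact Continuous.measurable (by fun_prop)) ?_
    exact Filter.Eventually.of_forall fun y => map_add_right_eq_self volume (g y)
  have hpre : S ⁻¹' {p : Y × ℝ | p.2 < g p.1} = Set.univ ×ˢ Set.Iio 0 := by
    ext p
    simp [hSapp]
  have hSd : ContDiff ℝ 1 S := by
    change ContDiff ℝ 1 fun p : Y × ℝ => (p.1, p.2 + g p.1)
    fun_prop
  set F := f ∘ S with hF
  have hFd : ContDiff ℝ 1 F := hf.comp hSd
  have hFs : HasCompactSupport F := hs.comp_homeomorph S
  have hSf : ∀ q c d, fderiv ℝ S q (c, d) = (c, d + fderiv ℝ g q.1 c) := by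
    intro q c d
    have h1 : HasFDerivAt (fun p : Y × ℝ => g p.1) ((fderiv ℝ g q.1).comp (.fst ℝ Y ℝ)) q :=
      ((hg.differentiable one_ne_zero) q.1).hasFDerivAt.comp q hasFDerivAt_fst
    have h2 : HasFDerivAt S ((ContinuousLinearMap.fst ℝ Y ℝ).prod
        (.snd ℝ Y ℝ + (fderiv ℝ g q.1).comp (.fst ℝ Y ℝ))) q :=
      hasFDerivAt_fst.prodMk (hasFDerivAt_snd.add h1)
    rw [h2.fderiv]
    simp
  have hFf : ∀ q, fderiv ℝ f (S q) (a, b) =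
      fderiv ℝ F q (a, 0) + (b - fderiv ℝ g q.1 a) * fderiv ℝ F q (0, 1) := by
    intro q
    have h1 : fderiv ℝ F q = (fderiv ℝ f (S q)).comp (fderiv ℝ S q) :=
      fderiv_comp q (hf.differentiable one_ne_zero _) (hSd.differentiable one_ne_zero _)
    rw [h1, ContinuousLinearMap.comp_apply, ContinuousLinearMap.comp_apply, hSf, hSf,
      ← smul_eq_mul, ← map_smul, ← map_add]
    simp
  -- In the sheared coordinates the domain is a half space: the horizontal derivative integrates to
  -- zero, and the vertical one to the boundary value.
  rw [← hmp.setIntegral_preimage_emb S.measurableEmbedding, hpre]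
  simp_rw [hFf]
  have hc : ∀ v, Continuous fun q => fderiv ℝ F q v := fun v =>
    (hFd.continuous_fderiv one_ne_zero).clm_apply continuous_const
  have hcs : ∀ v, HasCompactSupport fun q => fderiv ℝ F q v := fun v => hFs.fderiv_apply ℝ v
  have hgc : Continuous fun q : Y × ℝ => b - fderiv ℝ g q.1 a :=
    continuous_const.sub (((hg.continuous_fderiv one_ne_zero).comp continuous_fst).clm_apply
      continuous_const)
  have i1 : Integrable (fun q => fderiv ℝ F q (a, 0)) (μ.prod volume) :=
    (hc _).integrable_of_hasCompactSupport (hcs _)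
  have i2 : Integrable (fun q => (b - fderiv ℝ g q.1 a) * fderiv ℝ F q (0, 1)) (μ.prod volume) :=
    (hgc.mul (hc _)).integrable_of_hasCompactSupport (hcs _).mul_left
  rw [integral_add i1.integrableOn i2.integrableOn]
  have z1 : ∫ q in Set.univ ×ˢ Set.Iio 0, fderiv ℝ F q (a, 0) ∂(μ.prod volume) = 0 := by
    have i1' : Integrable (fun q => fderiv ℝ F q (a, 0))
        (μ.prod (volume.restrict (Set.Iio (0 : ℝ)))) := by
      have := i1.integrableOn (s := Set.univ ×ˢ Set.Iio 0)
      rwa [IntegrableOn, ← Measure.prod_restrict, Measure.restrict_univ] at this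
    rw [← Measure.prod_restrict, Measure.restrict_univ, integral_prod_symm _ i1']
    refine integral_eq_zero_of_ae (Filter.Eventually.of_forall fun t => ?_)
    have hemb : Topology.IsClosedEmbedding fun y : Y => (y, t) :=
      ⟨isEmbedding_prodMkLeft t, by
        have : Set.range (fun y : Y => (y, t)) = Set.univ ×ˢ {t} := by
          ext ⟨y, s⟩
          simp [eq_comm]
        rw [this]
        exact isClosed_univ.prod isClosed_singleton⟩
    have hd : ContDiff ℝ 1 fun y => F (y, t) := hFd.comp (by fun_prop)
    have h := integral_fderiv_eq_zero_of_hasCompactSupport μ hd (hFs.comp_isClosedEmbedding hemb) a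
    change ∫ y, fderiv ℝ F (y, t) (a, 0) ∂μ = 0
    refine Eq.trans (integral_congr_ae (Filter.Eventually.of_forall fun y => ?_)) h
    have h1 : HasFDerivAt (fun y : Y => (y, t)) (.inl ℝ Y ℝ) y := by
      simpa using! hasFDerivAt_prodMk_left y t
    have h2 := (hFd.differentiable one_ne_zero (y, t)).hasFDerivAt.comp y h1
    have h3 : fderiv ℝ (fun y => F (y, t)) y = _ := h2.fderiv
    simp only [h3]
    simp
  rw [z1, zero_add, setIntegral_prod _ i2.integrableOn, Measure.restrict_univ]
  congr 1
  ext y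
  simp only
  rw [integral_const_mul, mul_comm]
  congr 1
  have hd : ContDiff ℝ 1 fun t => F (y, t) := hFd.comp (by fun_prop)
  have hemb : Topology.IsClosedEmbedding fun t : ℝ => (y, t) :=
    ⟨isEmbedding_prodMkRight y, by
      have : Set.range (fun t : ℝ => (y, t)) = {y} ×ˢ Set.univ := by
        ext ⟨z, s⟩
        simp [eq_comm]
      rw [this]
      exact isClosed_singleton.prod isClosed_univ⟩
  have h := (hFs.comp_isClosedEmbedding hemb).integral_Iic_deriv_eq hd 0
  rw [integral_Iic_eq_integral_Iio] at h
  have h0 : F (y, 0) = f (y, g y) := by simp [hF, hSapp]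
  rw [← h0, ← h]
  congr 1
  ext t
  have h1 : HasDerivAt (fun t : ℝ => (y, t)) ((0 : Y), (1 : ℝ)) t :=
    (hasDerivAt_const t y).prodMk (hasDerivAt_id t)
  exact (((hFd.differentiable one_ne_zero) (y, t)).hasFDerivAt.comp_hasDerivAt t h1).deriv.symm

/-! ### Graph charts of a smooth boundary -/

/-- In the linear coordinates `L`, the set `Ω` is, inside `U`, the part below the graph of the
Lipschitz `C¹` function `g`. The last two fields relate the outer normal to the conormal
`(-∇g, 1)` of the graph. -/
structure IsGraphChart {n : ℕ} (Ω : Set (EuclideanSpace ℝ (Fin n))) {Y : Type*}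
    [NormedAddCommGroup Y] [InnerProductSpace ℝ Y]
    (L : (Y × ℝ) ≃L[ℝ] EuclideanSpace ℝ (Fin n)) (g : Y → ℝ)
    (U : Set (EuclideanSpace ℝ (Fin n))) : Prop where
  isOpen : IsOpen U
  contDiff : ContDiff ℝ 1 g
  lipschitz : ∃ K, LipschitzWith K g
  mem_iff : ∀ x ∈ U, (x ∈ Ω ↔ (L.symm x).2 < g (L.symm x).1)
  mem_frontier_iff : ∀ x ∈ U, (x ∈ frontier Ω ↔ (L.symm x).2 = g (L.symm x).1)
  continuousOn_normal : ContinuousOn (outerNormal Ω) (U ∩ frontier Ω)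
  norm_normal : ∀ x ∈ U ∩ frontier Ω, ‖outerNormal Ω x‖ = 1
  normal_eq : ∀ x ∈ U ∩ frontier Ω, ∃ κ : ℝ, 0 < κ ∧ ∀ v, inner ℝ (outerNormal Ω x) v =
    κ * ((L.symm v).2 - fderiv ℝ g (L.symm x).1 (L.symm v).1)

theorem IsGraphChart.mono {n : ℕ} {Ω : Set (EuclideanSpace ℝ (Fin n))} {Y : Type*}
    [NormedAddCommGroup Y] [InnerProductSpace ℝ Y]
    {L : (Y × ℝ) ≃L[ℝ] EuclideanSpace ℝ (Fin n)} {g : Y → ℝ}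
    {U V : Set (EuclideanSpace ℝ (Fin n))} (h : IsGraphChart Ω L g U) (hV : IsOpen V)
    (hVU : V ⊆ U) : IsGraphChart Ω L g V where
  isOpen := hV
  contDiff := h.contDiff
  lipschitz := h.lipschitz
  mem_iff x hx := h.mem_iff x (hVU hx)
  mem_frontier_iff x hx := h.mem_frontier_iff x (hVU hx)
  continuousOn_normal := h.continuousOn_normal.mono (Set.inter_subset_inter_left _ hVU)
  norm_normal x hx := h.norm_normal x ⟨hVU hx.1, hx.2⟩
  normal_eq x hx := h.normal_eq x ⟨hVU hx.1, hx.2⟩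

theorem IsLocalDefiningFunction.eq_zero {n : ℕ} {Ω : Set (EuclideanSpace ℝ (Fin n))}
    {x : EuclideanSpace ℝ (Fin n)} (hΩ : IsOpen Ω) (hx : x ∈ frontier Ω)
    {ρ : EuclideanSpace ℝ (Fin n) → ℝ} (hρ : IsLocalDefiningFunction Ω x ρ) : ρ x = 0 := by
  obtain ⟨hs, -, he⟩ := hρ
  have hxn : x ∉ Ω := by
    rw [hΩ.frontier_eq] at hx
    exact hx.2
  refine le_antisymm ?_ (not_lt.1 fun hlt => hxn (he.self_of_nhds.2 hlt))
  by_contra hgt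
  have hev : ∀ᶠ y in 𝓝 x, 0 < ρ y :=
    hs.continuous.continuousAt.eventually (lt_mem_nhds (not_le.1 hgt))
  obtain ⟨y, hy, hyΩ⟩ := (mem_closure_iff_frequently.1
    (frontier_subset_closure hx)).and_eventually (hev.and he) |>.exists
  exact absurd (hyΩ.2.1 hy) (not_lt.2 hyΩ.1.le)

/-- A local defining function that increases in the vertical direction of the coordinates `L`
gives a graph chart. -/
theorem IsLocalDefiningFunction.exists_isGraphChart {n : ℕ}
    {Ω : Set (EuclideanSpace ℝ (Fin n))} (hΩ : IsOpen Ω) {x₀ : EuclideanSpace ℝ (Fin n)}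
    (hx₀ : x₀ ∈ frontier Ω) {ρ : EuclideanSpace ℝ (Fin n) → ℝ}
    (hρ : IsLocalDefiningFunction Ω x₀ ρ) {Y : Type*} [NormedAddCommGroup Y]
    [InnerProductSpace ℝ Y] [FiniteDimensional ℝ Y]
    (L : (Y × ℝ) ≃L[ℝ] EuclideanSpace ℝ (Fin n)) (hL : 0 < fderiv ℝ ρ x₀ (L (0, 1))) :
    ∃ g U, IsGraphChart Ω L g U ∧ x₀ ∈ U := by
  have hρd : Differentiable ℝ ρ := hρ.1.differentiable (by simp)
  have hF : ContDiff ℝ 1 (ρ ∘ L) := (hρ.1.of_le (by norm_cast)).comp L.contDiff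
  have hFd : ∀ p q, fderiv ℝ (ρ ∘ L) p q = fderiv ℝ ρ (L p) (L q) := by
    intro p q
    rw [L.comp_right_fderiv]
    rfl
  obtain ⟨g, hg, hgL, U, hU, hpU, h⟩ := exists_graph_of_fderiv_pos hF (p₀ := L.symm x₀)
    (by simp [hρ.eq_zero hΩ hx₀]) (by simpa [hFd] using hL)
  obtain ⟨W, hWs, hW, hxW⟩ := eventually_nhds_iff.1 hρ.2.2
  have hV : IsOpen (W ∩ L.symm ⁻¹' U) := hW.inter (hU.preimage L.symm.continuous)
  have hdef : ∀ x ∈ W ∩ L.symm ⁻¹' U, IsLocalDefiningFunction Ω x ρ := by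
    intro x hx
    refine ⟨hρ.1, ?_, Filter.eventually_of_mem (hW.mem_nhds hx.1) hWs⟩
    intro h0
    have := (h _ hx.2).2.2
    rw [hFd, ← inner_gradient_left] at this
    simp [h0] at this
  have hmem : ∀ x ∈ W ∩ L.symm ⁻¹' U, (x ∈ Ω ↔ (L.symm x).2 < g (L.symm x).1) := by
    intro x hx
    rw [hWs x hx.1, ← (h _ hx.2).1]
    simp
  have hfr : ∀ x ∈ W ∩ L.symm ⁻¹' U, (x ∈ frontier Ω ↔ (L.symm x).2 = g (L.symm x).1) := by
    intro x hx
    constructor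
    · intro hxf
      rw [← (h _ hx.2).2.1]
      simpa using (hdef x hx).eq_zero hΩ hxf
    · -- a point of the graph is the limit of the points right below it, which lie in `Ω`
      intro hxg
      rw [hΩ.frontier_eq]
      refine ⟨?_, fun hxΩ => ((hmem x hx).1 hxΩ).ne hxg⟩
      have hc : Continuous fun t : ℝ => L ((L.symm x).1, (L.symm x).2 - t) := by fun_prop
      have ht : Filter.Tendsto (fun t : ℝ => L ((L.symm x).1, (L.symm x).2 - t)) (𝓝[>] 0)
          (𝓝 x) := by
        have := hc.tendsto 0
        simp only [sub_zero, Prod.mk.eta, ContinuousLinearEquiv.apply_symm_apply] at this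
        exact this.mono_left nhdsWithin_le_nhds
      refine mem_closure_of_tendsto ht ?_
      filter_upwards [ht.eventually (hV.mem_nhds hx), self_mem_nhdsWithin] with t ht1 ht2
      rw [hmem _ ht1]
      simpa [hxg] using ht2
  -- `ρ ∘ L` vanishes along the graph, so its derivative is a multiple of the conormal of the graph
  have hder : ∀ x ∈ (W ∩ L.symm ⁻¹' U) ∩ frontier Ω, ∀ v, fderiv ℝ ρ x v =
      ((L.symm v).2 - fderiv ℝ g (L.symm x).1 (L.symm v).1) * fderiv ℝ ρ x (L (0, 1)) := by
    rintro x ⟨hx, hxf⟩ v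
    set y := (L.symm x).1 with hy
    have hxg := (hfr x hx).1 hxf
    have hpx : L.symm x = (y, g y) := Prod.ext rfl hxg
    have hev : (fun z => (ρ ∘ L) (z, g z)) =ᶠ[𝓝 y] fun _ => 0 := by
      have hc : ContinuousAt (fun z => (z, g z)) y := by
        have := hg.continuous
        fun_prop
      filter_upwards [hc (hU.mem_nhds (show (y, g y) ∈ U by rw [← hpx]; exact hx.2))] with z hz
      exact (h _ hz).2.1.2 rfl
    have hG : HasFDerivAt (fun z => (z, g z))
        ((ContinuousLinearMap.id ℝ Y).prod (fderiv ℝ g y)) y :=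
      (hasFDerivAt_id y).prodMk ((hg.differentiable one_ne_zero) y).hasFDerivAt
    have h1 := ((hF.differentiable one_ne_zero) (y, g y)).hasFDerivAt.comp y hG
    have h2 : HasFDerivAt ((ρ ∘ L) ∘ fun z => (z, g z)) (0 : Y →L[ℝ] ℝ) y :=
      (hasFDerivAt_const (0 : ℝ) y).congr_of_eventuallyEq hev
    have h3 := congrArg (fun T => T (L.symm v).1) (h1.unique h2)
    simp only [ContinuousLinearMap.comp_apply, ContinuousLinearMap.prod_apply,
      ContinuousLinearMap.id_apply, _root_.zero_apply] at h3
    rw [hFd, ← hpx, ContinuousLinearEquiv.apply_symm_apply] at h3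
    have h4 : v = L ((L.symm v).1, fderiv ℝ g y (L.symm v).1) +
        ((L.symm v).2 - fderiv ℝ g y (L.symm v).1) • L (0, 1) := by
      rw [← map_smul, ← map_add]
      simp
    conv_lhs => rw [h4]
    rw [map_add, h3, map_smul, zero_add, smul_eq_mul]
  have hnorm : ∀ x ∈ (W ∩ L.symm ⁻¹' U) ∩ frontier Ω,
      outerNormal Ω x = ‖gradient ρ x‖⁻¹ • gradient ρ x :=
    fun x hx => outerNormal_eq hΩ hx.2 (hdef x hx.1)
  refine ⟨g, W ∩ L.symm ⁻¹' U, ⟨hV, hg, hgL, hmem, hfr, ?_, ?_, ?_⟩, hxW, hpU⟩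
  · have hgc : Continuous (gradient ρ) :=
      (InnerProductSpace.toDual ℝ _).symm.continuous.comp (hρ.1.continuous_fderiv (by simp))
    refine ContinuousOn.congr (ContinuousOn.smul (ContinuousOn.inv₀ hgc.norm.continuousOn ?_)
      hgc.continuousOn) hnorm
    exact fun x hx => norm_ne_zero_iff.2 (hdef x hx.1).2.1
  · intro x hx
    have := norm_ne_zero_iff.2 (hdef x hx.1).2.1
    rw [hnorm x hx, norm_smul, norm_inv, norm_norm, inv_mul_cancel₀ this]
  · intro x hx
    have h0 : 0 < ‖gradient ρ x‖ := norm_pos_iff.2 (hdef x hx.1).2.1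
    have h1 : 0 < fderiv ℝ ρ x (L (0, 1)) := by
      have := (h _ hx.1.2).2.2
      rwa [hFd, ContinuousLinearEquiv.apply_symm_apply] at this
    refine ⟨‖gradient ρ x‖⁻¹ * fderiv ℝ ρ x (L (0, 1)), by positivity, fun v => ?_⟩
    rw [hnorm x hx, real_inner_smul_left, inner_gradient_left, hder x hx v]
    ring

/-- The tangential derivatives at a boundary point of a function that vanishes on the boundary are
zero, because they are derivatives along the graph. -/
theorem IsGraphChart.fderiv_eq {n : ℕ} {Ω : Set (EuclideanSpace ℝ (Fin n))} {Y : Type*}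
    [NormedAddCommGroup Y] [InnerProductSpace ℝ Y]
    {L : (Y × ℝ) ≃L[ℝ] EuclideanSpace ℝ (Fin n)} {g : Y → ℝ}
    {U : Set (EuclideanSpace ℝ (Fin n))} (h : IsGraphChart Ω L g U)
    {w : EuclideanSpace ℝ (Fin n) → ℝ} (hw : Differentiable ℝ w)
    (hw0 : ∀ x ∈ frontier Ω, w x = 0) {x : EuclideanSpace ℝ (Fin n)} (hx : x ∈ U ∩ frontier Ω)
    (v : EuclideanSpace ℝ (Fin n)) :
    fderiv ℝ w x v = normalDeriv Ω w x * inner ℝ (outerNormal Ω x) v := by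
  obtain ⟨κ, hκ, hn⟩ := h.normal_eq x hx
  set y := (L.symm x).1 with hy
  have hxg := (h.mem_frontier_iff x hx.1).1 hx.2
  have hpx : L (y, g y) = x := by
    rw [← (Prod.ext rfl hxg : L.symm x = (y, g y)), L.apply_symm_apply]
  have htan : ∀ v, inner ℝ (outerNormal Ω x) v = 0 → fderiv ℝ w x v = 0 := by
    intro v hv
    rw [hn, mul_eq_zero, or_iff_right hκ.ne', sub_eq_zero] at hv
    have hG : HasFDerivAt (fun z => L (z, g z))
        ((L : (Y × ℝ) →L[ℝ] _).comp ((ContinuousLinearMap.id ℝ Y).prod (fderiv ℝ g y))) y :=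
      L.hasFDerivAt.comp y ((hasFDerivAt_id y).prodMk
        ((h.contDiff.differentiable one_ne_zero) y).hasFDerivAt)
    have h1 := (hw (L (y, g y))).hasFDerivAt.comp y hG
    have hev : (w ∘ fun z => L (z, g z)) =ᶠ[𝓝 y] fun _ => 0 := by
      have hc : ContinuousAt (fun z => L (z, g z)) y := hG.continuousAt
      filter_upwards [hc (h.isOpen.mem_nhds (show L (y, g y) ∈ U by rw [hpx]; exact hx.1))]
        with z hz
      exact hw0 _ ((h.mem_frontier_iff _ hz).2 (by simp))
    have h2 : HasFDerivAt (w ∘ fun z => L (z, g z)) (0 : Y →L[ℝ] ℝ) y :=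
      (hasFDerivAt_const (0 : ℝ) y).congr_of_eventuallyEq hev
    have h3 := congrArg (fun T => T (L.symm v).1) (h1.unique h2)
    have h4 : L ((L.symm v).1, fderiv ℝ g y (L.symm v).1) = v := by
      rw [← (Prod.ext rfl hv : L.symm v = ((L.symm v).1, fderiv ℝ g y (L.symm v).1)),
        L.apply_symm_apply]
    simp only [ContinuousLinearMap.comp_apply, ContinuousLinearMap.prod_apply,
      ContinuousLinearMap.id_apply, _root_.zero_apply, hpx] at h3
    rwa [ContinuousLinearEquiv.coe_coe, h4] at h3
  have h5 := htan (v - inner ℝ (outerNormal Ω x) v • outerNormal Ω x) (by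
    rw [inner_sub_right, real_inner_smul_right, real_inner_self_eq_norm_sq, h.norm_normal x hx]
    ring)
  rw [map_sub, map_smul, sub_eq_zero, smul_eq_mul] at h5
  rw [h5, normalDeriv, mul_comm]

/-- The conormal `(-∇g, 1)` of the graph of `g` in the coordinates `L`, as the vector that
represents the functional `v ↦ (L⁻¹ v).2 - Dg (L⁻¹ v).1`. -/
noncomputable def graphConormal {n : ℕ} {Y : Type*} [NormedAddCommGroup Y] [InnerProductSpace ℝ Y]
    (L : (Y × ℝ) ≃L[ℝ] EuclideanSpace ℝ (Fin n)) (g : Y → ℝ) (y : Y) :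
    EuclideanSpace ℝ (Fin n) :=
  (InnerProductSpace.toDual ℝ _).symm (((ContinuousLinearMap.snd ℝ Y ℝ) -
    (fderiv ℝ g y).comp (ContinuousLinearMap.fst ℝ Y ℝ)).comp (L.symm : _ →L[ℝ] Y × ℝ))

theorem inner_graphConormal {n : ℕ} {Y : Type*} [NormedAddCommGroup Y] [InnerProductSpace ℝ Y]
    (L : (Y × ℝ) ≃L[ℝ] EuclideanSpace ℝ (Fin n)) (g : Y → ℝ) (y : Y)
    (v : EuclideanSpace ℝ (Fin n)) :
    inner ℝ (graphConormal L g y) v = (L.symm v).2 - fderiv ℝ g y (L.symm v).1 := by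
  rw [graphConormal, InnerProductSpace.toDual_symm_apply]
  simp

theorem graphConormal_ne_zero {n : ℕ} {Y : Type*} [NormedAddCommGroup Y] [InnerProductSpace ℝ Y]
    (L : (Y × ℝ) ≃L[ℝ] EuclideanSpace ℝ (Fin n)) (g : Y → ℝ) (y : Y) :
    graphConormal L g y ≠ 0 := by
  intro h
  have := inner_graphConormal L g y (L (0, 1))
  simp [h] at this

theorem continuous_graphConormal {n : ℕ} {Y : Type*} [NormedAddCommGroup Y]
    [InnerProductSpace ℝ Y] (L : (Y × ℝ) ≃L[ℝ] EuclideanSpace ℝ (Fin n)) {g : Y → ℝ}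
    (hg : ContDiff ℝ 1 g) : Continuous (graphConormal L g) := by
  refine (InnerProductSpace.toDual ℝ _).symm.continuous.comp ?_
  exact (continuous_const.sub ((hg.continuous_fderiv one_ne_zero).clm_comp
    continuous_const)).clm_comp continuous_const

/-- The conormal of the graph points in the direction of the outer normal. -/
theorem IsGraphChart.norm_smul_normal {n : ℕ} {Ω : Set (EuclideanSpace ℝ (Fin n))} {Y : Type*}
    [NormedAddCommGroup Y] [InnerProductSpace ℝ Y]
    {L : (Y × ℝ) ≃L[ℝ] EuclideanSpace ℝ (Fin n)} {g : Y → ℝ}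
    {U : Set (EuclideanSpace ℝ (Fin n))} (h : IsGraphChart Ω L g U)
    {x : EuclideanSpace ℝ (Fin n)} (hx : x ∈ U ∩ frontier Ω) :
    ‖graphConormal L g (L.symm x).1‖ • outerNormal Ω x = graphConormal L g (L.symm x).1 := by
  obtain ⟨κ, hκ, hn⟩ := h.normal_eq x hx
  have h1 : outerNormal Ω x = κ • graphConormal L g (L.symm x).1 := by
    refine ext_inner_right ℝ fun v => ?_
    rw [hn, real_inner_smul_left, inner_graphConormal]
  have h2 := h.norm_normal x hx
  rw [h1, norm_smul, Real.norm_of_nonneg hκ.le] at h2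
  rw [h1, smul_smul, mul_comm, h2, one_smul]

/-! ### Comparison of the graph measure with the surface measure -/

/-- A Lipschitz, antilipschitz parametrization by a `d`-dimensional space compares the Lebesgue
measure with the `d`-dimensional Hausdorff measure of the image. -/
theorem exists_euclideanHausdorffMeasure_image_comparable {Y X : Type*} [NormedAddCommGroup Y]
    [InnerProductSpace ℝ Y] [FiniteDimensional ℝ Y] [MeasurableSpace Y] [BorelSpace Y]
    [EMetricSpace X] [MeasurableSpace X] [BorelSpace X] {γ : Y → X} {K K' : NNReal}
    (hγ : LipschitzWith K γ) (hγ' : AntilipschitzWith K' γ) :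
    ∃ C : NNReal, ∀ s : Set Y,
      Measure.euclideanHausdorffMeasure (Module.finrank ℝ Y) (γ '' s) ≤ C * volume s ∧
      volume s ≤ C * Measure.euclideanHausdorffMeasure (Module.finrank ℝ Y) (γ '' s) := by
  set d := Module.finrank ℝ Y
  refine ⟨max (K ^ d) (K' ^ d), fun s => ?_⟩
  rw [← InnerProductSpace.euclideanHausdorffMeasure_eq_volume]
  have h1 := hγ.hausdorffMeasure_image_le (d := d) (by positivity) s
  have h2 := hγ'.le_hausdorffMeasure_image (d := d) (by positivity) s
  rw [ENNReal.rpow_natCast] at h1 h2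
  simp only [Measure.euclideanHausdorffMeasure_def, Measure.smul_apply, ENNReal.smul_def,
    smul_eq_mul]
  constructor
  · rw [mul_left_comm]
    gcongr
    exact h1.trans (by gcongr; exact_mod_cast le_max_left _ _)
  · rw [mul_left_comm]
    gcongr
    exact h2.trans (by gcongr; exact_mod_cast le_max_right _ _)

/-- The graph of `g` in the coordinates `L`, as a parametrized surface. -/
noncomputable def graphParam {n : ℕ} {Y : Type*} [NormedAddCommGroup Y] [InnerProductSpace ℝ Y]
    (L : (Y × ℝ) ≃L[ℝ] EuclideanSpace ℝ (Fin n)) (g : Y → ℝ) (y : Y) :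
    EuclideanSpace ℝ (Fin n) :=
  L (y, g y)

@[simp]
theorem symm_graphParam {n : ℕ} {Y : Type*} [NormedAddCommGroup Y] [InnerProductSpace ℝ Y]
    (L : (Y × ℝ) ≃L[ℝ] EuclideanSpace ℝ (Fin n)) (g : Y → ℝ) (y : Y) :
    L.symm (graphParam L g y) = (y, g y) :=
  L.symm_apply_apply _

theorem exists_lipschitzWith_graphParam {n : ℕ} {Y : Type*} [NormedAddCommGroup Y]
    [InnerProductSpace ℝ Y] (L : (Y × ℝ) ≃L[ℝ] EuclideanSpace ℝ (Fin n)) {g : Y → ℝ}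
    (hg : ∃ K, LipschitzWith K g) : ∃ K, LipschitzWith K (graphParam L g) := by
  obtain ⟨K, hK⟩ := hg
  exact ⟨_, L.lipschitz.comp (LipschitzWith.id.prodMk hK)⟩

theorem exists_antilipschitzWith_graphParam {n : ℕ} {Y : Type*} [NormedAddCommGroup Y]
    [InnerProductSpace ℝ Y] (L : (Y × ℝ) ≃L[ℝ] EuclideanSpace ℝ (Fin n)) (g : Y → ℝ) :
    ∃ K, AntilipschitzWith K (graphParam L g) :=
  ⟨_, (LipschitzWith.prod_fst.comp L.symm.lipschitz).to_rightInverse (fun y => by simp)⟩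

theorem isClosedEmbedding_graphParam {n : ℕ} {Y : Type*} [NormedAddCommGroup Y]
    [InnerProductSpace ℝ Y] [FiniteDimensional ℝ Y]
    (L : (Y × ℝ) ≃L[ℝ] EuclideanSpace ℝ (Fin n)) {g : Y → ℝ}
    (hg : ∃ K, LipschitzWith K g) : IsClosedEmbedding (graphParam L g) := by
  obtain ⟨K, hK⟩ := exists_lipschitzWith_graphParam L hg
  obtain ⟨K', hK'⟩ := exists_antilipschitzWith_graphParam L g
  exact hK'.isClosedEmbedding hK.uniformContinuous

/-- The measure `c |graphConormal| dy` on the graph of `g`, transported by the parametrization. It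
is the area element of the graph when `c` is the Jacobian of the coordinates `L`, that is, when the
Lebesgue measure is `c` times the image under `L` of the product measure. -/
noncomputable def graphMeasure {n : ℕ} {Y : Type*} [NormedAddCommGroup Y] [InnerProductSpace ℝ Y]
    [FiniteDimensional ℝ Y] [MeasurableSpace Y] [BorelSpace Y]
    (L : (Y × ℝ) ≃L[ℝ] EuclideanSpace ℝ (Fin n)) (g : Y → ℝ) (c : NNReal) :
    Measure (EuclideanSpace ℝ (Fin n)) :=
  Measure.map (graphParam L g)
    ((volume : Measure Y).withDensity fun y => ((c * ‖graphConormal L g y‖₊ : NNReal) : ℝ≥0∞))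

theorem IsGraphChart.image_preimage {n : ℕ} {Ω : Set (EuclideanSpace ℝ (Fin n))} {Y : Type*}
    [NormedAddCommGroup Y] [InnerProductSpace ℝ Y]
    {L : (Y × ℝ) ≃L[ℝ] EuclideanSpace ℝ (Fin n)} {g : Y → ℝ}
    {U : Set (EuclideanSpace ℝ (Fin n))} (h : IsGraphChart Ω L g U)
    {A : Set (EuclideanSpace ℝ (Fin n))} (hA : A ⊆ U) :
    graphParam L g '' (graphParam L g ⁻¹' A) = A ∩ frontier Ω := by
  rw [Set.image_preimage_eq_inter_range]
  ext x
  refine and_congr_right fun hxA => ?_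
  rw [h.mem_frontier_iff x (hA hxA)]
  constructor
  · rintro ⟨y, rfl⟩
    simp
  · intro hx
    refine ⟨(L.symm x).1, ?_⟩
    rw [graphParam, ← hx]
    simp

/-- Inside a bounded chart the graph measure is comparable to the surface measure: the density is
bounded above and below, and the parametrization is bi-Lipschitz. -/
theorem IsGraphChart.graphMeasure_comparable {n : ℕ} {Ω : Set (EuclideanSpace ℝ (Fin n))}
    {Y : Type*} [NormedAddCommGroup Y] [InnerProductSpace ℝ Y] [FiniteDimensional ℝ Y]
    [MeasurableSpace Y] [BorelSpace Y] (hY : Module.finrank ℝ Y = n - 1)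
    {L : (Y × ℝ) ≃L[ℝ] EuclideanSpace ℝ (Fin n)} {g : Y → ℝ}
    {U : Set (EuclideanSpace ℝ (Fin n))} (h : IsGraphChart Ω L g U)
    (hU : Bornology.IsBounded U) {c : NNReal} (hc : 0 < c) :
    graphMeasure L g c U < ⊤ ∧ ∃ C : NNReal, ∀ A ⊆ U, MeasurableSet A →
      graphMeasure L g c A ≤ C * surfaceMeasure Ω A ∧
      surfaceMeasure Ω A ≤ C * graphMeasure L g c A := by
  obtain ⟨K, hK⟩ := exists_lipschitzWith_graphParam L h.lipschitz
  obtain ⟨K', hK'⟩ := exists_antilipschitzWith_graphParam L g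
  have hemb := isClosedEmbedding_graphParam L h.lipschitz
  have hmemb := hemb.measurableEmbedding
  obtain ⟨C, hC⟩ := exists_euclideanHausdorffMeasure_image_comparable hK hK'
  rw [hY] at hC
  have hsurf : ∀ A ⊆ U, MeasurableSet A → surfaceMeasure Ω A =
      Measure.euclideanHausdorffMeasure (n - 1) (graphParam L g '' (graphParam L g ⁻¹' A)) := by
    intro A hA hAm
    rw [h.image_preimage hA, surfaceMeasure, Measure.restrict_apply hAm]
  obtain ⟨κ, hκ⟩ : ∃ κ : Y → NNReal, κ = fun y => c * ‖graphConormal L g y‖₊ := ⟨_, rfl⟩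
  have hκc : Continuous κ := by
    rw [hκ]
    exact continuous_const.mul (continuous_graphConormal L h.contDiff).nnnorm
  have hκ0 : ∀ y, 0 < κ y := fun y => by
    rw [hκ]
    exact mul_pos hc (nnnorm_pos.2 (graphConormal_ne_zero L g y))
  have hσ : graphMeasure L g c =
      Measure.map (graphParam L g) ((volume : Measure Y).withDensity fun y => (κ y : ℝ≥0∞)) := by
    rw [hκ, graphMeasure]
  have hcpt : IsCompact (graphParam L g ⁻¹' closure U) :=
    hemb.isCompact_preimage hU.isCompact_closure
  obtain ⟨M, hM⟩ : ∃ M : NNReal, ∀ y ∈ graphParam L g ⁻¹' closure U, κ y ≤ M :=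
    let ⟨M, hM⟩ := hcpt.bddAbove_image (f := κ) hκc.continuousOn
    ⟨M, fun y hy => hM ⟨y, hy, rfl⟩⟩
  obtain ⟨M', hM'⟩ : ∃ M : NNReal, ∀ y ∈ graphParam L g ⁻¹' closure U, (κ y)⁻¹ ≤ M :=
    let ⟨M, hM⟩ := hcpt.bddAbove_image (f := fun y => (κ y)⁻¹)
      (hκc.continuousOn.inv₀ fun y _ => (hκ0 y).ne')
    ⟨M, fun y hy => hM ⟨y, hy, rfl⟩⟩
  have hloc : IsLocallyFiniteMeasure ((volume : Measure Y).withDensity fun y => (κ y : ℝ≥0∞)) :=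
    IsLocallyFiniteMeasure.withDensity_coe hκc
  have hσA : ∀ A, MeasurableSet A →
      graphMeasure L g c A = ∫⁻ y in graphParam L g ⁻¹' A, κ y := by
    intro A hAm
    rw [hσ, hmemb.map_apply, withDensity_apply _ (hmemb.measurable hAm)]
  have hclos : ∀ A ⊆ U, ∀ y ∈ graphParam L g ⁻¹' A, y ∈ graphParam L g ⁻¹' closure U :=
    fun A hA y hy => subset_closure (hA hy)
  refine ⟨?_, C * (M + M'), fun A hA hAm => ⟨?_, ?_⟩⟩
  · rw [hσ, hmemb.map_apply]
    exact (measure_mono (Set.preimage_mono subset_closure)).trans_lt hcpt.measure_lt_top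
  · rw [hσA A hAm]
    calc ∫⁻ y in graphParam L g ⁻¹' A, κ y ≤ ∫⁻ y in graphParam L g ⁻¹' A, (M : ℝ≥0∞) :=
          setLIntegral_mono measurable_const fun y hy =>
            ENNReal.coe_le_coe.2 (hM y (hclos A hA y hy))
      _ = M * volume (graphParam L g ⁻¹' A) := by rw [setLIntegral_const]
      _ ≤ M * (C * surfaceMeasure Ω A) := by
          rw [hsurf A hA hAm]
          gcongr
          exact (hC _).2
      _ = (C * M : NNReal) * surfaceMeasure Ω A := by
          rw [ENNReal.coe_mul, ← mul_assoc, mul_comm (M : ℝ≥0∞)]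
      _ ≤ _ := by
          gcongr
          exact le_self_add
  · calc surfaceMeasure Ω A ≤ C * volume (graphParam L g ⁻¹' A) := by
          rw [hsurf A hA hAm]
          exact (hC _).1
      _ = C * ∫⁻ y in graphParam L g ⁻¹' A, 1 := by rw [setLIntegral_one]
      _ ≤ C * ∫⁻ y in graphParam L g ⁻¹' A, M' * κ y := by
          gcongr 1
          refine setLIntegral_mono (hκc.measurable.coe_nnreal_ennreal.const_mul _) fun y hy => ?_
          have h3 : 1 ≤ M' * κ y := by
            rw [← inv_mul_cancel₀ (hκ0 y).ne']
            exact mul_le_mul_left (hM' y (hclos A hA y hy)) _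
          rw [← ENNReal.coe_mul, ← ENNReal.coe_one]
          exact ENNReal.coe_le_coe.2 h3
      _ = (C * M' : NNReal) * graphMeasure L g c A := by
          rw [hσA A hAm, lintegral_const_mul _ hκc.measurable.coe_nnreal_ennreal, ENNReal.coe_mul,
            mul_assoc]
      _ ≤ _ := by
          gcongr
          exact le_add_self

/-- The divergence theorem for functions supported in a chart. -/
theorem IsGraphChart.integral_fderiv_eq {n : ℕ} {Ω : Set (EuclideanSpace ℝ (Fin n))}
    (hΩ : MeasurableSet Ω) {Y : Type*} [NormedAddCommGroup Y] [InnerProductSpace ℝ Y]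
    [FiniteDimensional ℝ Y] [MeasurableSpace Y] [BorelSpace Y]
    {L : (Y × ℝ) ≃L[ℝ] EuclideanSpace ℝ (Fin n)} {g : Y → ℝ}
    {U : Set (EuclideanSpace ℝ (Fin n))} (h : IsGraphChart Ω L g U) {c : NNReal}
    (hc : (volume : Measure (EuclideanSpace ℝ (Fin n))) =
      c • Measure.map L (volume.prod volume : Measure (Y × ℝ)))
    {f : EuclideanSpace ℝ (Fin n) → ℝ} (hf : ContDiff ℝ 1 f) (hfs : HasCompactSupport f)
    (hfU : tsupport f ⊆ U) (v : EuclideanSpace ℝ (Fin n)) :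
    ∫ x in Ω, fderiv ℝ f x v =
      ∫ x in U, f x * inner ℝ (outerNormal Ω x) v ∂graphMeasure L g c := by
  have hemb := isClosedEmbedding_graphParam L h.lipschitz
  have hmemb := hemb.measurableEmbedding
  have hLd : ContDiff ℝ 1 (f ∘ L) := hf.comp L.contDiff
  have hLs : HasCompactSupport (f ∘ L) := hfs.comp_homeomorph L.toHomeomorph
  have hgc := h.contDiff.continuous
  have e1 : ∫ x in Ω, fderiv ℝ f x v = ∫ x in {x | (L.symm x).2 < g (L.symm x).1},
      fderiv ℝ f x v := by
    have hm : MeasurableSet {x | (L.symm x).2 < g (L.symm x).1} :=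
      (isOpen_lt (by fun_prop) (by fun_prop)).measurableSet
    rw [← integral_indicator hΩ, ← integral_indicator hm]
    congr 1
    ext x
    by_cases hx : x ∈ tsupport f
    · have : x ∈ Ω ↔ x ∈ {x | (L.symm x).2 < g (L.symm x).1} := h.mem_iff x (hfU hx)
      by_cases hxΩ : x ∈ Ω
      · rw [Set.indicator_of_mem hxΩ, Set.indicator_of_mem (this.1 hxΩ)]
      · rw [Set.indicator_of_notMem hxΩ, Set.indicator_of_notMem (mt this.2 hxΩ)]
    · have : fderiv ℝ f x = 0 := by
        by_contra h0
        exact hx (support_fderiv_subset ℝ h0)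
      simp [Set.indicator, this]
  have e2 : ∫ x in {x | (L.symm x).2 < g (L.symm x).1}, fderiv ℝ f x v =
      c * ∫ p in {p : Y × ℝ | p.2 < g p.1}, fderiv ℝ (f ∘ L) p (L.symm v)
        ∂(volume.prod volume) := by
    have hpre : L ⁻¹' {x | (L.symm x).2 < g (L.symm x).1} = {p | p.2 < g p.1} := by
      ext p
      simp
    rw [hc, Measure.restrict_smul, integral_smul_nnreal_measure,
      L.toHomeomorph.measurableEmbedding.setIntegral_map (f := L), hpre, NNReal.smul_def,
      smul_eq_mul]
    congr 2
    ext p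
    rw [L.comp_right_fderiv]
    simp
  have hκc : Measurable fun y => c * ‖graphConormal L g y‖₊ :=
    (continuous_const.mul (continuous_graphConormal L h.contDiff).nnnorm).measurable
  rw [e1, e2, ← Prod.mk.eta (p := L.symm v),
    integral_fderiv_subgraph volume h.contDiff hLd hLs, graphMeasure, hmemb.setIntegral_map,
    ← integral_indicator (hmemb.measurable h.isOpen.measurableSet),
    integral_withDensity_eq_integral_smul hκc, ← integral_const_mul]
  congr 1
  ext y
  rw [← inner_graphConormal, Function.comp_apply, ← graphParam]
  by_cases hy : graphParam L g y ∈ U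
  · have h1 := h.norm_smul_normal ⟨hy, (h.mem_frontier_iff _ hy).2 (by simp)⟩
    rw [symm_graphParam] at h1
    rw [Set.indicator_of_mem (show y ∈ graphParam L g ⁻¹' U from hy)]
    conv_lhs => rw [← h1]
    rw [real_inner_smul_left, NNReal.smul_def, smul_eq_mul, NNReal.coe_mul, coe_nnnorm]
    ring
  · have : f (graphParam L g y) = 0 := image_eq_zero_of_notMem_tsupport fun h => hy (hfU h)
    rw [Set.indicator_of_notMem (show y ∉ graphParam L g ⁻¹' U from hy), this]
    simp

/-! ### Inward vector fields and the boundary measure -/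

/-- Every boundary point lies in a bounded graph chart. The coordinates split space into the line
spanned by the gradient `e` of a defining function and its orthogonal complement. -/
theorem HasSmoothBoundary.exists_isGraphChart {n : ℕ} {Ω : Set (EuclideanSpace ℝ (Fin n))}
    (hΩ : IsOpen Ω) (hs : HasSmoothBoundary Ω) {x : EuclideanSpace ℝ (Fin n)}
    (hx : x ∈ frontier Ω) :
    ∃ (e : EuclideanSpace ℝ (Fin n)) (L : ((ℝ ∙ e)ᗮ × ℝ) ≃L[ℝ] EuclideanSpace ℝ (Fin n))
      (g : (ℝ ∙ e)ᗮ → ℝ) (U : Set (EuclideanSpace ℝ (Fin n))),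
      Module.finrank ℝ (ℝ ∙ e)ᗮ = n - 1 ∧ IsGraphChart Ω L g U ∧ Bornology.IsBounded U ∧
        x ∈ U := by
  obtain ⟨ρ, hρ⟩ := hs x hx
  set e := gradient ρ x with he
  have he0 : e ≠ 0 := hρ.2.1
  let L : ((ℝ ∙ e)ᗮ × ℝ) ≃L[ℝ] EuclideanSpace ℝ (Fin n) :=
    ((LinearEquiv.prodCongr (LinearEquiv.refl ℝ (ℝ ∙ e)ᗮ)
      (LinearEquiv.toSpanNonzeroSingleton ℝ _ e he0)).trans
      (Submodule.prodEquivOfIsCompl (ℝ ∙ e)ᗮ (ℝ ∙ e)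
        (Submodule.isCompl_orthogonal _).symm)).toContinuousLinearEquiv
  have hL : L (0, 1) = e := by
    simp [L]
  obtain ⟨g, U, h, hxU⟩ := hρ.exists_isGraphChart hΩ hx L (by
    rw [hL, ← inner_gradient_left, ← he, real_inner_self_eq_norm_sq]
    have := norm_pos_iff.2 he0
    positivity)
  refine ⟨e, L, g, U ∩ Metric.ball x 1, ?_, h.mono (h.isOpen.inter Metric.isOpen_ball)
    Set.inter_subset_left, Metric.isBounded_ball.subset Set.inter_subset_right, hxU,
    Metric.mem_ball_self one_pos⟩
  have h1 := Submodule.finrank_add_finrank_orthogonal (ℝ ∙ e)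
  rw [finrank_span_singleton he0, finrank_euclideanSpace_fin] at h1
  omega

theorem norm_outerNormal {n : ℕ} {Ω : Set (EuclideanSpace ℝ (Fin n))}
    (hΩ : IsOpen Ω) (hs : HasSmoothBoundary Ω) {x : EuclideanSpace ℝ (Fin n)}
    (hx : x ∈ frontier Ω) : ‖outerNormal Ω x‖ = 1 := by
  obtain ⟨e, L, g, U, -, h, -, hxU⟩ := hs.exists_isGraphChart hΩ hx
  exact h.norm_normal x ⟨hxU, hx⟩

theorem continuousOn_outerNormal {n : ℕ} {Ω : Set (EuclideanSpace ℝ (Fin n))}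
    (hΩ : IsOpen Ω) (hs : HasSmoothBoundary Ω) : ContinuousOn (outerNormal Ω) (frontier Ω) := by
  intro x hx
  obtain ⟨e, L, g, U, -, h, -, hxU⟩ := hs.exists_isGraphChart hΩ hx
  have := h.continuousOn_normal x ⟨hxU, hx⟩
  rwa [ContinuousWithinAt, Set.inter_comm, nhdsWithin_inter_of_mem'
    (mem_nhdsWithin_of_mem_nhds (h.isOpen.mem_nhds hxU))] at this

/-- A function that vanishes on the boundary has a normal gradient there. -/
theorem fderiv_eq_normalDeriv_mul {n : ℕ} {Ω : Set (EuclideanSpace ℝ (Fin n))}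
    (hΩ : IsOpen Ω) (hs : HasSmoothBoundary Ω) {w : EuclideanSpace ℝ (Fin n) → ℝ}
    (hw : Differentiable ℝ w) (hw0 : ∀ x ∈ frontier Ω, w x = 0) {x : EuclideanSpace ℝ (Fin n)}
    (hx : x ∈ frontier Ω) (v : EuclideanSpace ℝ (Fin n)) :
    fderiv ℝ w x v = normalDeriv Ω w x * inner ℝ (outerNormal Ω x) v := by
  obtain ⟨e, L, g, U, -, h, -, hxU⟩ := hs.exists_isGraphChart hΩ hx
  exact h.fderiv_eq hw hw0 ⟨hxU, hx⟩ v

/-- There is a smooth vector field that points strictly into `Ω` along the boundary. -/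
theorem exists_inward_vectorField {n : ℕ} {Ω : Set (EuclideanSpace ℝ (Fin n))}
    (hΩ : IsOpen Ω) (hs : HasSmoothBoundary Ω) :
    ∃ Z : EuclideanSpace ℝ (Fin n) → EuclideanSpace ℝ (Fin n), ContDiff ℝ ∞ Z ∧
      ∀ x ∈ frontier Ω, inner ℝ (outerNormal Ω x) (Z x) ≤ -1 := by
  have hconv : ∀ x, Convex ℝ {z : EuclideanSpace ℝ (Fin n) |
      x ∈ frontier Ω → inner ℝ (outerNormal Ω x) z ≤ -1} := by
    intro x a ha b hb s t hs ht hst hx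
    rw [inner_add_right, real_inner_smul_right, real_inner_smul_right]
    have h1 := mul_le_mul_of_nonneg_left (ha hx) hs
    have h2 := mul_le_mul_of_nonneg_left (hb hx) ht
    linarith
  have hloc : ∀ x, ∃ c : EuclideanSpace ℝ (Fin n), ∀ᶠ y in 𝓝 x, c ∈
      {z : EuclideanSpace ℝ (Fin n) | y ∈ frontier Ω → inner ℝ (outerNormal Ω y) z ≤ -1} := by
    intro x
    by_cases hx : x ∈ frontier Ω
    · refine ⟨-(2 : ℝ) • outerNormal Ω x, ?_⟩
      have hc : ContinuousWithinAt (fun y => inner ℝ (outerNormal Ω y)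
          (-(2 : ℝ) • outerNormal Ω x)) (frontier Ω) x :=
        ContinuousWithinAt.inner (continuousOn_outerNormal hΩ hs x hx) continuousWithinAt_const
      have h1 : inner ℝ (outerNormal Ω x) (-(2 : ℝ) • outerNormal Ω x) < -1 := by
        rw [real_inner_smul_right, real_inner_self_eq_norm_sq, norm_outerNormal hΩ hs hx]
        norm_num
      have := eventually_nhdsWithin_iff.1 (hc.eventually (gt_mem_nhds h1))
      filter_upwards [this] with y hy hyf
      exact (hy hyf).le
    · refine ⟨0, ?_⟩
      filter_upwards [isClosed_frontier.isOpen_compl.mem_nhds hx] with y hy hyf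
      exact absurd hyf hy
  obtain ⟨Z, hZ⟩ := exists_contMDiffMap_forall_mem_convex_of_local_const
    (modelWithCornersSelf ℝ (EuclideanSpace ℝ (Fin n))) (n := ⊤) hconv hloc
  exact ⟨Z, Z.contMDiff.contDiff, fun x hx => hZ x hx⟩

/-- Local form of `exists_boundary_measure`, for functions supported near a point of the closure. -/
theorem exists_local_boundary_measure {n : ℕ} {Ω : Set (EuclideanSpace ℝ (Fin n))}
    (hΩ : IsOpen Ω) (hb : Bornology.IsBounded Ω) (hs : HasSmoothBoundary Ω)
    {x : EuclideanSpace ℝ (Fin n)} (hx : x ∈ closure Ω) :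
    ∃ U : Set (EuclideanSpace ℝ (Fin n)), IsOpen U ∧ x ∈ U ∧ Bornology.IsBounded U ∧
      ∃ σ : Measure (EuclideanSpace ℝ (Fin n)), IsFiniteMeasure σ ∧
        (∃ C : NNReal, ∀ A ⊆ U, MeasurableSet A →
          σ A ≤ C * surfaceMeasure Ω A ∧ surfaceMeasure Ω A ≤ C * σ A) ∧
        ∀ f : EuclideanSpace ℝ (Fin n) → ℝ, ContDiff ℝ 1 f → HasCompactSupport f →
          tsupport f ⊆ U → ∀ v,
            ∫ x in Ω, fderiv ℝ f x v = ∫ x, f x * inner ℝ (outerNormal Ω x) v ∂σ := by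
  by_cases hxΩ : x ∈ Ω
  · refine ⟨Ω, hΩ, hxΩ, hb, 0, inferInstance, ⟨0, fun A hA hAm => ⟨by simp, ?_⟩⟩, ?_⟩
    · have : A ∩ frontier Ω = ∅ := by
        rw [hΩ.frontier_eq]
        ext y
        simp only [Set.mem_inter_iff, Set.mem_sdiff, Set.mem_empty_iff_false, iff_false]
        exact fun h => h.2.2 (hA h.1)
      rw [surfaceMeasure, Measure.restrict_apply hAm, this]
      simp
    · intro f hf hfs hfU v
      rw [integral_zero_measure, setIntegral_eq_integral_of_forall_compl_eq_zero,
        integral_fderiv_eq_zero_of_hasCompactSupport volume hf hfs v]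
      intro y hy
      have : fderiv ℝ f y = 0 := by
        by_contra h0
        exact hy (hfU (support_fderiv_subset ℝ h0))
      simp [this]
  · have hxf : x ∈ frontier Ω := by
      rw [hΩ.frontier_eq]
      exact ⟨hx, hxΩ⟩
    obtain ⟨e, L, g, U, hY, h, hU, hxU⟩ := hs.exists_isGraphChart hΩ hxf
    have hHaar : (Measure.map L (volume.prod volume : Measure ((ℝ ∙ e)ᗮ × ℝ))).IsAddHaarMeasure :=
      L.isAddHaarMeasure_map _
    obtain ⟨c, hc⟩ : ∃ c : NNReal, (volume : Measure (EuclideanSpace ℝ (Fin n))) =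
        c • Measure.map L (volume.prod volume : Measure ((ℝ ∙ e)ᗮ × ℝ)) :=
      ⟨_, Measure.isAddLeftInvariant_eq_smul _ _⟩
    have hc0 : 0 < c := by
      rw [pos_iff_ne_zero]
      rintro rfl
      rw [zero_smul] at hc
      exact (NeZero.ne (volume : Measure (EuclideanSpace ℝ (Fin n)))) hc
    obtain ⟨hfin, C, hC⟩ := h.graphMeasure_comparable hY hU hc0
    refine ⟨U, h.isOpen, hxU, hU, (graphMeasure L g c).restrict U, ⟨by simpa using hfin⟩,
      ⟨C, fun A hA hAm => ?_⟩, ?_⟩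
    · rw [Measure.restrict_apply hAm, Set.inter_eq_left.2 hA]
      exact hC A hA hAm
    · intro f hf hfs hfU v
      exact h.integral_fderiv_eq hΩ.measurableSet hc hf hfs hfU v

/-- A boundary measure for which the divergence theorem holds, comparable to the surface measure.
(The two measures are in fact equal, but this would need the area formula.) -/
theorem exists_boundary_measure {n : ℕ} {Ω : Set (EuclideanSpace ℝ (Fin n))}
    (hΩ : IsOpen Ω) (hb : Bornology.IsBounded Ω) (hs : HasSmoothBoundary Ω) :
    ∃ σ : Measure (EuclideanSpace ℝ (Fin n)), IsFiniteMeasure σ ∧ σ (frontier Ω)ᶜ = 0 ∧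
      (∃ C : NNReal, σ ≤ C • surfaceMeasure Ω ∧ surfaceMeasure Ω ≤ C • σ) ∧
      ∀ f : EuclideanSpace ℝ (Fin n) → ℝ, ContDiff ℝ 1 f → ∀ v,
        ∫ x in Ω, fderiv ℝ f x v = ∫ x, f x * inner ℝ (outerNormal Ω x) v ∂σ := by
  choose U hUo hxU hUb τ hτ hC' hdiv using fun x : closure Ω =>
    exists_local_boundary_measure hΩ hb hs x.2
  choose C hC using hC'
  obtain ⟨χ, hχ⟩ := SmoothPartitionOfUnity.exists_isSubordinate
    (modelWithCornersSelf ℝ (EuclideanSpace ℝ (Fin n))) isClosed_closure U hUo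
    (fun x hx => Set.mem_iUnion.2 ⟨⟨x, hx⟩, hxU ⟨x, hx⟩⟩)
  have hcpt : IsCompact (closure Ω) := hb.isCompact_closure
  obtain ⟨T, hT⟩ : ∃ T : Finset (closure Ω), ∀ x ∈ closure Ω, ∑ i ∈ T, χ i x = 1 := by
    have hfin := χ.locallyFinite.finite_nonempty_inter_compact hcpt
    refine ⟨hfin.toFinset, fun x hx => ?_⟩
    rw [← χ.sum_eq_one hx, finsum_eq_sum_of_support_subset]
    intro i hi
    simp only [Set.Finite.coe_toFinset, Set.mem_ofPred_eq]
    exact ⟨x, hi, hx⟩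
  have hχd : ∀ i, ContDiff ℝ 1 (χ i) := fun i =>
    (χ i).contMDiff.contDiff.of_le (by norm_cast)
  have hχm : ∀ i, Measurable fun x => (χ i x).toNNReal := fun i =>
    (hχd i).continuous.measurable.real_toNNReal
  have hfrm : MeasurableSet (frontier Ω) := isClosed_frontier.measurableSet
  set μ : closure Ω → Measure (EuclideanSpace ℝ (Fin n)) := fun i =>
    (τ i).withDensity fun x => ((χ i x).toNNReal : ℝ≥0∞) with hμ
  have hμU : ∀ i A, MeasurableSet A → μ i A ≤ τ i (A ∩ U i) := by
    intro i A hA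
    rw [hμ]
    simp only
    rw [withDensity_apply _ hA, ← lintegral_indicator hA,
      ← lintegral_indicator_one (hA.inter (hUo i).measurableSet)]
    refine lintegral_mono fun x => ?_
    by_cases hxA : x ∈ A
    · rw [Set.indicator_of_mem hxA]
      by_cases hxU : x ∈ U i
      · rw [Set.indicator_of_mem (show x ∈ A ∩ U i from ⟨hxA, hxU⟩)]
        have : (χ i x).toNNReal ≤ 1 := Real.toNNReal_le_one.2 (χ.le_one i x)
        exact ENNReal.coe_le_one_iff.2 this
      · have : χ i x = 0 := image_eq_zero_of_notMem_tsupport fun h => hxU (hχ i h)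
        simp [this]
    · simp [Set.indicator_of_notMem hxA]
  have hle : ∀ i ∈ T, μ i ≤ ∑ j ∈ T, μ j := by
    refine fun i hi => Measure.le_iff.2 fun A hA => ?_
    rw [Measure.finsetSum_apply]
    exact Finset.single_le_sum (f := fun j => μ j A) (fun _ _ => zero_le) hi
  have hσC : ∃ C : NNReal, (∑ i ∈ T, μ i) ≤ C • surfaceMeasure Ω ∧
      surfaceMeasure Ω ≤ C • ∑ i ∈ T, μ i := by
    refine ⟨(∑ i ∈ T, C i) * (T.card + 1), Measure.le_iff.2 fun A hA => ?_,
      Measure.le_iff.2 fun A hA => ?_⟩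
    · rw [Measure.finsetSum_apply]
      calc ∑ i ∈ T, μ i A ≤ ∑ i ∈ T, C i * surfaceMeasure Ω A := by
            refine Finset.sum_le_sum fun i _ => (hμU i A hA).trans ?_
            refine ((hC i _ Set.inter_subset_right (hA.inter (hUo i).measurableSet)).1).trans ?_
            gcongr
            exact Set.inter_subset_left
        _ = (∑ i ∈ T, C i : NNReal) * surfaceMeasure Ω A := by
            rw [← Finset.sum_mul]
            push_cast
            rfl
        _ ≤ _ := by
            rw [Measure.smul_apply, ENNReal.smul_def, smul_eq_mul]
            gcongr
            exact le_mul_of_one_le_right zero_le (by simp)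
    · -- where `χ i` is at least `1 / (T.card + 1)`, the measures `μ i` and `τ i` are comparable,
      -- and these sets cover the boundary because the sum of the `T.card` functions `χ i` is one
      set B : closure Ω → Set (EuclideanSpace ℝ (Fin n)) := fun i =>
        A ∩ {x | (T.card + 1 : ℝ)⁻¹ ≤ χ i x} with hB
      have hBm : ∀ i, MeasurableSet (B i) := fun i =>
        hA.inter (measurableSet_le measurable_const (hχd i).continuous.measurable)
      have hBU : ∀ i, B i ⊆ U i := by
        intro i x hx
        refine hχ i (subset_tsupport _ ?_)
        have h1 : (T.card + 1 : ℝ)⁻¹ ≤ χ i x := hx.2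
        have h2 : (0 : ℝ) < (T.card + 1 : ℝ)⁻¹ := by positivity
        exact (h2.trans_le h1).ne'
      have hcov : A ∩ frontier Ω ⊆ ⋃ i ∈ T, B i := by
        rintro x ⟨hxA, hxf⟩
        by_contra hcon
        simp only [hB, Set.mem_iUnion, not_exists, Set.mem_inter_iff, not_and,
          Set.mem_ofPred_eq, not_le] at hcon
        have h1 := hT x (frontier_subset_closure hxf)
        have h2 : ∑ i ∈ T, χ i x ≤ ∑ i ∈ T, (T.card + 1 : ℝ)⁻¹ :=
          Finset.sum_le_sum fun i hi => (hcon i hi hxA).le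
        rw [h1, Finset.sum_const, nsmul_eq_mul, ← div_eq_mul_inv, le_div_iff₀ (by positivity)] at h2
        linarith
      calc surfaceMeasure Ω A = surfaceMeasure Ω (A ∩ frontier Ω) := by
            rw [surfaceMeasure, Measure.restrict_apply hA,
              Measure.restrict_apply (hA.inter hfrm), Set.inter_assoc, Set.inter_self]
        _ ≤ ∑ i ∈ T, surfaceMeasure Ω (B i) :=
            (measure_mono hcov).trans (measure_biUnion_finset_le _ _)
        _ ≤ ∑ i ∈ T, C i * ((T.card + 1 : NNReal) * μ i A) := by
            refine Finset.sum_le_sum fun i _ => ((hC i _ (hBU i) (hBm i)).2).trans ?_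
            gcongr
            calc τ i (B i) = ∫⁻ x in B i, 1 ∂τ i := (setLIntegral_one _).symm
              _ ≤ ∫⁻ x in B i, (T.card + 1 : NNReal) * ((χ i x).toNNReal : ℝ≥0∞) ∂τ i := by
                  refine setLIntegral_mono ((hχm i).coe_nnreal_ennreal.const_mul _) fun x hx => ?_
                  have h1 : (T.card + 1 : ℝ)⁻¹ ≤ χ i x := hx.2
                  rw [inv_le_iff_one_le_mul₀' (by positivity)] at h1
                  have h2 : (1 : NNReal) ≤ (T.card + 1 : NNReal) * (χ i x).toNNReal := by
                    rw [← NNReal.coe_le_coe]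
                    push_cast
                    rwa [Real.coe_toNNReal _ (χ.nonneg i x)]
                  exact_mod_cast h2
              _ = (T.card + 1 : NNReal) * μ i (B i) := by
                  rw [lintegral_const_mul _ (hχm i).coe_nnreal_ennreal,
                    ← withDensity_apply _ (hBm i)]
              _ ≤ _ := by
                  gcongr
                  exact Set.inter_subset_left
        _ ≤ ∑ i ∈ T, C i * ((T.card + 1 : NNReal) * (∑ j ∈ T, μ j) A) := by
            refine Finset.sum_le_sum fun i hi => ?_
            gcongr
            exact hle i hi
        _ = _ := by
            rw [← Finset.sum_mul, Measure.smul_apply, ENNReal.smul_def, smul_eq_mul]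
            push_cast
            ring
  have hμfin : ∀ i, IsFiniteMeasure (μ i) := fun i => ⟨by
    exact (hμU i Set.univ MeasurableSet.univ).trans_lt (measure_lt_top _ _)⟩
  have hσfin : IsFiniteMeasure (∑ i ∈ T, μ i) := ⟨by
    rw [Measure.finsetSum_apply]
    exact ENNReal.sum_lt_top.2 fun i _ => measure_lt_top _ _⟩
  have hσ0 : (∑ i ∈ T, μ i) (frontier Ω)ᶜ = 0 := by
    obtain ⟨C, h1, -⟩ := hσC
    refine le_antisymm ((h1 _).trans ?_) zero_le
    rw [Measure.smul_apply, surfaceMeasure, Measure.restrict_apply hfrm.compl]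
    simp
  refine ⟨∑ i ∈ T, μ i, hσfin, hσ0, hσC, fun f hf v => ?_⟩
  have hFc : ContinuousOn (fun x => f x * inner ℝ (outerNormal Ω x) v) (frontier Ω) :=
    hf.continuous.continuousOn.mul
      (ContinuousOn.inner (continuousOn_outerNormal hΩ hs) continuousOn_const)
  have hFi : Integrable (fun x => f x * inner ℝ (outerNormal Ω x) v) (∑ i ∈ T, μ i) := by
    have hfc : IsCompact (frontier Ω) := hcpt.of_isClosed_subset isClosed_frontier
      frontier_subset_closure
    have := hFc.integrableOn_compact (μ := ∑ i ∈ T, μ i) hfc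
    rwa [IntegrableOn, Measure.restrict_eq_self_of_ae_mem] at this
    exact mem_ae_iff.2 hσ0
  have hprod : ∀ i, ContDiff ℝ 1 fun x => χ i x * f x := fun i => (hχd i).mul hf
  rw [integral_finsetSum_measure fun i hi => hFi.mono_measure (hle i hi)]
  have hterm : ∀ i ∈ T, ∫ x, f x * inner ℝ (outerNormal Ω x) v ∂μ i =
      ∫ x in Ω, fderiv ℝ (fun x => χ i x * f x) x v := by
    intro i _
    have hsub : tsupport (fun x => χ i x * f x) ⊆ tsupport (χ i) := tsupport_mul_subset_left
    have hχs : HasCompactSupport (χ i) := (hUb i).isCompact_closure.of_isClosed_subset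
      (isClosed_tsupport _) ((hχ i).trans subset_closure)
    have hcs : HasCompactSupport fun x => χ i x * f x := hχs.mul_right
    rw [hdiv i _ (hprod i) hcs (hsub.trans (hχ i)), hμ]
    simp only
    rw [integral_withDensity_eq_integral_smul (hχm i)]
    congr 1
    ext x
    rw [NNReal.smul_def, Real.coe_toNNReal _ (χ.nonneg i x), smul_eq_mul, mul_assoc]
  rw [Finset.sum_congr rfl hterm, ← integral_finsetSum]
  · refine setIntegral_congr_fun hΩ.measurableSet fun x hx => ?_
    have h1 : (fun y => ∑ i ∈ T, χ i y * f y) =ᶠ[𝓝 x] f := by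
      filter_upwards [hΩ.mem_nhds hx] with y hy
      rw [← Finset.sum_mul, hT y (subset_closure hy), one_mul]
    rw [← h1.fderiv_eq, fderiv_fun_sum fun i _ => (hprod i).differentiable one_ne_zero x]
    simp
  · intro i _
    have hc : Continuous fun x => fderiv ℝ (fun x => χ i x * f x) x v :=
      ((hprod i).continuous_fderiv one_ne_zero).clm_apply continuous_const
    exact (hc.continuousOn.integrableOn_compact hcpt).mono_set subset_closure

/-! ### Partial derivatives and integration by parts -/

/-- The partial derivative `∂_j f`. -/
noncomputable def partialDeriv {n : ℕ} {F : Type*} [NormedAddCommGroup F] [NormedSpace ℝ F]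
    (j : Fin n) (f : EuclideanSpace ℝ (Fin n) → F) (x : EuclideanSpace ℝ (Fin n)) : F :=
  fderiv ℝ f x (EuclideanSpace.single j 1)

theorem ContDiff.partialDeriv {n : ℕ} {F : Type*} [NormedAddCommGroup F] [NormedSpace ℝ F]
    {f : EuclideanSpace ℝ (Fin n) → F} (hf : ContDiff ℝ ∞ f) (j : Fin n) :
    ContDiff ℝ ∞ (partialDeriv j f) :=
  (hf.fderiv_right (m := ∞) (by simp)).clm_apply contDiff_const

theorem partialDeriv_mul {n : ℕ} {f g : EuclideanSpace ℝ (Fin n) → ℝ} (hf : ContDiff ℝ ∞ f)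
    (hg : ContDiff ℝ ∞ g) (j : Fin n) (x : EuclideanSpace ℝ (Fin n)) :
    partialDeriv j (fun y => f y * g y) x = partialDeriv j f x * g x + f x * partialDeriv j g x := by
  rw [partialDeriv, fderiv_fun_mul (hf.differentiable (by simp) x) (hg.differentiable (by simp) x)]
  simp only [_root_.add_apply, _root_.smul_apply, smul_eq_mul, partialDeriv]
  ring

theorem partialDeriv_sub {n : ℕ} {f g : EuclideanSpace ℝ (Fin n) → ℝ} (hf : ContDiff ℝ ∞ f)
    (hg : ContDiff ℝ ∞ g) (j : Fin n) (x : EuclideanSpace ℝ (Fin n)) :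
    partialDeriv j (fun y => f y - g y) x = partialDeriv j f x - partialDeriv j g x := by
  rw [partialDeriv, fderiv_fun_sub (hf.differentiable (by simp) x) (hg.differentiable (by simp) x)]
  simp [partialDeriv]

theorem partialDeriv_sum {n : ℕ} {ι : Type*} (s : Finset ι)
    {f : ι → EuclideanSpace ℝ (Fin n) → ℝ} (hf : ∀ i, ContDiff ℝ ∞ (f i))
    (j : Fin n) (x : EuclideanSpace ℝ (Fin n)) :
    partialDeriv j (fun y => ∑ i ∈ s, f i y) x = ∑ i ∈ s, partialDeriv j (f i) x := by
  rw [partialDeriv, fderiv_fun_sum fun i _ => (hf i).differentiable (by simp) x]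
  simp [partialDeriv]

theorem partialDeriv_const_mul {n : ℕ} {f : EuclideanSpace ℝ (Fin n) → ℝ} (hf : ContDiff ℝ ∞ f)
    (c : ℝ) (j : Fin n) (x : EuclideanSpace ℝ (Fin n)) :
    partialDeriv j (fun y => c * f y) x = c * partialDeriv j f x := by
  rw [partialDeriv, fderiv_const_mul (hf.differentiable (by simp) x)]
  simp [partialDeriv]

theorem partialDeriv_comm {n : ℕ} {F : Type*} [NormedAddCommGroup F] [NormedSpace ℝ F]
    {f : EuclideanSpace ℝ (Fin n) → F} (hf : ContDiff ℝ ∞ f) (i j : Fin n)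
    (x : EuclideanSpace ℝ (Fin n)) :
    partialDeriv i (partialDeriv j f) x = partialDeriv j (partialDeriv i f) x := by
  have hd : DifferentiableAt ℝ (fderiv ℝ f) x :=
    (hf.fderiv_right (m := ∞) (by simp)).differentiable (by simp) x
  have h : ∀ i j, partialDeriv i (partialDeriv j f) x =
      fderiv ℝ (fderiv ℝ f) x (EuclideanSpace.single i 1) (EuclideanSpace.single j 1) := by
    intro i j
    have : partialDeriv j f = fun y => fderiv ℝ f y (EuclideanSpace.single j 1) := rfl
    rw [this, partialDeriv, fderiv_clm_apply hd (differentiableAt_const _)]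
    simp
  rw [h, h]
  exact (hf.contDiffAt.isSymmSndFDerivAt (by
    rw [minSmoothness_of_isRCLikeNormedField]
    exact WithTop.coe_le_coe.2 le_top)).eq _ _

theorem laplacian_eq_sum_partialDeriv {n : ℕ} {F : Type*} [NormedAddCommGroup F]
    [NormedSpace ℝ F] {f : EuclideanSpace ℝ (Fin n) → F} (hf : ContDiff ℝ ∞ f)
    (x : EuclideanSpace ℝ (Fin n)) :
    Laplacian.laplacian f x = ∑ j, partialDeriv j (partialDeriv j f) x := by
  have hd : DifferentiableAt ℝ (fderiv ℝ f) x :=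
    (hf.fderiv_right (m := ∞) (by simp)).differentiable (by simp) x
  rw [InnerProductSpace.laplacian_eq_iteratedFDeriv_orthonormalBasis f
    (EuclideanSpace.basisFun (Fin n) ℝ)]
  refine Finset.sum_congr rfl fun j _ => ?_
  rw [iteratedFDeriv_two_apply]
  have : partialDeriv j f = fun y => fderiv ℝ f y (EuclideanSpace.single j 1) := rfl
  rw [this, partialDeriv, fderiv_clm_apply hd (differentiableAt_const _)]
  simp

/-- `σ` is a finite measure on the boundary of `Ω` for which the divergence theorem holds. -/
structure IsBoundaryMeasure {n : ℕ} (Ω : Set (EuclideanSpace ℝ (Fin n)))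
    (σ : Measure (EuclideanSpace ℝ (Fin n))) : Prop where
  isFinite : IsFiniteMeasure σ
  compl_frontier : σ (frontier Ω)ᶜ = 0
  integral_fderiv : ∀ f : EuclideanSpace ℝ (Fin n) → ℝ, ContDiff ℝ 1 f → ∀ v,
    ∫ x in Ω, fderiv ℝ f x v = ∫ x, f x * inner ℝ (outerNormal Ω x) v ∂σ

theorem ContinuousOn.integrable_boundaryMeasure {n : ℕ} {Ω : Set (EuclideanSpace ℝ (Fin n))}
    (hb : Bornology.IsBounded Ω) {σ : Measure (EuclideanSpace ℝ (Fin n))}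
    (hσ : IsBoundaryMeasure Ω σ) {f : EuclideanSpace ℝ (Fin n) → ℝ}
    (hf : ContinuousOn f (frontier Ω)) : Integrable f σ := by
  have := hσ.isFinite
  have hfc : IsCompact (frontier Ω) := hb.isCompact_closure.of_isClosed_subset isClosed_frontier
    frontier_subset_closure
  have h := hf.integrableOn_compact (μ := σ) hfc
  have hae : ∀ᵐ x ∂σ, x ∈ frontier Ω := mem_ae_iff.2 hσ.compl_frontier
  rwa [IntegrableOn, Measure.restrict_eq_self_of_ae_mem hae] at h

theorem Continuous.integrableOn_of_isBounded {n : ℕ} {Ω : Set (EuclideanSpace ℝ (Fin n))}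
    (hb : Bornology.IsBounded Ω) {f : EuclideanSpace ℝ (Fin n) → ℝ} (hf : Continuous f) :
    IntegrableOn f Ω :=
  (hf.continuousOn.integrableOn_compact hb.isCompact_closure).mono_set subset_closure

section

variable {n : ℕ} {Ω : Set (EuclideanSpace ℝ (Fin n))} {σ : Measure (EuclideanSpace ℝ (Fin n))}

theorem continuousOn_outerNormal_apply (hΩ : IsOpen Ω) (hs : HasSmoothBoundary Ω) (j : Fin n) :
    ContinuousOn (fun x => outerNormal Ω x j) (frontier Ω) :=
  ((EuclideanSpace.proj j : EuclideanSpace ℝ (Fin n) →L[ℝ] ℝ).continuous).comp_continuousOn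
    (continuousOn_outerNormal hΩ hs)

theorem inner_single_one (v : EuclideanSpace ℝ (Fin n)) (j : Fin n) :
    inner ℝ v (EuclideanSpace.single j 1) = v j := by
  rw [EuclideanSpace.inner_single_right]
  simp

theorem IsBoundaryMeasure.integral_divergence (hσ : IsBoundaryMeasure Ω σ) (hΩ : IsOpen Ω)
    (hb : Bornology.IsBounded Ω) (hs : HasSmoothBoundary Ω)
    {F : Fin n → EuclideanSpace ℝ (Fin n) → ℝ} (hF : ∀ j, ContDiff ℝ ∞ (F j)) :
    ∫ x in Ω, ∑ j, partialDeriv j (F j) x = ∫ x, ∑ j, F j x * outerNormal Ω x j ∂σ := by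
  rw [integral_finsetSum _ fun j _ =>
      ((hF j).partialDeriv j).continuous.integrableOn_of_isBounded hb,
    integral_finsetSum (f := fun j x => F j x * outerNormal Ω x j) _
      fun j _ => ContinuousOn.integrable_boundaryMeasure hb hσ
      ((hF j).continuous.continuousOn.mul (continuousOn_outerNormal_apply hΩ hs j))]
  refine Finset.sum_congr rfl fun j _ => ?_
  simp_rw [← inner_single_one (outerNormal Ω _) j]
  exact hσ.integral_fderiv (F j) ((hF j).of_le (by norm_cast)) _

theorem IsBoundaryMeasure.integral_congr_frontier (hσ : IsBoundaryMeasure Ω σ)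
    {f g : EuclideanSpace ℝ (Fin n) → ℝ} (h : ∀ x ∈ frontier Ω, f x = g x) :
    ∫ x, f x ∂σ = ∫ x, g x ∂σ := by
  refine integral_congr_ae ?_
  filter_upwards [mem_ae_iff.2 hσ.compl_frontier] with x hx
  exact h x hx

theorem partialDeriv_eq_normalDeriv_mul (hΩ : IsOpen Ω) (hs : HasSmoothBoundary Ω)
    {w : EuclideanSpace ℝ (Fin n) → ℝ} (hw : ContDiff ℝ ∞ w) (hw0 : ∀ x ∈ frontier Ω, w x = 0)
    {x : EuclideanSpace ℝ (Fin n)} (hx : x ∈ frontier Ω) (j : Fin n) :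
    partialDeriv j w x = normalDeriv Ω w x * outerNormal Ω x j := by
  rw [partialDeriv, fderiv_eq_normalDeriv_mul hΩ hs (hw.differentiable (by simp)) hw0 hx,
    inner_single_one]

theorem sum_sq_of_norm_eq_one {c : EuclideanSpace ℝ (Fin n)} (hc : ‖c‖ = 1) : ∑ j, c j ^ 2 = 1 := by
  have h := EuclideanSpace.norm_sq_eq c
  rw [hc] at h
  simpa using h.symm

theorem sum_outerNormal_sq (hΩ : IsOpen Ω) (hs : HasSmoothBoundary Ω)
    {x : EuclideanSpace ℝ (Fin n)} (hx : x ∈ frontier Ω) : ∑ j, outerNormal Ω x j ^ 2 = 1 :=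
  sum_sq_of_norm_eq_one (norm_outerNormal hΩ hs hx)

/-- Rellich's identity: the multiplier `X · ∇w` applied to the Laplacian. -/
theorem IsBoundaryMeasure.integral_rellich (hσ : IsBoundaryMeasure Ω σ) (hΩ : IsOpen Ω)
    (hb : Bornology.IsBounded Ω) (hs : HasSmoothBoundary Ω)
    {w : EuclideanSpace ℝ (Fin n) → ℝ} (hw : ContDiff ℝ ∞ w) (hw0 : ∀ x ∈ frontier Ω, w x = 0)
    {X : Fin n → EuclideanSpace ℝ (Fin n) → ℝ} (hX : ∀ j, ContDiff ℝ ∞ (X j)) :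
    ∫ x in Ω, (2 * (∑ j, partialDeriv j (partialDeriv j w) x) * (∑ k, X k x * partialDeriv k w x) +
        2 * (∑ j, ∑ k, partialDeriv j (X k) x * partialDeriv j w x * partialDeriv k w x) -
        (∑ j, partialDeriv j (X j) x) * ∑ k, partialDeriv k w x ^ 2) =
      ∫ x, (∑ j, X j x * outerNormal Ω x j) * normalDeriv Ω w x ^ 2 ∂σ := by
  have hwk : ∀ k, ContDiff ℝ ∞ (partialDeriv k w) := fun k => hw.partialDeriv k
  have hXw : ContDiff ℝ ∞ fun x => ∑ k, X k x * partialDeriv k w x :=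
    ContDiff.sum fun k _ => (hX k).mul (hwk k)
  have hww : ContDiff ℝ ∞ fun x => ∑ k, partialDeriv k w x * partialDeriv k w x :=
    ContDiff.sum fun k _ => (hwk k).mul (hwk k)
  have hA : ∀ j, ContDiff ℝ ∞ fun x =>
      2 * ((∑ k, X k x * partialDeriv k w x) * partialDeriv j w x) := fun j =>
    contDiff_const.mul (hXw.mul (hwk j))
  have hB : ∀ j, ContDiff ℝ ∞ fun x =>
      X j x * ∑ k, partialDeriv k w x * partialDeriv k w x := fun j => (hX j).mul hww
  have key := hσ.integral_divergence hΩ hb hs (fun j => (hA j).sub (hB j))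
  have hlhs : ∀ x, ∑ j, partialDeriv j (fun x =>
      2 * ((∑ k, X k x * partialDeriv k w x) * partialDeriv j w x) -
      X j x * ∑ k, partialDeriv k w x * partialDeriv k w x) x =
      2 * (∑ j, partialDeriv j (partialDeriv j w) x) * (∑ k, X k x * partialDeriv k w x) +
        2 * (∑ j, ∑ k, partialDeriv j (X k) x * partialDeriv j w x * partialDeriv k w x) -
        (∑ j, partialDeriv j (X j) x) * ∑ k, partialDeriv k w x ^ 2 := by
    intro x
    have hj : ∀ j, partialDeriv j (fun x =>
      2 * ((∑ k, X k x * partialDeriv k w x) * partialDeriv j w x) -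
      X j x * ∑ k, partialDeriv k w x * partialDeriv k w x) x =
      2 * (∑ k, partialDeriv j (X k) x * partialDeriv j w x * partialDeriv k w x) +
      2 * (∑ k, X k x * partialDeriv j w x * partialDeriv j (partialDeriv k w) x) +
      2 * partialDeriv j (partialDeriv j w) x * (∑ k, X k x * partialDeriv k w x) -
      partialDeriv j (X j) x * (∑ k, partialDeriv k w x ^ 2) -
      2 * ∑ k, X j x * partialDeriv k w x * partialDeriv k (partialDeriv j w) x := by
      intro j
      rw [partialDeriv_sub (hA j) (hB j), partialDeriv_const_mul (hXw.mul (hwk j)),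
        partialDeriv_mul hXw (hwk j), partialDeriv_mul (hX j) hww,
        partialDeriv_sum _ fun k => (hX k).mul (hwk k),
        partialDeriv_sum _ fun k => (hwk k).mul (hwk k)]
      simp_rw [fun k => partialDeriv_mul (hX k) (hwk k) j x,
        fun k => partialDeriv_mul (hwk k) (hwk k) j x, partialDeriv_comm hw _ j]
      simp only [Finset.sum_add_distrib, add_mul, mul_add, Finset.mul_sum, Finset.sum_mul]
      simp only [← Finset.sum_add_distrib, ← Finset.sum_sub_distrib]
      refine Finset.sum_congr rfl fun k _ => ?_
      ring
    simp_rw [hj]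
    simp only [Finset.sum_add_distrib, Finset.sum_sub_distrib, ← Finset.mul_sum, ← Finset.sum_mul]
    rw [Finset.sum_comm (f := fun j k =>
      X k x * partialDeriv j w x * partialDeriv j (partialDeriv k w) x)]
    ring
  simp_rw [hlhs] at key
  rw [key]
  refine hσ.integral_congr_frontier fun x hx => ?_
  have hn := sum_outerNormal_sq hΩ hs hx
  simp_rw [partialDeriv_eq_normalDeriv_mul hΩ hs hw hw0 hx]
  set β := normalDeriv Ω w x
  set ν := outerNormal Ω x
  have e1 : ∑ k, β * ν k * (β * ν k) = β ^ 2 := by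
    calc ∑ k, β * ν k * (β * ν k) = β ^ 2 * ∑ k, ν k ^ 2 := by
          rw [Finset.mul_sum]
          exact Finset.sum_congr rfl fun k _ => by ring
      _ = β ^ 2 := by rw [hn, mul_one]
  have e2 : ∑ k, X k x * (β * ν k) = β * ∑ k, X k x * ν k := by
    rw [Finset.mul_sum]
    exact Finset.sum_congr rfl fun k _ => by ring
  rw [e1, e2]
  have e3 : ∀ S : ℝ, ∑ j, (2 * ((β * S) * (β * ν j)) - X j x * β ^ 2) * ν j =
      2 * β ^ 2 * S * (∑ j, ν j ^ 2) - β ^ 2 * ∑ j, X j x * ν j := by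
    intro S
    rw [Finset.mul_sum, Finset.mul_sum, ← Finset.sum_sub_distrib]
    exact Finset.sum_congr rfl fun k _ => by ring
  rw [e3, hn]
  ring

/-- Green's identity for a function that vanishes on the boundary. -/
theorem IsBoundaryMeasure.integral_green (hσ : IsBoundaryMeasure Ω σ) (hΩ : IsOpen Ω)
    (hb : Bornology.IsBounded Ω) (hs : HasSmoothBoundary Ω)
    {w : EuclideanSpace ℝ (Fin n) → ℝ} (hw : ContDiff ℝ ∞ w) (hw0 : ∀ x ∈ frontier Ω, w x = 0) :
    ∫ x in Ω, (w x * (∑ j, partialDeriv j (partialDeriv j w) x) +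
      ∑ k, partialDeriv k w x ^ 2) = 0 := by
  have key := hσ.integral_divergence hΩ hb hs (fun j => hw.mul (hw.partialDeriv j))
  have h0 : ∫ x, ∑ j, w x * partialDeriv j w x * outerNormal Ω x j ∂σ = 0 := by
    rw [hσ.integral_congr_frontier (g := fun _ => 0) fun x hx => by simp [hw0 x hx]]
    simp
  rw [h0] at key
  rw [← key]
  congr 1
  ext x
  simp_rw [fun j => partialDeriv_mul hw (hw.partialDeriv j) j x]
  rw [Finset.sum_add_distrib, Finset.mul_sum, add_comm]
  simp_rw [sq]

/-- Transport identity for a function that vanishes on the boundary. -/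
theorem IsBoundaryMeasure.integral_transport (hσ : IsBoundaryMeasure Ω σ) (hΩ : IsOpen Ω)
    (hb : Bornology.IsBounded Ω) (hs : HasSmoothBoundary Ω)
    {w : EuclideanSpace ℝ (Fin n) → ℝ} (hw : ContDiff ℝ ∞ w) (hw0 : ∀ x ∈ frontier Ω, w x = 0)
    {X : Fin n → EuclideanSpace ℝ (Fin n) → ℝ} (hX : ∀ j, ContDiff ℝ ∞ (X j)) :
    ∫ x in Ω, (2 * w x * (∑ k, X k x * partialDeriv k w x) +
      (∑ j, partialDeriv j (X j) x) * w x ^ 2) = 0 := by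
  have key := hσ.integral_divergence hΩ hb hs (fun j => (hX j).mul (hw.mul hw))
  have h0 : ∫ x, ∑ j, X j x * (w x * w x) * outerNormal Ω x j ∂σ = 0 := by
    rw [hσ.integral_congr_frontier (g := fun _ => 0) fun x hx => by simp [hw0 x hx]]
    simp
  rw [h0] at key
  rw [← key]
  congr 1
  ext x
  simp_rw [fun j => partialDeriv_mul (hX j) (hw.mul hw) j x, partialDeriv_mul hw hw]
  rw [Finset.mul_sum, Finset.sum_mul, ← Finset.sum_add_distrib]
  exact Finset.sum_congr rfl fun k _ => by ring

end

/-! ### The pointwise inequality -/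

/-- The pointwise inequality behind the Carleman estimate, for a function `w` with Laplacian `L`
and squared gradient `G`. Here `p` is the slope of the convexified weight, `d` and `z` are the
derivatives of `w` along `c` and along the inward field `Z`, `q` is the quadratic form of the
derivative of `Z` at the gradient of `w`, `D` is the divergence of `Z`, `Z₁` is the component of
`Z` along `c`, and `P` is the value of the conjugated operator. The terms that follow `3 * P ^ 2`
are the integrands of the Rellich, Green and transport identities. -/
theorem carleman_pointwise {h K A p w d L z q D Z₁ G P : ℝ} (hh : 0 < h) (hh1 : h ≤ 1)
    (hA : 0 ≤ A) (hK : 8 * A + (5 * A + 1) ^ 2 + 4 * (5 * A + 1) + 1 ≤ K) (hhK : h * K ≤ 1)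
    (hp : 1 / 2 ≤ p) (hp2 : p ≤ 2) (hG : 0 ≤ G) (hz : z ^ 2 ≤ A * G) (hq : |q| ≤ A * G)
    (hD : |D| ≤ A) (hZ : |Z₁| ≤ A)
    (hP : P = -h ^ 2 * L - p ^ 2 * w + 2 * h * p * d + h * (h * K) * w) :
    h ^ 2 * (w ^ 2 + h ^ 2 * G) ≤ 3 * P ^ 2 +
      2 * h ^ 3 * (2 * L * (p * d) + 2 * (h * K * d ^ 2) - h * K * G) +
      h ^ 4 * (2 * L * z + 2 * q - D * G) +
      (2 * h ^ 3 * (h * K) + (5 * A + 1) * h ^ 4) * (w * L + G) +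
      2 * h * (2 * w * (p ^ 3 * d) + 3 * p ^ 2 * (h * K) * w ^ 2) +
      h ^ 2 * (2 * w * (p ^ 2 * z) + (p ^ 2 * D + 2 * p * (h * K) * Z₁) * w ^ 2) -
      (5 * A + 1) * h ^ 3 * (2 * w * (p * d) + h * K * w ^ 2) := by
  -- The right-hand side minus the left-hand side is a sum of squares and two remainders. The three
  -- copies of `P ^ 2` absorb the products of `P` with the antisymmetric part `B` of the operator,
  -- with the derivative `z` along the inward field, and with `w`.
  set B := 2 * h * p * d + h * (h * K) * w with hB
  have hK0 : 0 ≤ K := by nlinarith [sq_nonneg (5 * A + 1)]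
  -- the Green identity with coefficient `5 * A + 1` pays for the terms of size `5 * A * G` that the
  -- inward field produces, and leaves one copy of `h ^ 4 * G`
  have h1 : 0 ≤ -2 * z ^ 2 + (2 * q - D * G) + 5 * A * G := by
    have := neg_abs_le q
    have h3 : D * G ≤ A * G := mul_le_mul_of_nonneg_right ((le_abs_self D).trans hD) hG
    linarith
  -- the commutator gain `4 * K * p ^ 2` dominates all other multiples of `h ^ 2 * w ^ 2`
  have h2 : 0 ≤ 4 * K * p ^ 2 + p ^ 2 * D + 2 * p * (h * K) * Z₁ - (5 * A + 1) ^ 2 * h ^ 2 / 4 -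
      (5 * A + 1) * p ^ 2 - 1 := by
    have hpp : p ^ 2 ≤ 4 := by nlinarith
    have hpp' : 1 / 4 ≤ p ^ 2 := by nlinarith
    have hpn : 0 ≤ p ^ 2 := by positivity
    have a1 : -(4 * A) ≤ p ^ 2 * D := by
      have := (abs_le.1 hD).1
      nlinarith
    have a2 : -(4 * A) ≤ 2 * p * (h * K) * Z₁ := by
      have hc : 0 ≤ 2 * p * (h * K) := by positivity
      have hc' : 2 * p * (h * K) ≤ 4 := by nlinarith [mul_nonneg hh.le hK0]
      have := (abs_le.1 hZ).1
      nlinarith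
    have a3 : (5 * A + 1) ^ 2 * h ^ 2 / 4 ≤ (5 * A + 1) ^ 2 := by
      have : h ^ 2 ≤ 1 := by nlinarith
      nlinarith [sq_nonneg (5 * A + 1)]
    have a4 : (5 * A + 1) * p ^ 2 ≤ 4 * (5 * A + 1) := by nlinarith
    have a5 : K ≤ 4 * K * p ^ 2 := by nlinarith
    linarith
  have key : 3 * P ^ 2 +
      2 * h ^ 3 * (2 * L * (p * d) + 2 * (h * K * d ^ 2) - h * K * G) +
      h ^ 4 * (2 * L * z + 2 * q - D * G) +
      (2 * h ^ 3 * (h * K) + (5 * A + 1) * h ^ 4) * (w * L + G) +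
      2 * h * (2 * w * (p ^ 3 * d) + 3 * p ^ 2 * (h * K) * w ^ 2) +
      h ^ 2 * (2 * w * (p ^ 2 * z) + (p ^ 2 * D + 2 * p * (h * K) * Z₁) * w ^ 2) -
      (5 * A + 1) * h ^ 3 * (2 * w * (p * d) + h * K * w ^ 2) - h ^ 2 * (w ^ 2 + h ^ 2 * G) =
      (P - B) ^ 2 + (P - h ^ 2 * z) ^ 2 + (B + h ^ 2 * z) ^ 2 +
      (P - (5 * A + 1) * h ^ 2 * w / 2) ^ 2 + 4 * h ^ 4 * K * d ^ 2 +
      h ^ 4 * (-2 * z ^ 2 + (2 * q - D * G) + 5 * A * G) +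
      h ^ 2 * w ^ 2 * (4 * K * p ^ 2 + p ^ 2 * D + 2 * p * (h * K) * Z₁ -
        (5 * A + 1) ^ 2 * h ^ 2 / 4 - (5 * A + 1) * p ^ 2 - 1) := by
    rw [hB, hP]
    ring
  have : 0 ≤ (P - B) ^ 2 + (P - h ^ 2 * z) ^ 2 + (B + h ^ 2 * z) ^ 2 +
      (P - (5 * A + 1) * h ^ 2 * w / 2) ^ 2 + 4 * h ^ 4 * K * d ^ 2 +
      h ^ 4 * (-2 * z ^ 2 + (2 * q - D * G) + 5 * A * G) +
      h ^ 2 * w ^ 2 * (4 * K * p ^ 2 + p ^ 2 * D + 2 * p * (h * K) * Z₁ -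
        (5 * A + 1) ^ 2 * h ^ 2 / 4 - (5 * A + 1) * p ^ 2 - 1) := by
    have e1 := mul_nonneg (pow_nonneg hh.le 4) h1
    have e2 := mul_nonneg (mul_nonneg (sq_nonneg h) (sq_nonneg w)) h2
    positivity
  linarith

section

variable {n : ℕ}

/-- The function `1 + a (c · x)`; for `a = h K` and a unit vector `c` it is the derivative in the
direction `c` of the convexified weight `c · x + h K (c · x)² / 2`. -/
noncomputable def weightSlope (c : EuclideanSpace ℝ (Fin n)) (a : ℝ)
    (x : EuclideanSpace ℝ (Fin n)) : ℝ :=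
  1 + a * inner ℝ c x

theorem contDiff_weightSlope (c : EuclideanSpace ℝ (Fin n)) (a : ℝ) :
    ContDiff ℝ ∞ (weightSlope c a) :=
  contDiff_const.add (contDiff_const.mul (contDiff_const.inner ℝ contDiff_id))

theorem partialDeriv_weightSlope (c : EuclideanSpace ℝ (Fin n)) (a : ℝ) (j : Fin n)
    (x : EuclideanSpace ℝ (Fin n)) : partialDeriv j (weightSlope c a) x = a * c j := by
  have h : HasFDerivAt (weightSlope c a) (a • innerSL ℝ c) x :=
    (((innerSL ℝ c).hasFDerivAt (x := x)).const_mul a).const_add 1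
  rw [partialDeriv, h.fderiv, ← inner_single_one c j]
  simp

/-- The operator `e^{φ̃/h} (-h² Δ) e^{-φ̃/h}` for the weight `φ̃ = c · x + h K (c · x)² / 2`, where
`c` is a unit vector. -/
noncomputable def convexifiedOperator (c : EuclideanSpace ℝ (Fin n)) (h K : ℝ)
    (w : EuclideanSpace ℝ (Fin n) → ℝ) (x : EuclideanSpace ℝ (Fin n)) : ℝ :=
  -h ^ 2 * (∑ j, partialDeriv j (partialDeriv j w) x) - weightSlope c (h * K) x ^ 2 * w x +
    2 * h * weightSlope c (h * K) x * (∑ k, c k * partialDeriv k w x) + h * (h * K) * w x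

theorem continuous_convexifiedOperator (c : EuclideanSpace ℝ (Fin n)) (h K : ℝ)
    {w : EuclideanSpace ℝ (Fin n) → ℝ} (hw : ContDiff ℝ ∞ w) :
    Continuous (convexifiedOperator c h K w) := by
  have h1 := fun k => (hw.partialDeriv k).continuous
  have h2 := fun k => ((hw.partialDeriv k).partialDeriv k).continuous
  have h3 := hw.continuous
  have h4 := (contDiff_weightSlope c (h * K)).continuous
  unfold convexifiedOperator
  fun_prop

/-- One constant bounds everything that the pointwise inequality needs to know of a vector field. -/
theorem exists_vectorField_bound {Ω : Set (EuclideanSpace ℝ (Fin n))}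
    (hb : Bornology.IsBounded Ω) {Z : Fin n → EuclideanSpace ℝ (Fin n) → ℝ}
    (hZ : ∀ k, ContDiff ℝ ∞ (Z k)) (c : EuclideanSpace ℝ (Fin n)) :
    ∃ A, 0 ≤ A ∧ ∀ x ∈ closure Ω, |∑ k, c k * Z k x| ≤ A ∧ |∑ k, partialDeriv k (Z k) x| ≤ A ∧
      ∀ v : Fin n → ℝ, (∑ k, Z k x * v k) ^ 2 ≤ A * ∑ k, v k ^ 2 ∧
        |∑ j, ∑ k, partialDeriv j (Z k) x * v j * v k| ≤ A * ∑ k, v k ^ 2 := by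
  have h1 := fun k => (hZ k).continuous
  have h2 := fun j k => ((hZ k).partialDeriv j).continuous
  have hcont : Continuous fun x => |∑ k, c k * Z k x| + |∑ k, partialDeriv k (Z k) x| +
    ∑ k, Z k x ^ 2 + ∑ j, ∑ k, |partialDeriv j (Z k) x| := by fun_prop
  obtain ⟨A, hA⟩ := hb.isCompact_closure.exists_bound_of_continuousOn hcont.continuousOn
  refine ⟨max A 0, le_max_right _ _, fun x hx => ?_⟩
  have hAx := (le_abs_self _).trans (hA x hx) |>.trans (le_max_left A 0)
  have p1 := abs_nonneg (∑ k, c k * Z k x)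
  have p2 := abs_nonneg (∑ k, partialDeriv k (Z k) x)
  have p3 : 0 ≤ ∑ k, Z k x ^ 2 := Finset.sum_nonneg fun k _ => sq_nonneg _
  have p4 : 0 ≤ ∑ j, ∑ k, |partialDeriv j (Z k) x| :=
    Finset.sum_nonneg fun j _ => Finset.sum_nonneg fun k _ => abs_nonneg _
  refine ⟨by linarith, by linarith, fun v => ?_⟩
  have hG : 0 ≤ ∑ k, v k ^ 2 := Finset.sum_nonneg fun k _ => sq_nonneg _
  constructor
  · refine (Finset.sum_mul_sq_le_sq_mul_sq _ _ _).trans ?_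
    exact mul_le_mul_of_nonneg_right (by linarith) hG
  · calc |∑ j, ∑ k, partialDeriv j (Z k) x * v j * v k|
        ≤ ∑ j, ∑ k, |partialDeriv j (Z k) x| * ∑ k, v k ^ 2 := by
          refine (Finset.abs_sum_le_sum_abs _ _).trans (Finset.sum_le_sum fun j _ => ?_)
          refine (Finset.abs_sum_le_sum_abs _ _).trans (Finset.sum_le_sum fun k _ => ?_)
          rw [mul_assoc, abs_mul]
          refine mul_le_mul_of_nonneg_left ?_ (abs_nonneg _)
          have hj := Finset.single_le_sum (f := fun k => v k ^ 2) (fun _ _ => sq_nonneg _)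
            (Finset.mem_univ j)
          have hk := Finset.single_le_sum (f := fun k => v k ^ 2) (fun _ _ => sq_nonneg _)
            (Finset.mem_univ k)
          rw [abs_le]
          constructor <;> nlinarith [sq_nonneg (v j + v k), sq_nonneg (v j - v k)]
      _ = (∑ j, ∑ k, |partialDeriv j (Z k) x|) * ∑ k, v k ^ 2 := by
          simp_rw [Finset.sum_mul]
      _ ≤ _ := mul_le_mul_of_nonneg_right (by linarith) hG

end

/-! ### The real estimate for the convexified weight -/

section

variable {n : ℕ} {Ω : Set (EuclideanSpace ℝ (Fin n))} {σ : Measure (EuclideanSpace ℝ (Fin n))}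

/-- Carleman estimate for real functions and the convexified weight. The term `-h ^ 4` in the
boundary coefficient is the gain from the inward vector field. -/
theorem IsBoundaryMeasure.carleman_real (hσ : IsBoundaryMeasure Ω σ) (hΩ : IsOpen Ω)
    (hb : Bornology.IsBounded Ω) (hs : HasSmoothBoundary Ω) {c : EuclideanSpace ℝ (Fin n)}
    (hc : ‖c‖ = 1) :
    ∃ K h₀ : ℝ, 0 < K ∧ 0 < h₀ ∧ h₀ ≤ 1 ∧ ∀ h, 0 < h → h ≤ h₀ →
      (∀ x ∈ closure Ω, |h * K * inner ℝ c x| ≤ 1 / 4) ∧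
      ∀ w : EuclideanSpace ℝ (Fin n) → ℝ, ContDiff ℝ ∞ w → (∀ x ∈ frontier Ω, w x = 0) →
        h ^ 2 * ∫ x in Ω, (w x ^ 2 + h ^ 2 * ∑ k, partialDeriv k w x ^ 2) ≤
          3 * (∫ x in Ω, convexifiedOperator c h K w x ^ 2) +
          ∫ x, (2 * h ^ 3 * weightSlope c (h * K) x * inner ℝ (outerNormal Ω x) c - h ^ 4) *
            normalDeriv Ω w x ^ 2 ∂σ := by
  obtain ⟨Zv, hZv, hZν⟩ := exists_inward_vectorField hΩ hs
  obtain ⟨Z, hZdef⟩ : ∃ Z : Fin n → EuclideanSpace ℝ (Fin n) → ℝ, ∀ k x, Z k x = Zv x k :=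
    ⟨fun k x => Zv x k, fun _ _ => rfl⟩
  have hZ : ∀ k, ContDiff ℝ ∞ (Z k) := by
    intro k
    have : Z k = fun x => Zv x k := funext fun x => hZdef k x
    rw [this]
    exact (EuclideanSpace.proj k : EuclideanSpace ℝ (Fin n) →L[ℝ] ℝ).contDiff.comp hZv
  obtain ⟨A, hA, hAb⟩ := exists_vectorField_bound hb hZ c
  obtain ⟨R, hR⟩ := hb.isCompact_closure.exists_bound_of_continuousOn
    (f := fun x => inner ℝ c x) (by fun_prop)
  obtain ⟨K, hK⟩ : ∃ K, K = 8 * A + (5 * A + 1) ^ 2 + 4 * (5 * A + 1) + 1 := ⟨_, rfl⟩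
  have hK0 : 0 < K := by rw [hK]; positivity
  obtain ⟨M, hM, hMR⟩ : ∃ M : ℝ, 0 < M ∧ R ≤ M := ⟨max R 1, by positivity, le_max_left _ _⟩
  refine ⟨K, min 1 (min (1 / K) (1 / (4 * K * M))), hK0, by positivity, min_le_left _ _, ?_⟩
  intro h hh hh0
  have hh1 : h ≤ 1 := hh0.trans (min_le_left _ _)
  have hhK : h * K ≤ 1 := by
    have := hh0.trans ((min_le_right _ _).trans (min_le_left _ _))
    rwa [le_div_iff₀ hK0] at this
  have hhM : h * K * M ≤ 1 / 4 := by
    have := hh0.trans ((min_le_right _ _).trans (min_le_right _ _))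
    rw [le_div_iff₀ (by positivity)] at this
    linarith
  have hsmall : ∀ x ∈ closure Ω, |h * K * inner ℝ c x| ≤ 1 / 4 := by
    intro x hx
    rw [abs_mul, abs_of_pos (mul_pos hh hK0)]
    have := (hR x hx).trans hMR
    rw [Real.norm_eq_abs] at this
    exact (mul_le_mul_of_nonneg_left this (by positivity)).trans hhM
  refine ⟨hsmall, fun w hw hw0 => ?_⟩
  set p := weightSlope c (h * K) with hp
  have hpd : ContDiff ℝ ∞ p := contDiff_weightSlope c (h * K)
  have hpp : ∀ j x, partialDeriv j p x = h * K * c j := partialDeriv_weightSlope c (h * K)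
  have hp2d : ContDiff ℝ ∞ fun x => p x * p x := hpd.mul hpd
  have hpp2 : ∀ j x, partialDeriv j (fun x => p x * p x) x = 2 * p x * (h * K * c j) := by
    intro j x
    rw [partialDeriv_mul hpd hpd, hpp]
    ring
  have hp3d : ContDiff ℝ ∞ fun x => p x * (p x * p x) := hpd.mul hp2d
  have hpp3 : ∀ j x, partialDeriv j (fun x => p x * (p x * p x)) x =
      3 * p x ^ 2 * (h * K * c j) := by
    intro j x
    rw [partialDeriv_mul hpd hp2d, hpp, hpp2]
    ring
  have hcsum := sum_sq_of_norm_eq_one hc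
  -- the quantities that enter the pointwise inequality
  obtain ⟨L, hL⟩ : ∃ L : EuclideanSpace ℝ (Fin n) → ℝ,
    ∀ x, ∑ j, partialDeriv j (partialDeriv j w) x = L x := ⟨_, fun _ => rfl⟩
  obtain ⟨G, hG⟩ : ∃ G : EuclideanSpace ℝ (Fin n) → ℝ,
    ∀ x, ∑ k, partialDeriv k w x ^ 2 = G x := ⟨_, fun _ => rfl⟩
  obtain ⟨d, hd⟩ : ∃ d : EuclideanSpace ℝ (Fin n) → ℝ,
    ∀ x, ∑ k, c k * partialDeriv k w x = d x := ⟨_, fun _ => rfl⟩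
  obtain ⟨z, hz⟩ : ∃ z : EuclideanSpace ℝ (Fin n) → ℝ,
    ∀ x, ∑ k, Z k x * partialDeriv k w x = z x := ⟨_, fun _ => rfl⟩
  obtain ⟨q, hq⟩ : ∃ q : EuclideanSpace ℝ (Fin n) → ℝ,
    ∀ x, ∑ j, ∑ k, partialDeriv j (Z k) x * partialDeriv j w x * partialDeriv k w x = q x :=
    ⟨_, fun _ => rfl⟩
  obtain ⟨D, hD⟩ : ∃ D : EuclideanSpace ℝ (Fin n) → ℝ,
    ∀ x, ∑ k, partialDeriv k (Z k) x = D x := ⟨_, fun _ => rfl⟩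
  obtain ⟨Z₁, hZ₁⟩ : ∃ Z₁ : EuclideanSpace ℝ (Fin n) → ℝ,
    ∀ x, ∑ k, c k * Z k x = Z₁ x := ⟨_, fun _ => rfl⟩
  have cw := hw.continuous
  have cw1 := fun k => (hw.partialDeriv k).continuous
  have cw2 := fun k => ((hw.partialDeriv k).partialDeriv k).continuous
  have cp := hpd.continuous
  have cZ := fun k => (hZ k).continuous
  have cZ1 := fun j k => ((hZ k).partialDeriv j).continuous
  have cL : Continuous L := by rw [← funext hL]; fun_prop
  have cG : Continuous G := by rw [← funext hG]; fun_prop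
  have cd : Continuous d := by rw [← funext hd]; fun_prop
  have cz : Continuous z := by rw [← funext hz]; fun_prop
  have cq : Continuous q := by rw [← funext hq]; fun_prop
  have cD : Continuous D := by rw [← funext hD]; fun_prop
  have cZ₁ : Continuous Z₁ := by rw [← funext hZ₁]; fun_prop
  have hcG : ∀ x, ∑ k, (c k * p x) * partialDeriv k w x = p x * d x := by
    intro x
    rw [← hd, Finset.mul_sum]
    exact Finset.sum_congr rfl fun k _ => by ring
  -- Rellich identities for the fields `p c` and `Z`
  have r1 := hσ.integral_rellich hΩ hb hs hw hw0 (X := fun k x => c k * p x)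
    (fun k => contDiff_const.mul hpd)
  have r2 := hσ.integral_rellich hΩ hb hs hw hw0 hZ
  have g1 := hσ.integral_green hΩ hb hs hw hw0
  -- transport identities for the fields `p³ c`, `p² Z` and `p c`
  have t1 := hσ.integral_transport hΩ hb hs hw hw0 (X := fun k x => c k * (p x * (p x * p x)))
    (fun k => contDiff_const.mul hp3d)
  have t2 := hσ.integral_transport hΩ hb hs hw hw0 (X := fun k x => (p x * p x) * Z k x)
    (fun k => hp2d.mul (hZ k))
  have t3 := hσ.integral_transport hΩ hb hs hw hw0 (X := fun k x => c k * p x)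
    (fun k => contDiff_const.mul hpd)
  have s1 : ∀ x, ∑ j, partialDeriv j (fun x => c j * p x) x = h * K := by
    intro x
    simp_rw [partialDeriv_const_mul hpd, hpp]
    calc ∑ j, c j * (h * K * c j) = h * K * ∑ j, c j ^ 2 := by
          rw [Finset.mul_sum]
          exact Finset.sum_congr rfl fun k _ => by ring
      _ = h * K := by rw [hcsum, mul_one]
  have s2 : ∀ x, ∑ j, ∑ k, partialDeriv j (fun x => c k * p x) x * partialDeriv j w x *
      partialDeriv k w x = h * K * d x ^ 2 := by
    intro x
    simp_rw [partialDeriv_const_mul hpd, hpp]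
    rw [sq, ← hd, Finset.sum_mul_sum, Finset.mul_sum]
    refine Finset.sum_congr rfl fun j _ => ?_
    rw [Finset.mul_sum]
    exact Finset.sum_congr rfl fun k _ => by ring
  have s3 : ∀ x, ∑ j, partialDeriv j (fun x => c j * (p x * (p x * p x))) x =
      3 * p x ^ 2 * (h * K) := by
    intro x
    simp_rw [partialDeriv_const_mul hp3d, hpp3]
    calc ∑ j, c j * (3 * p x ^ 2 * (h * K * c j)) = 3 * p x ^ 2 * (h * K) * ∑ j, c j ^ 2 := by
          rw [Finset.mul_sum]
          exact Finset.sum_congr rfl fun k _ => by ring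
      _ = _ := by rw [hcsum, mul_one]
  have s4 : ∀ x, ∑ j, partialDeriv j (fun x => (p x * p x) * Z j x) x =
      p x ^ 2 * D x + 2 * p x * (h * K) * Z₁ x := by
    intro x
    simp_rw [fun j => partialDeriv_mul hp2d (hZ j) j x, hpp2]
    rw [← hD, ← hZ₁, Finset.mul_sum, Finset.mul_sum, ← Finset.sum_add_distrib]
    exact Finset.sum_congr rfl fun k _ => by ring
  have s5 : ∀ x, ∑ k, c k * (p x * (p x * p x)) * partialDeriv k w x = p x ^ 3 * d x := by
    intro x
    rw [← hd, Finset.mul_sum]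
    exact Finset.sum_congr rfl fun k _ => by ring
  have s6 : ∀ x, ∑ k, (p x * p x) * Z k x * partialDeriv k w x = p x ^ 2 * z x := by
    intro x
    rw [← hz, Finset.mul_sum]
    exact Finset.sum_congr rfl fun k _ => by ring
  simp only [s1, s2, s3, s4, s5, s6, hcG, hL, hG, hz, hq, hD] at r1 r2 g1 t1 t2 t3
  have hPw : ∀ x, convexifiedOperator c h K w x =
      -h ^ 2 * L x - p x ^ 2 * w x + 2 * h * p x * d x + h * (h * K) * w x := by
    intro x
    rw [convexifiedOperator, hL, hd]
  have cP := continuous_convexifiedOperator c h K hw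
  have hpoint : ∀ x ∈ Ω, h ^ 2 * (w x ^ 2 + h ^ 2 * G x) ≤
      3 * convexifiedOperator c h K w x ^ 2 +
      2 * h ^ 3 * (2 * L x * (p x * d x) + 2 * (h * K * d x ^ 2) - h * K * G x) +
      h ^ 4 * (2 * L x * z x + 2 * q x - D x * G x) +
      (2 * h ^ 3 * (h * K) + (5 * A + 1) * h ^ 4) * (w x * L x + G x) +
      2 * h * (2 * w x * (p x ^ 3 * d x) + 3 * p x ^ 2 * (h * K) * w x ^ 2) +
      h ^ 2 * (2 * w x * (p x ^ 2 * z x) +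
        (p x ^ 2 * D x + 2 * p x * (h * K) * Z₁ x) * w x ^ 2) -
      (5 * A + 1) * h ^ 3 * (2 * w x * (p x * d x) + h * K * w x ^ 2) := by
    intro x hx
    obtain ⟨b1, b2, b3⟩ := hAb x (subset_closure hx)
    obtain ⟨b4, b5⟩ := b3 fun k => partialDeriv k w x
    rw [hZ₁] at b1
    rw [hD] at b2
    rw [hz, hG] at b4
    rw [hq, hG] at b5
    have b6 := abs_le.1 (hsmall x (subset_closure hx))
    have b7 : p x = 1 + h * K * inner ℝ c x := rfl
    have b8 : 0 ≤ G x := by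
      rw [← hG]
      exact Finset.sum_nonneg fun k _ => sq_nonneg _
    exact carleman_pointwise hh hh1 hA hK.ge hhK (by linarith [b6.1]) (by linarith [b6.2]) b8 b4
      b5 b2 b1 (hPw x)
  have hint : ∀ f : EuclideanSpace ℝ (Fin n) → ℝ, Continuous f → Integrable f (volume.restrict Ω) :=
    fun f hf => hf.integrableOn_of_isBounded hb
  simp only [hG]
  have hmono := setIntegral_mono_on (hint _ (by fun_prop)) (hint _ (by fun_prop))
    hΩ.measurableSet hpoint
  rw [integral_sub (hint _ (by fun_prop)) (hint _ (by fun_prop)),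
    integral_add (hint _ (by fun_prop)) (hint _ (by fun_prop)),
    integral_add (hint _ (by fun_prop)) (hint _ (by fun_prop)),
    integral_add (hint _ (by fun_prop)) (hint _ (by fun_prop)),
    integral_add (hint _ (by fun_prop)) (hint _ (by fun_prop)),
    integral_add (hint _ (by fun_prop)) (hint _ (by fun_prop))] at hmono
  simp only [integral_const_mul] at hmono
  rw [r1, r2, g1, t1, t2, t3] at hmono
  refine hmono.trans ?_
  have hN : ContinuousOn (normalDeriv Ω w) (frontier Ω) :=
    (hw.continuous_fderiv (by simp)).continuousOn.clm_apply (continuousOn_outerNormal hΩ hs)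
  have hν := continuousOn_outerNormal_apply hΩ hs
  have hbd1 : ContinuousOn (fun x => (∑ j, c j * p x * outerNormal Ω x j) *
      normalDeriv Ω w x ^ 2) (frontier Ω) := by
    have := cp.continuousOn (s := frontier Ω)
    fun_prop
  have hbd2 : ContinuousOn (fun x => (∑ j, Z j x * outerNormal Ω x j) *
      normalDeriv Ω w x ^ 2) (frontier Ω) := by
    have := fun k => (cZ k).continuousOn (s := frontier Ω)
    fun_prop
  have hbd3 : ContinuousOn (fun x => (2 * h ^ 3 * p x * inner ℝ (outerNormal Ω x) c - h ^ 4) *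
      normalDeriv Ω w x ^ 2) (frontier Ω) := by
    have := cp.continuousOn (s := frontier Ω)
    have := continuousOn_outerNormal hΩ hs
    fun_prop
  have i1 := ContinuousOn.integrable_boundaryMeasure hb hσ hbd1
  have i2 := ContinuousOn.integrable_boundaryMeasure hb hσ hbd2
  have i3 := ContinuousOn.integrable_boundaryMeasure hb hσ hbd3
  have hbdry : 2 * h ^ 3 * (∫ x, (∑ j, c j * p x * outerNormal Ω x j) *
      normalDeriv Ω w x ^ 2 ∂σ) + h ^ 4 * (∫ x, (∑ j, Z j x * outerNormal Ω x j) *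
      normalDeriv Ω w x ^ 2 ∂σ) ≤
      ∫ x, (2 * h ^ 3 * p x * inner ℝ (outerNormal Ω x) c - h ^ 4) *
            normalDeriv Ω w x ^ 2 ∂σ := by
    rw [← integral_const_mul, ← integral_const_mul, ← integral_add (i1.const_mul _)
      (i2.const_mul _)]
    refine integral_mono_ae ((i1.const_mul _).add (i2.const_mul _)) i3 ?_
    filter_upwards [mem_ae_iff.2 hσ.compl_frontier] with x hx
    have e1 : ∑ j, c j * p x * outerNormal Ω x j = p x * inner ℝ (outerNormal Ω x) c := by
      rw [PiLp.inner_apply, Finset.mul_sum]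
      refine Finset.sum_congr rfl fun k _ => ?_
      simp
      ring
    have e2 : ∑ j, Z j x * outerNormal Ω x j = inner ℝ (outerNormal Ω x) (Zv x) := by
      rw [PiLp.inner_apply]
      refine Finset.sum_congr rfl fun k _ => ?_
      simp [hZdef]
    simp only [e1, e2]
    have e3 := hZν x hx
    have e4 : 0 ≤ h ^ 4 * normalDeriv Ω w x ^ 2 := by positivity
    nlinarith
  linarith

end

/-! ### Conjugation by weights -/

section

variable {n : ℕ}

theorem partialDeriv_smul {F : Type*} [NormedAddCommGroup F] [NormedSpace ℝ F]
    {f : EuclideanSpace ℝ (Fin n) → ℝ} {v : EuclideanSpace ℝ (Fin n) → F} (hf : ContDiff ℝ ∞ f)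
    (hv : ContDiff ℝ ∞ v) (j : Fin n) (x : EuclideanSpace ℝ (Fin n)) :
    partialDeriv j (fun y => f y • v y) x = f x • partialDeriv j v x + partialDeriv j f x • v x := by
  rw [partialDeriv, fderiv_fun_smul (hf.differentiable (by simp) x) (hv.differentiable (by simp) x)]
  simp [partialDeriv]

theorem partialDeriv_add {F : Type*} [NormedAddCommGroup F] [NormedSpace ℝ F]
    {f v : EuclideanSpace ℝ (Fin n) → F} (hf : ContDiff ℝ ∞ f)
    (hv : ContDiff ℝ ∞ v) (j : Fin n) (x : EuclideanSpace ℝ (Fin n)) :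
    partialDeriv j (fun y => f y + v y) x = partialDeriv j f x + partialDeriv j v x := by
  rw [partialDeriv, fderiv_fun_add (hf.differentiable (by simp) x) (hv.differentiable (by simp) x)]
  simp [partialDeriv]

theorem partialDeriv_inner (c : EuclideanSpace ℝ (Fin n)) (j : Fin n)
    (x : EuclideanSpace ℝ (Fin n)) : partialDeriv j (fun y => inner ℝ c y) x = c j := by
  have h : HasFDerivAt (fun y => inner ℝ c y) (innerSL ℝ c) x := (innerSL ℝ c).hasFDerivAt
  rw [partialDeriv, h.fderiv, ← inner_single_one c j]
  simp

theorem partialDeriv_exp {f : EuclideanSpace ℝ (Fin n) → ℝ} (hf : ContDiff ℝ ∞ f) (j : Fin n)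
    (x : EuclideanSpace ℝ (Fin n)) :
    partialDeriv j (fun y => Real.exp (f y)) x = Real.exp (f x) * partialDeriv j f x := by
  rw [partialDeriv, fderiv_exp (hf.differentiable (by simp) x)]
  simp [partialDeriv]

theorem partialDeriv_weight_smul {F : Type*} [NormedAddCommGroup F] [NormedSpace ℝ F]
    {c : EuclideanSpace ℝ (Fin n)} {g a : EuclideanSpace ℝ (Fin n) → ℝ} (hg : ContDiff ℝ ∞ g)
    (hgd : ∀ j x, partialDeriv j g x = g x * (a x * c j))
    {v : EuclideanSpace ℝ (Fin n) → F} (hv : ContDiff ℝ ∞ v) (j : Fin n)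
    (x : EuclideanSpace ℝ (Fin n)) :
    partialDeriv j (fun y => g y • v y) x = g x • (partialDeriv j v x + (a x * c j) • v x) := by
  rw [partialDeriv_smul hg hv, hgd]
  module

/-- The Laplacian of `g v` for a weight `g` that depends only on `c · x`, where `c` is a unit
vector; `a` is the logarithmic derivative of `g` in the direction `c`. -/
theorem sum_partialDeriv_weight_smul {F : Type*} [NormedAddCommGroup F] [NormedSpace ℝ F]
    {c : EuclideanSpace ℝ (Fin n)} (hc : ‖c‖ = 1) {g a : EuclideanSpace ℝ (Fin n) → ℝ} {b : ℝ}
    (hg : ContDiff ℝ ∞ g) (ha : ContDiff ℝ ∞ a)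
    (hgd : ∀ j x, partialDeriv j g x = g x * (a x * c j))
    (had : ∀ j x, partialDeriv j a x = b * c j)
    {v : EuclideanSpace ℝ (Fin n) → F} (hv : ContDiff ℝ ∞ v) (x : EuclideanSpace ℝ (Fin n)) :
    ∑ j, partialDeriv j (partialDeriv j fun y => g y • v y) x =
      g x • (∑ j, partialDeriv j (partialDeriv j v) x +
        (2 * a x) • ∑ k, c k • partialDeriv k v x + (a x ^ 2 + b) • v x) := by
  have hcsum := sum_sq_of_norm_eq_one hc
  have hj : ∀ j, partialDeriv j (partialDeriv j fun y => g y • v y) x =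
      g x • partialDeriv j (partialDeriv j v) x + (g x * (2 * a x)) • (c j • partialDeriv j v x) +
        c j ^ 2 • ((g x * (a x ^ 2 + b)) • v x) := by
    intro j
    have h1 : (partialDeriv j fun y => g y • v y) =
        fun y => g y • (partialDeriv j v y + (a y * c j) • v y) :=
      funext fun y => partialDeriv_weight_smul hg hgd hv j y
    have hac : ContDiff ℝ ∞ fun y => a y * c j := ha.mul contDiff_const
    have hacd : partialDeriv j (fun y => a y * c j) x = b * c j * c j := by
      have : (fun y => a y * c j) = fun y => c j * a y := funext fun y => mul_comm _ _
      rw [this, partialDeriv_const_mul ha, had]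
      ring
    have hacv : ContDiff ℝ ∞ fun y => (a y * c j) • v y := hac.smul hv
    have hsum : ContDiff ℝ ∞ fun y => partialDeriv j v y + (a y * c j) • v y :=
      (hv.partialDeriv j).add hacv
    rw [h1, partialDeriv_weight_smul hg hgd hsum, partialDeriv_add (hv.partialDeriv j) hacv,
      partialDeriv_smul hac hv, hacd]
    module
  simp_rw [hj]
  rw [Finset.sum_add_distrib, Finset.sum_add_distrib, ← Finset.smul_sum, ← Finset.smul_sum,
    ← Finset.sum_smul, hcsum]
  module

/-- The operator `v ↦ e^{φ/h} (-h² Δ) (e^{-φ/h} v)` for `φ = c · x`, where `c` is a unit vector. -/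
noncomputable def freeOperator {F : Type*} [NormedAddCommGroup F] [NormedSpace ℝ F]
    (c : EuclideanSpace ℝ (Fin n)) (h : ℝ) (v : EuclideanSpace ℝ (Fin n) → F)
    (x : EuclideanSpace ℝ (Fin n)) : F :=
  (-h ^ 2) • (∑ j, partialDeriv j (partialDeriv j v) x) +
    (2 * h) • (∑ k, c k • partialDeriv k v x) - v x

theorem continuous_freeOperator {F : Type*} [NormedAddCommGroup F] [NormedSpace ℝ F]
    (c : EuclideanSpace ℝ (Fin n)) (h : ℝ) {v : EuclideanSpace ℝ (Fin n) → F}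
    (hv : ContDiff ℝ ∞ v) : Continuous (freeOperator c h v) := by
  have h1 := fun k => (hv.partialDeriv k).continuous
  have h2 := fun k => ((hv.partialDeriv k).partialDeriv k).continuous
  have h3 := hv.continuous
  unfold freeOperator
  fun_prop

/-- The exponentials in the definition of the conjugated operator cancel. -/
theorem conjugatedSchrodinger_eq {c : EuclideanSpace ℝ (Fin n)} (hc : ‖c‖ = 1)
    (q : EuclideanSpace ℝ (Fin n) → ℂ) {h : ℝ} (hh : h ≠ 0) {u : EuclideanSpace ℝ (Fin n) → ℂ}
    (hu : ContDiff ℝ ∞ u) (x : EuclideanSpace ℝ (Fin n)) :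
    conjugatedSchrodinger (fun x => inner ℝ c x) q h u x =
      freeOperator c h u x + h ^ 2 * q x * u x := by
  have hi : ContDiff ℝ ∞ fun x : EuclideanSpace ℝ (Fin n) => (inner ℝ c x : ℝ) :=
    contDiff_const.inner ℝ contDiff_id
  have hφ : ContDiff ℝ ∞ fun x : EuclideanSpace ℝ (Fin n) => -inner ℝ c x / h :=
    hi.neg.div_const h
  have hφd : ∀ j x, partialDeriv j (fun x => -inner ℝ c x / h) x = -h⁻¹ * c j := by
    intro j x
    have : (fun x => -inner ℝ c x / h) = fun x => -h⁻¹ * inner ℝ c x := by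
      ext y
      field_simp
    rw [this, partialDeriv_const_mul hi, partialDeriv_inner]
  have hg : ContDiff ℝ ∞ fun x : EuclideanSpace ℝ (Fin n) => Real.exp (-inner ℝ c x / h) := hφ.exp
  have hgu : ContDiff ℝ ∞ fun y => Real.exp (-inner ℝ c y / h) • u y := hg.smul hu
  have e : (fun y => (Real.exp (-inner ℝ c y / h) : ℂ) * u y) =
      fun y => Real.exp (-inner ℝ c y / h) • u y := funext fun y => (Complex.real_smul).symm
  rw [conjugatedSchrodinger, e, laplacian_eq_sum_partialDeriv hgu,
    sum_partialDeriv_weight_smul hc (a := fun _ => -h⁻¹) (b := 0) hg contDiff_const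
      (fun j x => by rw [partialDeriv_exp hφ, hφd]) (fun j x => by simp [partialDeriv]) hu,
    freeOperator]
  have hexp : (Real.exp (inner ℝ c x / h) : ℂ) * (Real.exp (-inner ℝ c x / h) : ℂ) = 1 := by
    rw [← Complex.ofReal_mul, ← Real.exp_add]
    simp [neg_div]
  have hh' : (h : ℂ) ≠ 0 := by exact_mod_cast hh
  simp only [Complex.real_smul]
  push_cast at hexp ⊢
  generalize (∑ j, partialDeriv j (partialDeriv j u) x) = L
  generalize (∑ k, (c k : ℂ) * partialDeriv k u x) = d
  calc Complex.exp (inner ℝ c x / h) * (-(h : ℂ) ^ 2 * (Complex.exp (-inner ℝ c x / h) *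
        (L + 2 * -(h : ℂ)⁻¹ * d + ((-(h : ℂ)⁻¹) ^ 2 + 0) * u x)) +
        h ^ 2 * q x * (Complex.exp (-inner ℝ c x / h) * u x))
      = (Complex.exp (inner ℝ c x / h) * Complex.exp (-inner ℝ c x / h)) *
        (-(h : ℂ) ^ 2 * (L + 2 * -(h : ℂ)⁻¹ * d + ((-(h : ℂ)⁻¹) ^ 2 + 0) * u x) +
          h ^ 2 * q x * u x) := by ring
    _ = _ := by
        rw [hexp]
        field_simp
        ring

/-- The convexifying factor `e^{K (c · x)² / 2}`. -/
noncomputable def convexFactor (c : EuclideanSpace ℝ (Fin n)) (K : ℝ)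
    (x : EuclideanSpace ℝ (Fin n)) : ℝ :=
  Real.exp (K / 2 * (inner ℝ c x * inner ℝ c x))

theorem contDiff_convexFactor (c : EuclideanSpace ℝ (Fin n)) (K : ℝ) :
    ContDiff ℝ ∞ (convexFactor c K) :=
  (contDiff_const.mul ((contDiff_const.inner ℝ contDiff_id).mul
    (contDiff_const.inner ℝ contDiff_id))).exp

theorem partialDeriv_convexFactor (c : EuclideanSpace ℝ (Fin n)) (K : ℝ) (j : Fin n)
    (x : EuclideanSpace ℝ (Fin n)) :
    partialDeriv j (convexFactor c K) x = convexFactor c K x * (K * inner ℝ c x * c j) := by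
  have h1 : ContDiff ℝ ∞ fun x : EuclideanSpace ℝ (Fin n) => (inner ℝ c x : ℝ) :=
    contDiff_const.inner ℝ contDiff_id
  have h2 := h1.mul h1
  have : convexFactor c K = fun x => Real.exp (K / 2 * (inner ℝ c x * inner ℝ c x)) := rfl
  rw [this, partialDeriv_exp (contDiff_const.mul h2), partialDeriv_const_mul h2,
    partialDeriv_mul h1 h1, partialDeriv_inner]
  ring

theorem one_le_convexFactor (c : EuclideanSpace ℝ (Fin n)) {K : ℝ} (hK : 0 ≤ K)
    (x : EuclideanSpace ℝ (Fin n)) : 1 ≤ convexFactor c K x :=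
  Real.one_le_exp (mul_nonneg (by linarith) (mul_self_nonneg _))

theorem partialDeriv_convexFactor_mul (c : EuclideanSpace ℝ (Fin n)) (K : ℝ)
    {v : EuclideanSpace ℝ (Fin n) → ℝ} (hv : ContDiff ℝ ∞ v) (j : Fin n)
    (x : EuclideanSpace ℝ (Fin n)) :
    partialDeriv j (fun y => convexFactor c K y * v y) x =
      convexFactor c K x * (partialDeriv j v x + K * inner ℝ c x * c j * v x) :=
  partialDeriv_weight_smul (a := fun x => K * inner ℝ c x) (contDiff_convexFactor c K)
    (fun j x => partialDeriv_convexFactor c K j x) hv j x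

/-- The convexifying factor intertwines the operators that belong to the linear and to the
convexified weight. -/
theorem convexifiedOperator_convexFactor_mul {c : EuclideanSpace ℝ (Fin n)} (hc : ‖c‖ = 1)
    (h K : ℝ) {v : EuclideanSpace ℝ (Fin n) → ℝ} (hv : ContDiff ℝ ∞ v)
    (x : EuclideanSpace ℝ (Fin n)) :
    convexifiedOperator c h K (fun y => convexFactor c K y * v y) x =
      convexFactor c K x * freeOperator c h v x := by
  have hcsum := sum_sq_of_norm_eq_one hc
  have h1 : ContDiff ℝ ∞ fun x : EuclideanSpace ℝ (Fin n) => (inner ℝ c x : ℝ) :=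
    contDiff_const.inner ℝ contDiff_id
  have key := sum_partialDeriv_weight_smul hc (a := fun x => K * inner ℝ c x) (b := K)
    (contDiff_convexFactor c K) (contDiff_const.mul h1)
    (fun j x => partialDeriv_convexFactor c K j x)
    (fun j x => by rw [partialDeriv_const_mul h1, partialDeriv_inner]) hv x
  simp only [smul_eq_mul] at key
  have hd : ∑ k, c k * partialDeriv k (fun y => convexFactor c K y * v y) x =
      convexFactor c K x * (∑ k, c k * partialDeriv k v x + K * inner ℝ c x * v x) := by
    calc ∑ k, c k * partialDeriv k (fun y => convexFactor c K y * v y) x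
        = convexFactor c K x * (∑ k, c k * partialDeriv k v x +
            K * inner ℝ c x * v x * ∑ k, c k ^ 2) := by
          rw [Finset.mul_sum (a := K * inner ℝ c x * v x), ← Finset.sum_add_distrib,
            Finset.mul_sum]
          refine Finset.sum_congr rfl fun k _ => ?_
          rw [partialDeriv_convexFactor_mul c K hv]
          ring
      _ = _ := by rw [hcsum, mul_one]
  rw [convexifiedOperator, key, hd, freeOperator, weightSlope]
  simp only [smul_eq_mul]
  ring

theorem partialDeriv_clm_comp {F G : Type*} [NormedAddCommGroup F] [NormedSpace ℝ F]
    [NormedAddCommGroup G] [NormedSpace ℝ G] (T : F →L[ℝ] G) {v : EuclideanSpace ℝ (Fin n) → F}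
    (hv : ContDiff ℝ ∞ v) (j : Fin n) :
    partialDeriv j (fun y => T (v y)) = fun x => T (partialDeriv j v x) := by
  ext x
  have h := T.hasFDerivAt.comp x (hv.differentiable (by simp) x).hasFDerivAt
  have h' : fderiv ℝ (fun y => T (v y)) x = _ := h.fderiv
  rw [partialDeriv, h']
  rfl

theorem freeOperator_clm_comp {F G : Type*} [NormedAddCommGroup F] [NormedSpace ℝ F]
    [NormedAddCommGroup G] [NormedSpace ℝ G] (T : F →L[ℝ] G) (c : EuclideanSpace ℝ (Fin n)) (h : ℝ)
    {v : EuclideanSpace ℝ (Fin n) → F} (hv : ContDiff ℝ ∞ v) (x : EuclideanSpace ℝ (Fin n)) :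
    freeOperator c h (fun y => T (v y)) x = T (freeOperator c h v x) := by
  simp only [freeOperator, partialDeriv_clm_comp T hv, map_add, map_sub, map_smul, map_sum,
    fun j => partialDeriv_clm_comp T (hv.partialDeriv j) j]

end

/-! ### The real estimate for the linear weight -/

section

variable {n : ℕ} {Ω : Set (EuclideanSpace ℝ (Fin n))} {σ : Measure (EuclideanSpace ℝ (Fin n))}

/-- The part of the boundary where the component of the normal in the direction `c` lies in `I`. -/
def boundaryPart (Ω : Set (EuclideanSpace ℝ (Fin n))) (c : EuclideanSpace ℝ (Fin n)) (I : Set ℝ) :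
    Set (EuclideanSpace ℝ (Fin n)) :=
  {x ∈ frontier Ω | inner ℝ (outerNormal Ω x) c ∈ I}

theorem continuousOn_inner_outerNormal (hΩ : IsOpen Ω) (hs : HasSmoothBoundary Ω)
    (c : EuclideanSpace ℝ (Fin n)) :
    ContinuousOn (fun x => inner ℝ (outerNormal Ω x) c) (frontier Ω) :=
  ContinuousOn.inner (continuousOn_outerNormal hΩ hs) continuousOn_const

theorem measurableSet_boundaryPart (hΩ : IsOpen Ω) (hs : HasSmoothBoundary Ω)
    (c : EuclideanSpace ℝ (Fin n)) {I : Set ℝ} (hI : I.OrdConnected) :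
    MeasurableSet (boundaryPart Ω c I) := by
  have hm : MeasurableSet (frontier Ω) := isClosed_frontier.measurableSet
  have h1 : Measurable fun x : frontier Ω => (inner ℝ (outerNormal Ω x) c : ℝ) :=
    (continuousOn_iff_continuous_domRestrict.1 (continuousOn_inner_outerNormal hΩ hs c)).measurable
  have h2 := hm.subtype_image (h1 hI.measurableSet)
  convert h2 using 1
  ext x
  simp [boundaryPart, and_comm]

theorem continuousOn_normalDeriv {F : Type*} [NormedAddCommGroup F] [NormedSpace ℝ F]
    (hΩ : IsOpen Ω) (hs : HasSmoothBoundary Ω) {w : EuclideanSpace ℝ (Fin n) → F}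
    (hw : ContDiff ℝ ∞ w) : ContinuousOn (normalDeriv Ω w) (frontier Ω) :=
  (hw.continuous_fderiv (by simp)).continuousOn.clm_apply (continuousOn_outerNormal hΩ hs)

/-- Removing the convexifying factor increases the energy density by at most a factor two. -/
theorem energy_le_convexFactor_mul {c : EuclideanSpace ℝ (Fin n)} (hc : ‖c‖ = 1) {h K : ℝ}
    (hK : 0 ≤ K) {v : EuclideanSpace ℝ (Fin n) → ℝ} (hv : ContDiff ℝ ∞ v)
    {x : EuclideanSpace ℝ (Fin n)} (hx : |h * K * inner ℝ c x| ≤ 1 / 4) :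
    v x ^ 2 + h ^ 2 * ∑ k, partialDeriv k v x ^ 2 ≤
      2 * ((convexFactor c K x * v x) ^ 2 +
        h ^ 2 * ∑ k, partialDeriv k (fun y => convexFactor c K y * v y) x ^ 2) := by
  have hcsum := sum_sq_of_norm_eq_one hc
  simp_rw [partialDeriv_convexFactor_mul c K hv]
  obtain ⟨t, ht⟩ : ∃ t, h * K * inner ℝ c x = t := ⟨_, rfl⟩
  obtain ⟨d, hd⟩ : ∃ d, ∑ k, c k * partialDeriv k v x = d := ⟨_, rfl⟩
  have hE := one_le_convexFactor c hK x
  generalize convexFactor c K x = E at *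
  have e1 : h ^ 2 * ∑ k, (E * (partialDeriv k v x + K * inner ℝ c x * c k * v x)) ^ 2 =
      E ^ 2 * (h ^ 2 * ∑ k, partialDeriv k v x ^ 2 + 2 * t * h * v x * d + t ^ 2 * v x ^ 2) := by
    calc h ^ 2 * ∑ k, (E * (partialDeriv k v x + K * inner ℝ c x * c k * v x)) ^ 2
        = E ^ 2 * (h ^ 2 * ∑ k, partialDeriv k v x ^ 2 +
            2 * t * h * v x * (∑ k, c k * partialDeriv k v x) +
            t ^ 2 * v x ^ 2 * ∑ k, c k ^ 2) := by
          simp only [Finset.mul_sum, ← Finset.sum_add_distrib]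
          refine Finset.sum_congr rfl fun k _ => ?_
          rw [← ht]
          ring
      _ = _ := by rw [hcsum, hd, mul_one]
  have hdG : d ^ 2 ≤ ∑ k, partialDeriv k v x ^ 2 := by
    rw [← hd]
    refine (Finset.sum_mul_sq_le_sq_mul_sq _ _ _).trans ?_
    rw [hcsum, one_mul]
  rw [e1]
  rw [ht] at hx
  generalize (∑ k, partialDeriv k v x ^ 2) = G at *
  generalize v x = v at *
  have ht2 : t ^ 2 ≤ 1 / 16 := by
    have := sq_le_sq' (by linarith [(abs_le.1 hx).1]) (abs_le.1 hx).2
    linarith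
  have hh2 : h ^ 2 * d ^ 2 ≤ h ^ 2 * G := mul_le_mul_of_nonneg_left hdG (sq_nonneg h)
  have h1 : v ^ 2 + h ^ 2 * G ≤
      2 * (v ^ 2 + (h ^ 2 * G + 2 * t * h * v * d + t ^ 2 * v ^ 2)) := by
    nlinarith [sq_nonneg (h * d + 2 * (t * v)), mul_nonneg (sub_nonneg.2 ht2) (sq_nonneg v),
      sq_nonneg v]
  have h2 : 0 ≤ v ^ 2 + (h ^ 2 * G + 2 * t * h * v * d + t ^ 2 * v ^ 2) := by
    have : 0 ≤ h ^ 2 * G := (mul_nonneg (sq_nonneg h) (sq_nonneg d)).trans hh2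
    nlinarith [sq_nonneg v]
  have hE2 : 1 ≤ E ^ 2 := one_le_pow₀ hE
  nlinarith

theorem boundaryCoefficient_of_le_neg {h δ p ν : ℝ} (hh : 0 < h) (hδ : 0 < δ) (hp : 3 / 4 ≤ p)
    (hν : ν ≤ -δ) : 2 * h ^ 3 * p * ν - h ^ 4 ≤ -(δ * h ^ 3) := by
  have h3 : 0 < h ^ 3 := by positivity
  have h4 : 0 < h ^ 4 := by positivity
  have h1 : p * ν ≤ -(3 / 4 * δ) := by nlinarith
  have h2 := mul_le_mul_of_nonneg_left h1 h3.le
  nlinarith [mul_pos h3 hδ]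

/-- Below `h / 3` the gain `h ^ 4` wins, because `2 * (5 / 4) * (1 / 3) = 5 / 6 < 1`. -/
theorem boundaryCoefficient_of_lt {h p ν : ℝ} (hh : 0 < h) (hp0 : 3 / 4 ≤ p) (hp : p ≤ 5 / 4)
    (hν : ν < h / 3) : 2 * h ^ 3 * p * ν - h ^ 4 ≤ -(h ^ 4 / 6) := by
  have h3 : 0 < h ^ 3 := by positivity
  have h1 : p * ν ≤ 5 / 12 * h := by nlinarith
  have h2 := mul_le_mul_of_nonneg_left h1 h3.le
  linarith [show h ^ 4 = h ^ 3 * h by ring]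

theorem boundaryCoefficient_le {h p ν : ℝ} (hh : 0 < h) (hp0 : 3 / 4 ≤ p) (hp : p ≤ 5 / 4)
    (hν : ν ≤ 1) : 2 * h ^ 3 * p * ν - h ^ 4 ≤ 5 / 2 * h ^ 3 := by
  have h3 : 0 < h ^ 3 := by positivity
  have h4 : 0 < h ^ 4 := by positivity
  have h1 : p * ν ≤ 5 / 4 := by nlinarith
  have h2 := mul_le_mul_of_nonneg_left h1 h3.le
  linarith

/-- Carleman estimate for real functions and the linear weight, where the boundary is split
according to the sign of the normal component in the direction `c`. -/
theorem IsBoundaryMeasure.carleman_free_real (hσ : IsBoundaryMeasure Ω σ) (hΩ : IsOpen Ω)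
    (hb : Bornology.IsBounded Ω) (hs : HasSmoothBoundary Ω) {c : EuclideanSpace ℝ (Fin n)}
    (hc : ‖c‖ = 1) :
    ∃ M h₀ : ℝ, 1 ≤ M ∧ 0 < h₀ ∧ h₀ ≤ 1 ∧ ∀ h δ, 0 < h → h ≤ h₀ → 0 < δ →
      ∀ v : EuclideanSpace ℝ (Fin n) → ℝ, ContDiff ℝ ∞ v → (∀ x ∈ frontier Ω, v x = 0) →
        δ * h ^ 3 * (∫ x in boundaryPart Ω c (Set.Iic (-δ)), normalDeriv Ω v x ^ 2 ∂σ) +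
        h ^ 4 / 6 * (∫ x in boundaryPart Ω c (Set.Ioo (-δ) (h / 3)), normalDeriv Ω v x ^ 2 ∂σ) +
        h ^ 2 / 2 * (∫ x in Ω, (v x ^ 2 + h ^ 2 * ∑ k, partialDeriv k v x ^ 2)) ≤
          3 * M * (∫ x in Ω, freeOperator c h v x ^ 2) +
          5 / 2 * M * h ^ 3 *
            (∫ x in boundaryPart Ω c (Set.Ici (h / 3)), normalDeriv Ω v x ^ 2 ∂σ) := by
  obtain ⟨K, h₀, hK, hh₀, hh₀1, H⟩ := hσ.carleman_real hΩ hb hs hc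
  have hEc := (contDiff_convexFactor c K).continuous
  obtain ⟨M, hM⟩ := hb.isCompact_closure.exists_bound_of_continuousOn
    (f := fun x => convexFactor c K x ^ 2) (by fun_prop)
  refine ⟨max M 1, h₀, le_max_right _ _, hh₀, hh₀1, fun h δ hh hhh hδ v hv hv0 => ?_⟩
  obtain ⟨hsmall, H⟩ := H h hh hhh
  have hEM : ∀ x ∈ closure Ω, convexFactor c K x ^ 2 ≤ max M 1 := fun x hx =>
    (le_abs_self _).trans ((hM x hx).trans (le_max_left _ _))
  have hE1 : ∀ x, 1 ≤ convexFactor c K x ^ 2 := fun x =>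
    one_le_pow₀ (one_le_convexFactor c hK.le x)
  have hM1 : 1 ≤ max M 1 := le_max_right _ _
  generalize max M 1 = M at *
  have hEv : ContDiff ℝ ∞ fun y => convexFactor c K y * v y := (contDiff_convexFactor c K).mul hv
  have main := H _ hEv fun x hx => by rw [hv0 x hx, mul_zero]
  simp_rw [convexifiedOperator_convexFactor_mul hc h K hv] at main
  have hint : ∀ f : EuclideanSpace ℝ (Fin n) → ℝ, Continuous f → IntegrableOn f Ω :=
    fun f hf => hf.integrableOn_of_isBounded hb
  have cv := hv.continuous
  have cv1 := fun k => (hv.partialDeriv k).continuous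
  have cEv1 := fun k => (hEv.partialDeriv k).continuous
  have cP := continuous_freeOperator c h hv
  have hlow : ∫ x in Ω, (v x ^ 2 + h ^ 2 * ∑ k, partialDeriv k v x ^ 2) ≤
      2 * ∫ x in Ω, ((convexFactor c K x * v x) ^ 2 +
        h ^ 2 * ∑ k, partialDeriv k (fun y => convexFactor c K y * v y) x ^ 2) := by
    rw [← integral_const_mul]
    exact setIntegral_mono_on (hint _ (by fun_prop)) (hint _ (by fun_prop)) hΩ.measurableSet
      fun x hx => energy_le_convexFactor_mul hc hK.le hv (hsmall x (subset_closure hx))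
  have hup : ∫ x in Ω, (convexFactor c K x * freeOperator c h v x) ^ 2 ≤
      M * ∫ x in Ω, freeOperator c h v x ^ 2 := by
    rw [← integral_const_mul]
    refine setIntegral_mono_on (hint _ (by fun_prop)) (hint _ (by fun_prop)) hΩ.measurableSet
      fun x hx => ?_
    rw [mul_pow]
    exact mul_le_mul_of_nonneg_right (hEM x (subset_closure hx)) (sq_nonneg _)
  have hN := continuousOn_normalDeriv hΩ hs hv
  have hNE := continuousOn_normalDeriv hΩ hs hEv
  have hν := continuousOn_inner_outerNormal hΩ hs c
  have hi : Integrable (fun x => normalDeriv Ω v x ^ 2) σ :=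
    ContinuousOn.integrable_boundaryMeasure hb hσ (hN.pow 2)
  have mA := measurableSet_boundaryPart hΩ hs c (Set.ordConnected_Iic (a := -δ))
  have mB := measurableSet_boundaryPart hΩ hs c (Set.ordConnected_Ioo (a := -δ) (b := h / 3))
  have mC := measurableSet_boundaryPart hΩ hs c (Set.ordConnected_Ici (a := h / 3))
  have hbd : ∫ x, (2 * h ^ 3 * weightSlope c (h * K) x * inner ℝ (outerNormal Ω x) c - h ^ 4) *
      normalDeriv Ω (fun y => convexFactor c K y * v y) x ^ 2 ∂σ ≤
      -(δ * h ^ 3) * (∫ x in boundaryPart Ω c (Set.Iic (-δ)), normalDeriv Ω v x ^ 2 ∂σ) +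
      -(h ^ 4 / 6) * (∫ x in boundaryPart Ω c (Set.Ioo (-δ) (h / 3)),
        normalDeriv Ω v x ^ 2 ∂σ) +
      5 / 2 * M * h ^ 3 *
        (∫ x in boundaryPart Ω c (Set.Ici (h / 3)), normalDeriv Ω v x ^ 2 ∂σ) := by
    set f := fun x => normalDeriv Ω v x ^ 2 with hf
    have iA := (hi.indicator mA).const_mul (-(δ * h ^ 3))
    have iB := (hi.indicator mB).const_mul (-(h ^ 4 / 6))
    have iC := (hi.indicator mC).const_mul (5 / 2 * M * h ^ 3)
    have iAB : Integrable (fun x =>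
        -(δ * h ^ 3) * (boundaryPart Ω c (Set.Iic (-δ))).indicator f x +
        -(h ^ 4 / 6) * (boundaryPart Ω c (Set.Ioo (-δ) (h / 3))).indicator f x) σ := iA.add iB
    have iABC : Integrable (fun x =>
        -(δ * h ^ 3) * (boundaryPart Ω c (Set.Iic (-δ))).indicator f x +
        -(h ^ 4 / 6) * (boundaryPart Ω c (Set.Ioo (-δ) (h / 3))).indicator f x +
        5 / 2 * M * h ^ 3 * (boundaryPart Ω c (Set.Ici (h / 3))).indicator f x) σ := iAB.add iC
    rw [← integral_indicator mA, ← integral_indicator mB, ← integral_indicator mC,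
      ← integral_const_mul, ← integral_const_mul, ← integral_const_mul,
      ← integral_add iA iB, ← integral_add iAB iC]
    refine integral_mono_ae (ContinuousOn.integrable_boundaryMeasure hb hσ ?_) iABC ?_
    · have := (contDiff_weightSlope c (h * K)).continuous.continuousOn (s := frontier Ω)
      fun_prop
    · -- exactly one of the three indicators is nonzero at a boundary point
      filter_upwards [mem_ae_iff.2 hσ.compl_frontier] with x hx
      have hx : x ∈ frontier Ω := hx
      have hxc := frontier_subset_closure hx
      have hnd : normalDeriv Ω (fun y => convexFactor c K y * v y) x =
          convexFactor c K x * normalDeriv Ω v x := by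
        rw [normalDeriv, fderiv_fun_mul
          ((contDiff_convexFactor c K).differentiable (by simp) x)
          (hv.differentiable (by simp) x)]
        simp [hv0 x hx, normalDeriv]
      rw [hnd, mul_pow]
      have q1 := hE1 x
      have q2 := hEM x hxc
      have q3 := abs_le.1 (hsmall x hxc)
      have q4 : weightSlope c (h * K) x = 1 + h * K * inner ℝ c x := rfl
      have q5 : inner ℝ (outerNormal Ω x) c ≤ 1 := by
        have := real_inner_le_norm (outerNormal Ω x) c
        rwa [norm_outerNormal hΩ hs hx, hc, one_mul] at this
      simp only [hf, Set.indicator, boundaryPart, Set.mem_ofPred_eq, hx, true_and, Set.mem_Iic,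
        Set.mem_Ioo, Set.mem_Ici]
      have q6 : 3 / 4 ≤ weightSlope c (h * K) x := by linarith [q3.1]
      have q7 : weightSlope c (h * K) x ≤ 5 / 4 := by linarith [q3.2]
      generalize weightSlope c (h * K) x = p at *
      generalize inner ℝ (outerNormal Ω x) c = ν at *
      generalize convexFactor c K x ^ 2 = E at *
      have q8 : 0 ≤ normalDeriv Ω v x ^ 2 := sq_nonneg _
      generalize normalDeriv Ω v x ^ 2 = β at *
      have q9 : β ≤ E * β := le_mul_of_one_le_left q8 q1
      rcases le_or_gt ν (-δ) with hA | hA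
      · have nB : ¬(-δ < ν ∧ ν < h / 3) := fun h => absurd hA (not_le.2 h.1)
        have nC : ¬(h / 3 ≤ ν) := not_le.2 (by linarith)
        simp only [hA, nB, nC, if_true, if_false, mul_zero, add_zero]
        have k1 := mul_le_mul_of_nonneg_right (boundaryCoefficient_of_le_neg hh hδ q6 hA)
          (q8.trans q9)
        have k2 := mul_le_mul_of_nonneg_left q9 (show 0 ≤ δ * h ^ 3 by positivity)
        linarith
      · have nA : ¬(ν ≤ -δ) := not_le.2 hA
        rcases lt_or_ge ν (h / 3) with hB | hB
        · have nC : ¬(h / 3 ≤ ν) := not_le.2 hB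
          simp only [hA, hB, nA, nC, if_true, if_false, and_self, mul_zero, add_zero, zero_add]
          have k1 := mul_le_mul_of_nonneg_right (boundaryCoefficient_of_lt hh q6 q7 hB)
            (q8.trans q9)
          have k2 := mul_le_mul_of_nonneg_left q9 (show 0 ≤ h ^ 4 / 6 by positivity)
          linarith
        · have nB : ¬(-δ < ν ∧ ν < h / 3) := fun h => absurd hB (not_le.2 h.2)
          simp only [hB, nA, nB, if_true, if_false, mul_zero, zero_add]
          have k1 := mul_le_mul_of_nonneg_right (boundaryCoefficient_le hh q6 q7 q5)
            (q8.trans q9)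
          have k2 := mul_le_mul_of_nonneg_left (mul_le_mul_of_nonneg_right q2 q8)
            (show 0 ≤ 5 / 2 * h ^ 3 by positivity)
          linarith
  have hh2 : 0 ≤ h ^ 2 / 2 := by positivity
  have := mul_le_mul_of_nonneg_left hlow hh2
  linarith

end

/-! ### Complex functions and the potential -/

section

variable {n : ℕ} {Ω : Set (EuclideanSpace ℝ (Fin n))} {σ : Measure (EuclideanSpace ℝ (Fin n))}

theorem normalDeriv_clm_comp {F G : Type*} [NormedAddCommGroup F] [NormedSpace ℝ F]
    [NormedAddCommGroup G] [NormedSpace ℝ G] (T : F →L[ℝ] G) {v : EuclideanSpace ℝ (Fin n) → F}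
    (hv : ContDiff ℝ ∞ v) (x : EuclideanSpace ℝ (Fin n)) :
    normalDeriv Ω (fun y => T (v y)) x = T (normalDeriv Ω v x) := by
  have h := T.hasFDerivAt.comp x (hv.differentiable (by simp) x).hasFDerivAt
  have h' : fderiv ℝ (fun y => T (v y)) x = _ := h.fderiv
  rw [normalDeriv, h']
  rfl

theorem sq_norm_eq_reCLM_add_imCLM (z : ℂ) :
    ‖z‖ ^ 2 = Complex.reCLM z ^ 2 + Complex.imCLM z ^ 2 := by
  rw [Complex.sq_norm, Complex.normSq_apply]
  simp only [Complex.reCLM_apply, Complex.imCLM_apply]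
  ring

/-- Carleman estimate for complex functions, the linear weight and the free operator. The operator
is real, so the real and imaginary parts can be estimated separately. -/
theorem IsBoundaryMeasure.carleman_free (hσ : IsBoundaryMeasure Ω σ) (hΩ : IsOpen Ω)
    (hb : Bornology.IsBounded Ω) (hs : HasSmoothBoundary Ω) {c : EuclideanSpace ℝ (Fin n)}
    (hc : ‖c‖ = 1) :
    ∃ M h₀ : ℝ, 1 ≤ M ∧ 0 < h₀ ∧ h₀ ≤ 1 ∧ ∀ h δ, 0 < h → h ≤ h₀ → 0 < δ →
      ∀ u : EuclideanSpace ℝ (Fin n) → ℂ, ContDiff ℝ ∞ u → (∀ x ∈ frontier Ω, u x = 0) →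
        δ * h ^ 3 * (∫ x in boundaryPart Ω c (Set.Iic (-δ)), ‖normalDeriv Ω u x‖ ^ 2 ∂σ) +
        h ^ 4 / 6 * (∫ x in boundaryPart Ω c (Set.Ioo (-δ) (h / 3)), ‖normalDeriv Ω u x‖ ^ 2 ∂σ) +
        h ^ 2 / 2 * (∫ x in Ω, (‖u x‖ ^ 2 + h ^ 2 * ∑ k, ‖partialDeriv k u x‖ ^ 2)) ≤
          3 * M * (∫ x in Ω, ‖freeOperator c h u x‖ ^ 2) +
          5 / 2 * M * h ^ 3 *
            (∫ x in boundaryPart Ω c (Set.Ici (h / 3)), ‖normalDeriv Ω u x‖ ^ 2 ∂σ) := by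
  obtain ⟨M, h₀, hM, hh₀, hh₀1, H⟩ := hσ.carleman_free_real hΩ hb hs hc
  refine ⟨M, h₀, hM, hh₀, hh₀1, fun h δ hh hhh hδ u hu hu0 => ?_⟩
  have hT : ∀ T : ℂ →L[ℝ] ℝ, ContDiff ℝ ∞ fun y => T (u y) := fun T => T.contDiff.comp hu
  have hbdi : ∀ (T : ℂ →L[ℝ] ℝ) (S : Set (EuclideanSpace ℝ (Fin n))),
      IntegrableOn (fun x => T (normalDeriv Ω u x) ^ 2) S σ := fun T S =>
    (ContinuousOn.integrable_boundaryMeasure hb hσ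
      ((T.continuous.comp_continuousOn (continuousOn_normalDeriv hΩ hs hu)).pow 2)).integrableOn
  have hΩi : ∀ f : EuclideanSpace ℝ (Fin n) → ℝ, Continuous f → Integrable f (volume.restrict Ω) :=
    fun f hf => hf.integrableOn_of_isBounded hb
  have c0 := hu.continuous
  have c1 := fun k => (hu.partialDeriv k).continuous
  have c2 := continuous_freeOperator c h hu
  have key := fun T : ℂ →L[ℝ] ℝ => H h δ hh hhh hδ _ (hT T) fun x hx => by rw [hu0 x hx, map_zero]
  simp only [normalDeriv_clm_comp _ hu, freeOperator_clm_comp _ c h hu,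
    partialDeriv_clm_comp _ hu] at key
  have e1 : ∀ S : Set (EuclideanSpace ℝ (Fin n)), ∫ x in S, ‖normalDeriv Ω u x‖ ^ 2 ∂σ =
      ∫ x in S, Complex.reCLM (normalDeriv Ω u x) ^ 2 ∂σ +
        ∫ x in S, Complex.imCLM (normalDeriv Ω u x) ^ 2 ∂σ := by
    intro S
    rw [← integral_add (hbdi _ S) (hbdi _ S)]
    simp_rw [sq_norm_eq_reCLM_add_imCLM]
  have e2 : ∫ x in Ω, ‖freeOperator c h u x‖ ^ 2 =
      (∫ x in Ω, Complex.reCLM (freeOperator c h u x) ^ 2) +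
        ∫ x in Ω, Complex.imCLM (freeOperator c h u x) ^ 2 := by
    rw [← integral_add (hΩi _ (by fun_prop)) (hΩi _ (by fun_prop))]
    simp_rw [sq_norm_eq_reCLM_add_imCLM]
  have e3 : ∫ x in Ω, (‖u x‖ ^ 2 + h ^ 2 * ∑ k, ‖partialDeriv k u x‖ ^ 2) =
      (∫ x in Ω, (Complex.reCLM (u x) ^ 2 + h ^ 2 * ∑ k, Complex.reCLM (partialDeriv k u x) ^ 2)) +
      ∫ x in Ω, (Complex.imCLM (u x) ^ 2 +
        h ^ 2 * ∑ k, Complex.imCLM (partialDeriv k u x) ^ 2) := by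
    rw [← integral_add (hΩi _ (by fun_prop)) (hΩi _ (by fun_prop))]
    congr 1
    ext x
    simp_rw [sq_norm_eq_reCLM_add_imCLM, Finset.sum_add_distrib]
    ring
  have k1 := key Complex.reCLM
  have k2 := key Complex.imCLM
  rw [e1, e1, e1, e2, e3]
  linarith

theorem exists_ae_norm_le_of_memLp_top {X F : Type*} [MeasurableSpace X] [NormedAddCommGroup F]
    {μ : Measure X} {q : X → F} (hq : MemLp q ⊤ μ) : ∃ Q : ℝ, ∀ᵐ x ∂μ, ‖q x‖ ≤ Q := by
  refine ⟨(eLpNorm q ⊤ μ).toReal, ?_⟩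
  have h := hq.eLpNorm_lt_top
  rw [eLpNorm_exponent_top] at h ⊢
  filter_upwards [ae_le_eLpNormEssSup (f := q) (μ := μ)] with x hx
  rw [← toReal_enorm]
  exact ENNReal.toReal_mono h.ne hx

/-- Carleman estimate for the conjugated Schrödinger operator; the potential is absorbed for small
`h`. -/
theorem IsBoundaryMeasure.carleman (hσ : IsBoundaryMeasure Ω σ) (hΩ : IsOpen Ω)
    (hb : Bornology.IsBounded Ω) (hs : HasSmoothBoundary Ω) {c : EuclideanSpace ℝ (Fin n)}
    (hc : ‖c‖ = 1) {q : EuclideanSpace ℝ (Fin n) → ℂ} (hq : MemLp q ⊤ (volume.restrict Ω)) :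
    ∃ M h₀ : ℝ, 1 ≤ M ∧ 0 < h₀ ∧ ∀ h δ, 0 < h → h ≤ h₀ → 0 < δ →
      ∀ u : EuclideanSpace ℝ (Fin n) → ℂ, ContDiff ℝ ∞ u → (∀ x ∈ frontier Ω, u x = 0) →
        IntegrableOn (fun x => ‖conjugatedSchrodinger (fun x => inner ℝ c x) q h u x‖ ^ 2) Ω ∧
        δ * h ^ 3 * (∫ x in boundaryPart Ω c (Set.Iic (-δ)), ‖normalDeriv Ω u x‖ ^ 2 ∂σ) +
        h ^ 4 / 6 * (∫ x in boundaryPart Ω c (Set.Ioo (-δ) (h / 3)), ‖normalDeriv Ω u x‖ ^ 2 ∂σ) +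
        h ^ 2 / 4 * (∫ x in Ω, (‖u x‖ ^ 2 + h ^ 2 * ∑ k, ‖partialDeriv k u x‖ ^ 2)) ≤
          6 * M * (∫ x in Ω, ‖conjugatedSchrodinger (fun x => inner ℝ c x) q h u x‖ ^ 2) +
          5 / 2 * M * h ^ 3 *
            (∫ x in boundaryPart Ω c (Set.Ici (h / 3)), ‖normalDeriv Ω u x‖ ^ 2 ∂σ) := by
  obtain ⟨M, h₀, hM, hh₀, hh₀1, H⟩ := hσ.carleman_free hΩ hb hs hc
  obtain ⟨Q, hQ⟩ := exists_ae_norm_le_of_memLp_top hq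
  have hM0 : 0 < M := by linarith
  refine ⟨M, min h₀ (1 / (24 * M * (Q ^ 2 + 1))), hM, by positivity,
    fun h δ hh hhh hδ u hu hu0 => ?_⟩
  have hh1 : h ≤ h₀ := hhh.trans (min_le_left _ _)
  have hhQ : 24 * M * Q ^ 2 * h ^ 2 ≤ 1 := by
    have h1 := hhh.trans (min_le_right _ _)
    rw [le_div_iff₀ (by positivity)] at h1
    have h2 : h ^ 2 ≤ h := by nlinarith
    have h3 := mul_le_mul_of_nonneg_left h2 (show 0 ≤ 24 * M * Q ^ 2 by positivity)
    have h4 : 0 ≤ h * (24 * M) := by positivity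
    linarith
  have c0 := hu.continuous
  have c1 := fun k => (hu.partialDeriv k).continuous
  have c2 := continuous_freeOperator c h hu
  have hΩi : ∀ f : EuclideanSpace ℝ (Fin n) → ℝ, Continuous f → Integrable f (volume.restrict Ω) :=
    fun f hf => hf.integrableOn_of_isBounded hb
  have hpar : ∀ a b : ℂ, ‖a + b‖ ^ 2 ≤ 2 * ‖a‖ ^ 2 + 2 * ‖b‖ ^ 2 := by
    intro a b
    have h1 := norm_add_le a b
    nlinarith [norm_nonneg (a + b), sq_nonneg (‖a‖ - ‖b‖)]
  have hqu : ∀ᵐ x ∂(volume.restrict Ω), ‖(h : ℂ) ^ 2 * q x * u x‖ ^ 2 ≤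
      h ^ 4 * Q ^ 2 * ‖u x‖ ^ 2 := by
    filter_upwards [hQ] with x hx
    rw [norm_mul, norm_mul, norm_pow, Complex.norm_real, Real.norm_of_nonneg hh.le, mul_pow,
      mul_pow, ← pow_mul]
    gcongr
  have hP := conjugatedSchrodinger_eq hc q hh.ne' hu
  have hPm : AEStronglyMeasurable (conjugatedSchrodinger (fun x => inner ℝ c x) q h u)
      (volume.restrict Ω) := by
    rw [show conjugatedSchrodinger (fun x => inner ℝ c x) q h u =
      fun x => freeOperator c h u x + h ^ 2 * q x * u x from funext hP]
    exact c2.aestronglyMeasurable.add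
      ((aestronglyMeasurable_const.mul hq.1).mul c0.aestronglyMeasurable)
  have hPi : IntegrableOn
      (fun x => ‖conjugatedSchrodinger (fun x => inner ℝ c x) q h u x‖ ^ 2) Ω := by
    refine Integrable.mono' (hΩi (fun x => 2 * ‖freeOperator c h u x‖ ^ 2 +
      2 * (h ^ 4 * Q ^ 2 * ‖u x‖ ^ 2)) (by fun_prop)) (hPm.norm.pow 2) ?_
    filter_upwards [hqu] with x hx
    rw [Real.norm_of_nonneg (by positivity), hP]
    linarith [hpar (freeOperator c h u x) (h ^ 2 * q x * u x)]
  refine ⟨hPi, ?_⟩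
  have main := H h δ hh hh1 hδ u hu hu0
  have hfree : ∫ x in Ω, ‖freeOperator c h u x‖ ^ 2 ≤
      2 * (∫ x in Ω, ‖conjugatedSchrodinger (fun x => inner ℝ c x) q h u x‖ ^ 2) +
        2 * (h ^ 4 * Q ^ 2) *
          ∫ x in Ω, (‖u x‖ ^ 2 + h ^ 2 * ∑ k, ‖partialDeriv k u x‖ ^ 2) := by
    have hi : Integrable (fun x => ‖u x‖ ^ 2 + h ^ 2 * ∑ k, ‖partialDeriv k u x‖ ^ 2)
        (volume.restrict Ω) := hΩi _ (by fun_prop)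
    rw [← integral_const_mul, ← integral_const_mul,
      ← integral_add (hPi.const_mul 2) (hi.const_mul _)]
    refine integral_mono_ae (hΩi _ (by fun_prop)) ((hPi.const_mul 2).add (hi.const_mul _)) ?_
    filter_upwards [hqu] with x hx
    have h1 := hpar (conjugatedSchrodinger (fun x => inner ℝ c x) q h u x)
      (-(h ^ 2 * q x * u x))
    have h2 : conjugatedSchrodinger (fun x => inner ℝ c x) q h u x + -(h ^ 2 * q x * u x) =
        freeOperator c h u x := by
      rw [hP]
      ring
    rw [h2, norm_neg] at h1
    have h3 : 0 ≤ h ^ 4 * Q ^ 2 * (h ^ 2 * ∑ k, ‖partialDeriv k u x‖ ^ 2) :=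
      mul_nonneg (by positivity) (mul_nonneg (by positivity)
        (Finset.sum_nonneg fun k _ => by positivity))
    linarith
  have hJ : 0 ≤ ∫ x in Ω, (‖u x‖ ^ 2 + h ^ 2 * ∑ k, ‖partialDeriv k u x‖ ^ 2) :=
    integral_nonneg fun x => add_nonneg (by positivity) (mul_nonneg (by positivity)
        (Finset.sum_nonneg fun k _ => by positivity))
  generalize (∫ x in Ω, (‖u x‖ ^ 2 + h ^ 2 * ∑ k, ‖partialDeriv k u x‖ ^ 2)) = J at *
  have h1 := mul_le_mul_of_nonneg_left hfree (show 0 ≤ 3 * M by positivity)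
  have h2 : 3 * M * (2 * (h ^ 4 * Q ^ 2) * J) ≤ h ^ 2 / 4 * J := by
    have := mul_le_mul_of_nonneg_right hhQ (show 0 ≤ h ^ 2 / 4 * J by positivity)
    linarith
  linarith

/-! ### Extended real form of the estimate -/

theorem sqNormL2_eq_lintegral {X F : Type*} [MeasurableSpace X] [NormedAddCommGroup F]
    (f : X → F) (S : Set X) (μ : Measure X) : sqNormL2 f S μ = ∫⁻ x in S, ‖f x‖ₑ ^ 2 ∂μ := by
  have h := eLpNorm_nnreal_pow_eq_lintegral (f := f) (μ := μ.restrict S) (p := 2) two_ne_zero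
  simpa [sqNormL2] using h

theorem sqNormL2_eq_ofReal {X F : Type*} [MeasurableSpace X] [NormedAddCommGroup F]
    {f : X → F} {S : Set X} {μ : Measure X} (hf : IntegrableOn (fun x => ‖f x‖ ^ 2) S μ) :
    sqNormL2 f S μ = ENNReal.ofReal (∫ x in S, ‖f x‖ ^ 2 ∂μ) := by
  rw [sqNormL2_eq_lintegral, ofReal_integral_eq_lintegral_ofReal hf
    (Filter.Eventually.of_forall fun x => by positivity)]
  congr 1
  ext x
  rw [ENNReal.ofReal_pow (norm_nonneg _), ofReal_norm]

theorem sqNormL2_le_of_le_smul {X F : Type*} [MeasurableSpace X] [NormedAddCommGroup F]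
    {μ μ' : Measure X} {C : NNReal} (h : μ ≤ C • μ') (f : X → F) (S : Set X) :
    sqNormL2 f S μ ≤ C * sqNormL2 f S μ' := by
  rw [sqNormL2_eq_lintegral, sqNormL2_eq_lintegral]
  calc ∫⁻ x in S, ‖f x‖ₑ ^ 2 ∂μ ≤ ∫⁻ x in S, ‖f x‖ₑ ^ 2 ∂(C • μ') :=
        lintegral_mono' (Measure.restrict_mono_measure h S) le_rfl
    _ = _ := by
        rw [Measure.restrict_smul, ENNReal.smul_def, lintegral_smul_measure, smul_eq_mul]

theorem sq_norm_smul_complexGradient (u : EuclideanSpace ℝ (Fin n) → ℂ) (h : ℝ)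
    (x : EuclideanSpace ℝ (Fin n)) :
    ‖h • complexGradient u x‖ ^ 2 = h ^ 2 * ∑ k, ‖partialDeriv k u x‖ ^ 2 := by
  rw [norm_smul, mul_pow, EuclideanSpace.norm_sq_eq]
  simp [complexGradient, partialDeriv]

theorem normalDeriv_inner (c x : EuclideanSpace ℝ (Fin n)) :
    normalDeriv Ω (fun y => (inner ℝ c y : ℝ)) x = inner ℝ (outerNormal Ω x) c := by
  have h : HasFDerivAt (fun y => (inner ℝ c y : ℝ)) (innerSL ℝ c) x := (innerSL ℝ c).hasFDerivAt
  rw [normalDeriv, h.fderiv, innerSL_apply_apply, real_inner_comm]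

end

theorem proposition4p2 (n : ℕ) (hn : 2 ≤ n) (Ω : Set (EuclideanSpace ℝ (Fin n)))
    (hΩ_open : IsOpen Ω) (hΩ_bdd : Bornology.IsBounded Ω) (hΩ_smooth : HasSmoothBoundary Ω)
    (q : EuclideanSpace ℝ (Fin n) → ℂ) (hq : MemLp q ∞ (volume.restrict Ω))
    (s : ℝ) (hs : s = 1 ∨ s = -1)
    (φ : EuclideanSpace ℝ (Fin n) → ℝ) (hφ : ∀ x, φ x = s * x ⟨0, by omega⟩) :
    ∃ C₀ h₀ : ℝ, 0 < C₀ ∧ 0 < h₀ ∧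
      ∀ h δ : ℝ, 0 < h → h ≤ h₀ → 0 < δ →
        ∀ u : EuclideanSpace ℝ (Fin n) → ℂ, ContDiff ℝ ∞ u → (∀ x ∈ frontier Ω, u x = 0) →
          ENNReal.ofReal (δ * h ^ 3 / C₀) *
              sqNormL2 (normalDeriv Ω u)
                {x ∈ frontier Ω | normalDeriv Ω φ x ≤ -δ} (surfaceMeasure Ω) +
            ENNReal.ofReal (h ^ 4 / C₀) *
              sqNormL2 (normalDeriv Ω u)
                {x ∈ frontier Ω | -δ < normalDeriv Ω φ x ∧ normalDeriv Ω φ x < h / 3} (surfaceMeasure Ω) +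
            ENNReal.ofReal (h ^ 2 / C₀) *
              (sqNormL2 u Ω volume + sqNormL2 (fun x => h • complexGradient u x) Ω volume)
          ≤ sqNormL2 (conjugatedSchrodinger φ q h u) Ω volume +
            ENNReal.ofReal (h ^ 3) *
              sqNormL2 (normalDeriv Ω u)
                {x ∈ frontier Ω | h / 3 ≤ normalDeriv Ω φ x} (surfaceMeasure Ω) := by
  obtain ⟨c, hc, hφc⟩ : ∃ c : EuclideanSpace ℝ (Fin n), ‖c‖ = 1 ∧ φ = fun x => inner ℝ c x := by
    refine ⟨EuclideanSpace.single ⟨0, by omega⟩ s, ?_, ?_⟩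
    · rw [PiLp.norm_single]
      rcases hs with rfl | rfl <;> simp
    · ext x
      rw [hφ, EuclideanSpace.inner_single_left]
      simp
  subst hφc
  obtain ⟨σ, hσfin, hσ0, ⟨C, hσC, hCσ⟩, hdiv⟩ :=
    exists_boundary_measure hΩ_open hΩ_bdd hΩ_smooth
  have hσ : IsBoundaryMeasure Ω σ := ⟨hσfin, hσ0, hdiv⟩
  obtain ⟨M, h₀, hM, hh₀, H⟩ := hσ.carleman hΩ_open hΩ_bdd hΩ_smooth hc hq
  -- a constant `B ≥ 1` that compares the two boundary measures
  obtain ⟨B, hB1, hσB, hBσ⟩ : ∃ B : NNReal, 1 ≤ B ∧ σ ≤ B • surfaceMeasure Ω ∧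
      surfaceMeasure Ω ≤ B • σ := by
    refine ⟨max C 1, le_max_right _ _, hσC.trans fun A => ?_, hCσ.trans fun A => ?_⟩ <;>
    · simp only [Measure.smul_apply, ENNReal.smul_def, smul_eq_mul]
      gcongr
      exact le_max_left _ _
  have hM0 : 0 < M := by linarith
  have hB1' : (1 : ℝ) ≤ B := by exact_mod_cast hB1
  have hB0 : (0 : ℝ) < B := by linarith
  refine ⟨36 * M * B ^ 2, h₀, by positivity, hh₀, fun h δ hh hhh hδ u hu hu0 => ?_⟩
  obtain ⟨hPi, key⟩ := H h δ hh hhh hδ u hu hu0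
  simp only [normalDeriv_inner]
  have hi : ∀ S : Set (EuclideanSpace ℝ (Fin n)),
      IntegrableOn (fun x => ‖normalDeriv Ω u x‖ ^ 2) S σ := fun S =>
    (ContinuousOn.integrable_boundaryMeasure hΩ_bdd hσ
      ((continuousOn_normalDeriv hΩ_open hΩ_smooth hu).norm.pow 2)).integrableOn
  have hle : ∀ S : Set (EuclideanSpace ℝ (Fin n)), sqNormL2 (normalDeriv Ω u) S (surfaceMeasure Ω) ≤
      ENNReal.ofReal (B * ∫ x in S, ‖normalDeriv Ω u x‖ ^ 2 ∂σ) := by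
    intro S
    rw [ENNReal.ofReal_mul hB0.le, ENNReal.ofReal_coe_nnreal, ← sqNormL2_eq_ofReal (hi S)]
    exact sqNormL2_le_of_le_smul hBσ _ _
  have hge : ∀ S : Set (EuclideanSpace ℝ (Fin n)),
      ENNReal.ofReal ((B : ℝ)⁻¹ * ∫ x in S, ‖normalDeriv Ω u x‖ ^ 2 ∂σ) ≤
        sqNormL2 (normalDeriv Ω u) S (surfaceMeasure Ω) := by
    intro S
    rw [ENNReal.ofReal_mul (by positivity), ENNReal.ofReal_inv_of_pos hB0,
      ENNReal.ofReal_coe_nnreal, ← sqNormL2_eq_ofReal (hi S)]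
    rw [ENNReal.inv_mul_le_iff (by exact_mod_cast hB0.ne') ENNReal.coe_ne_top]
    exact sqNormL2_le_of_le_smul hσB _ _
  have c0 := hu.continuous
  have c1 := fun k => (hu.partialDeriv k).continuous
  have i1 : IntegrableOn (fun x => ‖u x‖ ^ 2) Ω :=
    Continuous.integrableOn_of_isBounded hΩ_bdd (by fun_prop)
  have i2 : IntegrableOn (fun x => ‖h • complexGradient u x‖ ^ 2) Ω := by
    simp_rw [sq_norm_smul_complexGradient]
    exact Continuous.integrableOn_of_isBounded hΩ_bdd (by fun_prop)
  simp_rw [← sq_norm_smul_complexGradient] at key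
  rw [integral_add i1 i2] at key
  rw [sqNormL2_eq_ofReal i1, sqNormL2_eq_ofReal i2, sqNormL2_eq_ofReal hPi]
  have hA := hle (boundaryPart Ω c (Set.Iic (-δ)))
  have hB := hle (boundaryPart Ω c (Set.Ioo (-δ) (h / 3)))
  have hC := hge (boundaryPart Ω c (Set.Ici (h / 3)))
  have nA : 0 ≤ ∫ x in boundaryPart Ω c (Set.Iic (-δ)), ‖normalDeriv Ω u x‖ ^ 2 ∂σ :=
    integral_nonneg fun x => by positivity
  have nB : 0 ≤ ∫ x in boundaryPart Ω c (Set.Ioo (-δ) (h / 3)), ‖normalDeriv Ω u x‖ ^ 2 ∂σ :=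
    integral_nonneg fun x => by positivity
  have nC : 0 ≤ ∫ x in boundaryPart Ω c (Set.Ici (h / 3)), ‖normalDeriv Ω u x‖ ^ 2 ∂σ :=
    integral_nonneg fun x => by positivity
  have nU : 0 ≤ ∫ x in Ω, ‖u x‖ ^ 2 := integral_nonneg fun x => by positivity
  have nV : 0 ≤ ∫ x in Ω, ‖h • complexGradient u x‖ ^ 2 := integral_nonneg fun x => by positivity
  have nP : 0 ≤ ∫ x in Ω, ‖conjugatedSchrodinger (fun x => inner ℝ c x) q h u x‖ ^ 2 :=
    integral_nonneg fun x => by positivity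
  generalize (∫ x in boundaryPart Ω c (Set.Iic (-δ)), ‖normalDeriv Ω u x‖ ^ 2 ∂σ) = a at *
  generalize (∫ x in boundaryPart Ω c (Set.Ioo (-δ) (h / 3)), ‖normalDeriv Ω u x‖ ^ 2 ∂σ) = b at *
  generalize (∫ x in boundaryPart Ω c (Set.Ici (h / 3)), ‖normalDeriv Ω u x‖ ^ 2 ∂σ) = r at *
  generalize (∫ x in Ω, ‖u x‖ ^ 2) = U at *
  generalize (∫ x in Ω, ‖h • complexGradient u x‖ ^ 2) = V at *
  generalize (∫ x in Ω, ‖conjugatedSchrodinger (fun x => inner ℝ c x) q h u x‖ ^ 2) = P at *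
  -- after division by `36 M B²` the real estimate has the required coefficients
  have hreal : δ * h ^ 3 / (36 * M * B ^ 2) * (B * a) + h ^ 4 / (36 * M * B ^ 2) * (B * b) +
      h ^ 2 / (36 * M * B ^ 2) * (U + V) ≤ P + h ^ 3 * ((B : ℝ)⁻¹ * r) := by
    have t1 : 0 ≤ δ * h ^ 3 * a := by positivity
    have t2 : 0 ≤ h ^ 2 * (U + V) := by positivity
    have t3 : h ^ 2 * (U + V) ≤ B * (h ^ 2 * (U + V)) := le_mul_of_one_le_left t2 hB1'
    have t4 : 0 ≤ M * h ^ 3 * r := by positivity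
    have t5 : M * P ≤ B * (M * P) := le_mul_of_one_le_left (by positivity) hB1'
    have t6 : δ * h ^ 3 * (B * a) + h ^ 4 * (B * b) + h ^ 2 * (U + V) ≤
        B * (36 * M * P + 15 * M * h ^ 3 * r) := by
      have := mul_le_mul_of_nonneg_left key (show (0 : ℝ) ≤ 6 * B by positivity)
      have t7 : 0 ≤ B * (δ * h ^ 3 * a) := by positivity
      have t8 : 0 ≤ B * (h ^ 2 * (U + V)) := by positivity
      linarith
    have t9 : B * (36 * M * P + 15 * M * h ^ 3 * r) ≤
        (P + h ^ 3 * ((B : ℝ)⁻¹ * r)) * (36 * M * B ^ 2) := by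
      have e : (P + h ^ 3 * ((B : ℝ)⁻¹ * r)) * (36 * M * B ^ 2) =
          B * (36 * (B * (M * P)) + 36 * (M * h ^ 3 * r)) := by
        field_simp
      rw [e]
      refine mul_le_mul_of_nonneg_left ?_ hB0.le
      linarith
    have e : δ * h ^ 3 / (36 * M * B ^ 2) * (B * a) + h ^ 4 / (36 * M * B ^ 2) * (B * b) +
        h ^ 2 / (36 * M * B ^ 2) * (U + V) =
        (δ * h ^ 3 * (B * a) + h ^ 4 * (B * b) + h ^ 2 * (U + V)) / (36 * M * B ^ 2) := by
      ring
    rw [e, div_le_iff₀ (by positivity)]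
    exact t6.trans t9
  calc _ ≤ ENNReal.ofReal (δ * h ^ 3 / (36 * M * B ^ 2)) * ENNReal.ofReal (B * a) +
        ENNReal.ofReal (h ^ 4 / (36 * M * B ^ 2)) * ENNReal.ofReal (B * b) +
        ENNReal.ofReal (h ^ 2 / (36 * M * B ^ 2)) * (ENNReal.ofReal U + ENNReal.ofReal V) := by
        gcongr
        · exact hA
        · exact hB
    _ = ENNReal.ofReal (δ * h ^ 3 / (36 * M * B ^ 2) * (B * a) +
        h ^ 4 / (36 * M * B ^ 2) * (B * b) + h ^ 2 / (36 * M * B ^ 2) * (U + V)) := by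
        rw [← ENNReal.ofReal_add nU nV, ← ENNReal.ofReal_mul (by positivity),
          ← ENNReal.ofReal_mul (by positivity), ← ENNReal.ofReal_mul (by positivity),
          ← ENNReal.ofReal_add (by positivity) (by positivity),
          ← ENNReal.ofReal_add (by positivity) (by positivity)]
    _ ≤ ENNReal.ofReal (P + h ^ 3 * ((B : ℝ)⁻¹ * r)) := ENNReal.ofReal_le_ofReal hreal
    _ = ENNReal.ofReal P + ENNReal.ofReal (h ^ 3) * ENNReal.ofReal ((B : ℝ)⁻¹ * r) := by
        rw [ENNReal.ofReal_add nP (by positivity), ENNReal.ofReal_mul (by positivity)]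
    _ ≤ _ := by
        gcongr
        exact hC
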